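/- Let $G$ be a connected and simply connected nilpotent Lie group with Lie algebra $\mathfrak g$, let $\log : G\to\mathfrak g$ be the inverse of the exponential map, and fix a linear complement $\mathfrak g^{(1)}$ of $[\mathfrak g,\mathfrak g]$ in $\mathfrak g$ together with a basis $X_1,\dots,X_d$ of $\mathfrak g^{(1)}$, by which $\mathfrak g^{(1)}$ is identified with the Euclidean space $\mathbb R^d$. Write $Z|_{\mathfrak g^{(1)}}$ for the projection of $Z\in\mathfrak g$ to $\mathfrak g^{(1)}$ along $[\mathfrak g,\mathfrak g]$. Let $\Gamma\subset G$ be a discrete subgroup such that $\Gamma\backslash G$ is compact. Let $X=(V,E)$ be a connected graph ($E$ is the set of oriented edges; $o(e)$, $t(e)$, $\bar e$ are the origin, the terminus and the inverse of $e$; loops and multiple edges are allowed) which is a regular covering of a finite graph $X_0=\Gamma\backslash X=(V_0,E_0)$ with covering transformation group $\Gamma$. Let $\Phi:V\to G$ satisfy $\Phi(\gamma y)=\gamma\cdot\Phi(y)$ for $\gamma\in\Gamma$, $y\in V$. Let $p:E_0\to(0,1]$ satisfy $\sum_{e\in E_0,\,o(e)=y}p(e)=1$ for every $y\in V_0$,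 and let $p$ also denote its $\Gamma$-invariant lift to $E$. Let $m$ be the normalized invariant probability of the induced random walk on $X_0$, and put $\widetilde m(e)=p(e)m(o(e))$ and $\gamma_p=\sum_{e\in E_0}\widetilde m(e)e\in \mathrm H_1(X_0,\mathbb R)$. Let $\rho_{\mathbb R}:\mathrm H_1(X_0,\mathbb R)\to\mathfrak g^{(1)}$ be the linear map induced by the canonical surjection $\pi_1(X_0)\to\Gamma$: the class of a closed path of $X_0$ that lifts to a path in $X$ from $y$ to $\gamma y$ is sent to $\log\gamma|_{\mathfrak g^{(1)}}$. Identify $\mathrm H^1(X_0,\mathbb R)=\mathrm H_1(X_0,\mathbb R)^*$ with the space of modified harmonic $1$-forms, that is, of $\omega:E_0\to\mathbb R$ with $\omega(\bar e)=-\omega(e)$ and $\sum_{o(e)=y}p(e)\omega(e)=\langle\gamma_p,\omega\rangle$ for every $y\in V_0$, and equip it with the inner product $$\langle\!\langle\omega_1,\omega_2\rangle\!\rangle_p=\sum_{e\in E_0}\widetilde m(e)\omega_1(e)\omega_2(e)-\langle\gamma_p,\omega_1\rangle\langle\gamma_p,\omega_2\rangle .$$ The Albanese metric $g_0$ is the inner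 product on $\mathfrak g^{(1)}$ dual to the restriction of $\langle\!\langle\cdot,\cdot\rangle\!\rangle_p$ to $\mathrm{Hom}(\mathfrak g^{(1)},\mathbb R)$, which is embedded in $\mathrm H^1(X_0,\mathbb R)$ by the transpose of $\rho_{\mathbb R}$. Put $\Sigma^{-1}=(\langle X_i,X_j\rangle_{g_0})_{i,j=1}^{d}$. Fix $x\in V$. Let $\mathbb P_x$ be the law, on the space $\Omega_x(X)$ of infinite paths $c=(e_1,e_2,\dots)$ in $X$ starting at $x$, of the random walk with transition probability $p$, and let $w_k(c)=o(e_{k+1})$. Put $\Xi_k=\log\Phi(w_k)|_{\mathfrak g^{(1)}}$ and $\overline W_k=\Xi_k-\Xi_{k-1}-\rho_{\mathbb R}(\gamma_p)$ for $k\ge1$. Let $(a_n)_{n\ge1}$ be a monotone increasing sequence of positive real numbers with $a_n/\sqrt n\to+\infty$ and $a_n/n\to0$, and put $$Z^{(n)}_t=\frac1{a_n}\Big(\overline W_1+\cdots+\overline W_{[nt]}+(nt-[nt])\,\overline W_{[nt]+1}\Big),\qquad 0\le t\le1 .$$ Let $\mathrm{AC}_0([0,1];\mathfrak g^{(1)})$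 be the space of absolutely continuous paths $h:[0,1]\to\mathfrak g^{(1)}$ with $h(0)=0$, equipped with the topology of uniform convergence, and let $$I'(h)=\int_0^1\tfrac12\big\langle\Sigma^{-1}\dot h(t),\dot h(t)\big\rangle\,dt\in[0,\infty],\qquad h\in \mathrm{AC}_0([0,1];\mathfrak g^{(1)}).$$ Then $I'$ is a good rate function on $\mathrm{AC}_0([0,1];\mathfrak g^{(1)})$ (it is lower semicontinuous and its sublevel sets $\{I'\le r\}$, $r<\infty$, are compact), and $(Z^{(n)})_{n\ge1}$ satisfies the moderate deviation principle in $\mathrm{AC}_0([0,1];\mathfrak g^{(1)})$ with speed $a_n^2/n$ and rate function $I'$: for every Borel set $A\subset\mathrm{AC}_0([0,1];\mathfrak g^{(1)})$, with interior $A^\circ$ and closure $\overline A$, $$-\inf_{h\in A^\circ}I'(h)\le\liminf_{n\to\infty}\frac n{a_n^2}\log\mathbb P_x(Z^{(n)}\in A)\le\limsup_{n\to\infty}\frac n{a_n^2}\log\mathbb P_x(Z^{(n)}\in A)\le-\inf_{h\in\overline A}I'(h).$$ -/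

import Mathlib

open MeasureTheory Filter Topology
open scoped ENNReal NNReal unitInterval

noncomputable section

namespace CoveringMDP

/-! ### Simply connected nilpotent Lie groups in exponential coordinates -/

section Nilpotent

variable {𝔤 : Type*} [LieRing 𝔤]

/-- The right-nested bracket `[a₁, [a₂, … [aₘ₋₁, aₘ]…]]` of a word in a Lie algebra. -/
def nestedBracket : List 𝔤 → 𝔤
  | [] => 0
  | [a] => a
  | a :: b :: l => ⁅a, nestedBracket (b :: l)⁆

/-- The word `X^{r₁} Y^{s₁} ⋯ X^{rₖ} Y^{sₖ}` attached to the exponents `(rᵢ, sᵢ)`. -/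
def bchWord {𝔤 : Type*} (X Y : 𝔤) (q : List (ℕ × ℕ)) : List 𝔤 :=
  q.flatMap fun rs => List.replicate rs.1 X ++ List.replicate rs.2 Y

/-- The coefficient of the word `X^{r₁} Y^{s₁} ⋯ X^{rₖ} Y^{sₖ}` in Dynkin's form of the
Baker–Campbell–Hausdorff series:
`((-1)^(k-1) / k) * 1 / ((∑ (rᵢ + sᵢ)) * ∏ rᵢ! sᵢ!)`; it is `0` if some `(rᵢ, sᵢ)` is `(0, 0)`
(such index vectors are not part of the series). -/
def bchCoeff {k : ℕ} (q : Fin (k + 1) → ℕ × ℕ) : ℝ :=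
  if ∀ i, 0 < (q i).1 + (q i).2 then
    ((-1) ^ k / (k + 1)) *
      (((∑ i, ((q i).1 + (q i).2) : ℕ) : ℝ) *
        ∏ i, (((q i).1.factorial : ℝ) * ((q i).2.factorial : ℝ)))⁻¹
  else 0

/-- The Baker–Campbell–Hausdorff product `log (exp X · exp Y)` of a nilpotent real Lie algebra.
With `r` the step number, every nested bracket of more than `r` letters vanishes, so that the
Dynkin series is the finite sum over `1 ≤ k ≤ r` and `rᵢ, sᵢ ≤ r`. -/
def bch [LieAlgebra ℝ 𝔤] (X Y : 𝔤) : 𝔤 :=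
  ∑ k ∈ Finset.range (LieModule.nilpotencyLength 𝔤 𝔤),
    ∑ q : Fin (k + 1) → Fin (LieModule.nilpotencyLength 𝔤 𝔤 + 1) ×
        Fin (LieModule.nilpotencyLength 𝔤 𝔤 + 1),
      bchCoeff (fun i => (((q i).1 : ℕ), ((q i).2 : ℕ))) •
        nestedBracket (bchWord X Y (List.ofFn fun i => (((q i).1 : ℕ), ((q i).2 : ℕ))))

end Nilpotent

/-- The connected and simply connected nilpotent Lie group with Lie algebra `𝔤`, in exponential
coordinates: the exponential map `exp : 𝔤 → G` is a bijection (a diffeomorphism) with inverse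
`log : G → 𝔤`, and `exp X * exp Y` is the exponential of the Baker–Campbell–Hausdorff product. -/
@[ext]
structure NilpotentLieGroup (𝔤 : Type*) where
  /-- The exponential map. -/
  exp ::
  /-- The inverse of the exponential map. -/
  log : 𝔤

instance {𝔤 : Type*} [LieRing 𝔤] [LieAlgebra ℝ 𝔤] : Mul (NilpotentLieGroup 𝔤) :=
  ⟨fun g h => .exp (bch g.log h.log)⟩

instance {𝔤 : Type*} [TopologicalSpace 𝔤] : TopologicalSpace (NilpotentLieGroup 𝔤) :=
  TopologicalSpace.induced NilpotentLieGroup.log inferInstance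

theorem length_bchWord {𝔤 : Type*} (X Y : 𝔤) (q : List (ℕ × ℕ)) :
    (bchWord X Y q).length = (q.map fun rs => rs.1 + rs.2).sum := by
  induction q with
  | nil => simp [bchWord]
  | cons a q ih =>
    simp only [bchWord, List.flatMap_cons, List.length_append, List.length_replicate,
      List.map_cons, List.sum_cons] at ih ⊢
    omega

theorem mem_bchWord {𝔤 : Type*} {X Y a : 𝔤} {q : List (ℕ × ℕ)} (h : a ∈ bchWord X Y q) :
    a = X ∨ a = Y := by
  simp only [bchWord, List.mem_flatMap, List.mem_append, List.mem_replicate] at h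
  obtain ⟨_, _, h | h⟩ := h
  · exact Or.inl h.2
  · exact Or.inr h.2

section NilpotentLemmas

variable {𝔤 : Type*} [LieRing 𝔤] [LieAlgebra ℝ 𝔤]

variable (𝔤) in
/-- The second term `𝔫₂ = [𝔤, 𝔤]` of the lower central series `𝔫₁ = 𝔤`, `𝔫ₖ₊₁ = [𝔤, 𝔫ₖ]`. -/
def commutatorPart : Submodule ℝ 𝔤 :=
  (LieModule.lowerCentralSeries ℝ 𝔤 𝔤 1).toSubmodule

theorem nestedBracket_mem_commutatorPart (l : List 𝔤) (hl : 2 ≤ l.length) :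
    nestedBracket l ∈ commutatorPart 𝔤 := by
  match l, hl with
  | a :: b :: l, _ =>
    simp only [nestedBracket, commutatorPart, LieSubmodule.mem_toSubmodule]
    rw [show (1 : ℕ) = 0 + 1 from rfl, LieModule.lowerCentralSeries_succ]
    exact LieSubmodule.lie_mem_lie (by simp) (by simp)

theorem nestedBracket_eq_zero_of_smul (X : 𝔤) (l : List 𝔤) (hl : 2 ≤ l.length)
    (h : ∀ a ∈ l, ∃ s : ℝ, a = s • X) : nestedBracket l = 0 := by
  induction l with
  | nil => simp at hl
  | cons a l ih =>
    match l, hl with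
    | [b], _ =>
      obtain ⟨s, rfl⟩ := h a (by simp)
      obtain ⟨t, rfl⟩ := h b (by simp)
      simp [nestedBracket]
    | b :: c :: l, _ =>
      have := ih (by simp) (fun a ha => h a (by simp [ha]))
      simp only [nestedBracket] at this ⊢
      rw [this, lie_zero]

/-- Modulo any subspace that contains the nested brackets of at least two letters, the
Baker–Campbell–Hausdorff product is addition. -/
theorem bch_sub_mem [LieRing.IsNilpotent 𝔤] (X Y : 𝔤) (S : Submodule ℝ 𝔤)
    (hS : ∀ l : List 𝔤, (∀ a ∈ l, a = X ∨ a = Y) → 2 ≤ l.length → nestedBracket l ∈ S) :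
    bch X Y - (X + Y) ∈ S := by
  rcases hN : LieModule.nilpotencyLength 𝔤 𝔤 with - | n
  · have : Subsingleton 𝔤 := (LieModule.nilpotencyLength_eq_zero_iff 𝔤 𝔤).mp hN
    rw [Subsingleton.elim (bch X Y - (X + Y)) 0]
    exact S.zero_mem
  have key : ∀ (k : ℕ) (q : Fin (k + 1) → ℕ × ℕ), 2 ≤ ∑ i, ((q i).1 + (q i).2) →
      bchCoeff q • nestedBracket (bchWord X Y (List.ofFn q)) ∈ S := by
    intro k q hq
    refine S.smul_mem _ (hS _ (fun a ha => mem_bchWord ha) ?_)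
    rw [length_bchWord, List.map_ofFn, List.sum_ofFn]
    exact hq
  unfold bch
  rw [hN, Finset.sum_range_succ', add_sub_assoc]
  refine S.add_mem (S.sum_mem fun k _ => S.sum_mem fun q _ => ?_) ?_
  · by_cases h : ∀ i, 0 < ((q i).1 : ℕ) + ((q i).2 : ℕ)
    · refine key _ _ ?_
      calc 2 ≤ ∑ _i : Fin (k + 1 + 1), 1 := by simp
        _ ≤ _ := Finset.sum_le_sum fun i _ => h i
    · rw [bchCoeff, if_neg h, zero_smul]
      exact S.zero_mem
  · rw [← (Equiv.funUnique (Fin 1) (Fin (n + 1 + 1) × Fin (n + 1 + 1))).symm.sum_comp]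
    have hXY : X + Y = ∑ p : Fin (n + 1 + 1) × Fin (n + 1 + 1),
        ((if p = (1, 0) then X else 0) + (if p = (0, 1) then Y else 0)) := by
      rw [Finset.sum_add_distrib]
      simp
    rw [hXY, ← Finset.sum_sub_distrib]
    refine S.sum_mem fun p _ => ?_
    obtain ⟨r, s⟩ := p
    by_cases h2 : 2 ≤ (r : ℕ) + (s : ℕ)
    · have h10 : ((r, s) : Fin (n + 1 + 1) × Fin (n + 1 + 1)) ≠ (1, 0) := by
        intro h; simp only [Prod.mk.injEq] at h; obtain ⟨rfl, rfl⟩ := h; simp at h2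
      have h01 : ((r, s) : Fin (n + 1 + 1) × Fin (n + 1 + 1)) ≠ (0, 1) := by
        intro h; simp only [Prod.mk.injEq] at h; obtain ⟨rfl, rfl⟩ := h; simp at h2
      rw [if_neg h10, if_neg h01, add_zero, sub_zero]
      exact key _ _ (by simpa using h2)
    · have hcases : (r = 0 ∧ s = 0) ∨ (r = 1 ∧ s = 0) ∨ (r = 0 ∧ s = 1) := by
        simp only [Fin.ext_iff, Fin.val_zero, Fin.val_one]
        omega
      rcases hcases with ⟨rfl, rfl⟩ | ⟨rfl, rfl⟩ | ⟨rfl, rfl⟩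
      · simp [bchCoeff]
      · simp [bchCoeff, bchWord, nestedBracket]
      · simp [bchCoeff, bchWord, nestedBracket]

theorem bch_sub_mem_commutatorPart [LieRing.IsNilpotent 𝔤] (X Y : 𝔤) :
    bch X Y - (X + Y) ∈ commutatorPart 𝔤 :=
  bch_sub_mem X Y _ fun l _ hl => nestedBracket_mem_commutatorPart l hl

/-- `t ↦ exp (t X)` is a one-parameter subgroup, so that `NilpotentLieGroup.exp` is the exponential
map of the group. -/
theorem exp_smul_mul_exp_smul [LieRing.IsNilpotent 𝔤] (X : 𝔤) (s t : ℝ) :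
    NilpotentLieGroup.exp (s • X) * .exp (t • X) = .exp ((s + t) • X) := by
  have h := bch_sub_mem (s • X) (t • X) ⊥ fun l hl h2 => by
    rw [nestedBracket_eq_zero_of_smul X l h2
      (fun a ha => (hl a ha).elim (fun h => ⟨s, h⟩) (fun h => ⟨t, h⟩))]
    exact Submodule.zero_mem _
  rw [Submodule.mem_bot, sub_eq_zero, ← add_smul] at h
  exact congrArg NilpotentLieGroup.exp h

end NilpotentLemmas

/-- A homomorphism `ι : Γ → G` from a group `Γ` is the embedding of a cocompact lattice: it is
injective, its image is discrete, and `Γ \ G` is compact. -/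
structure IsCocompactLattice {𝔤 Γ : Type*} [LieRing 𝔤] [LieAlgebra ℝ 𝔤] [TopologicalSpace 𝔤]
    [Group Γ] (ι : Γ →ₙ* NilpotentLieGroup 𝔤) : Prop where
  injective : Function.Injective ι
  discrete : DiscreteTopology (Set.range ι)
  cocompact : ∃ K : Set (NilpotentLieGroup 𝔤), IsCompact K ∧
    ∀ g : NilpotentLieGroup 𝔤, ∃ γ : Γ, ∃ k ∈ K, g = ι γ * k

section Projection

variable {𝔤 : Type*} [LieRing 𝔤] [LieAlgebra ℝ 𝔤]

/-- The component `log g |_{𝔤⁽¹⁾}` of `log g` for the decomposition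
`𝔤 = 𝔤⁽¹⁾ ⊕ 𝔫₂`, `𝔫₂ = 𝔤⁽²⁾ ⊕ ⋯ ⊕ 𝔤⁽ʳ⁾`, where `W = 𝔤⁽¹⁾`. -/
def logOne {W : Submodule ℝ 𝔤} (hW : IsCompl W (commutatorPart 𝔤)) (g : NilpotentLieGroup 𝔤) : W :=
  W.projectionOnto (commutatorPart 𝔤) hW g.log

theorem logOne_mul [LieRing.IsNilpotent 𝔤] {W : Submodule ℝ 𝔤}
    (hW : IsCompl W (commutatorPart 𝔤)) (g h : NilpotentLieGroup 𝔤) :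
    logOne hW (g * h) = logOne hW g + logOne hW h := by
  have h1 := bch_sub_mem_commutatorPart g.log h.log
  rw [← Submodule.ker_projectionOnto hW, LinearMap.mem_ker, map_sub, map_add, sub_eq_zero] at h1
  exact h1

end Projection

/-! ### Graphs, coverings and homology -/

/-- A graph in the sense of Serre, possibly with loops and multiple edges: `E` is the set of all
oriented edges, `o e`, `t e` and `inv e` are the origin, the terminus and the inverse edge. -/
structure OrientedGraph (V E : Type*) where
  o : E → V
  t : E → V
  inv : E → E
  inv_inv : ∀ e, inv (inv e) = e
  inv_ne : ∀ e, inv e ≠ e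
  o_inv : ∀ e, o (inv e) = t e

namespace OrientedGraph

variable {V E : Type*} (X : OrientedGraph V E)

theorem t_inv (e : E) : X.t (X.inv e) = X.o e := by
  rw [← X.o_inv, X.inv_inv]

/-- `X.IsPath x l y`: the list of edges `l` is a path from `x` to `y`. -/
def IsPath (x : V) : List E → V → Prop
  | [], y => x = y
  | e :: l, y => X.o e = x ∧ IsPath (X.t e) l y

/-- Any two vertices are joined by a path. -/
def Connected : Prop := ∀ x y, ∃ l, X.IsPath x l y

/-- The real 1-chains: formal combinations of oriented edges, modulo `ē = -e`. -/
abbrev Chain : Type _ :=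
  (E →₀ ℝ) ⧸ Submodule.span ℝ
    (Set.range fun e : E => Finsupp.single e (1 : ℝ) + Finsupp.single (X.inv e) 1)

/-- The 1-chain of an oriented edge. -/
def edge (e : E) : X.Chain := Submodule.Quotient.mk (Finsupp.single e 1)

/-- A map `f` on oriented edges with `f ē = - f e`, extended to 1-chains. -/
def liftChain {M : Type*} [AddCommGroup M] [Module ℝ M] (f : E → M)
    (hf : ∀ e, f (X.inv e) = - f e) : X.Chain →ₗ[ℝ] M :=
  Submodule.liftQ _ (Finsupp.linearCombination ℝ f) (by
    rw [Submodule.span_le]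
    rintro _ ⟨e, rfl⟩
    simp [hf])

@[simp]
theorem liftChain_edge {M : Type*} [AddCommGroup M] [Module ℝ M] (f : E → M)
    (hf : ∀ e, f (X.inv e) = - f e) (e : E) : X.liftChain f hf (X.edge e) = f e := by
  simp only [liftChain, edge, ← Submodule.mkQ_apply]
  simp

/-- The boundary operator `∂ e = t e - o e`. -/
def boundary : X.Chain →ₗ[ℝ] (V →₀ ℝ) :=
  X.liftChain (fun e => Finsupp.single (X.t e) 1 - Finsupp.single (X.o e) 1) fun e => by
    simp [X.o_inv, X.t_inv]

/-- The first homology group `H₁(X, ℝ)`. -/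
abbrev H1 : Submodule ℝ X.Chain := LinearMap.ker X.boundary

end OrientedGraph

/-- A regular covering `X → X₀` with covering transformation group `Γ` (so that `X₀ = Γ \ X`):
a surjective morphism of graphs which is bijective on the edges issuing from each vertex, together
with an action of `Γ` on `X` by graph automorphisms that preserve the fibres, free on vertices and
transitive on the fibres of vertices. -/
structure RegularCovering (Γ : Type*) [Group Γ] {V E V₀ E₀ : Type*} [MulAction Γ V] [MulAction Γ E]
    (X : OrientedGraph V E) (X₀ : OrientedGraph V₀ E₀) where
  /-- The covering map on vertices. -/
  vert : V → V₀
  /-- The covering map on edges. -/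
  edge : E → E₀
  o_edge : ∀ e, X₀.o (edge e) = vert (X.o e)
  t_edge : ∀ e, X₀.t (edge e) = vert (X.t e)
  edge_inv : ∀ e, edge (X.inv e) = X₀.inv (edge e)
  vert_surjective : Function.Surjective vert
  star_bijective : ∀ (x : V) (e₀ : E₀), X₀.o e₀ = vert x → ∃! e, X.o e = x ∧ edge e = e₀
  o_smul : ∀ (γ : Γ) (e : E), X.o (γ • e) = γ • X.o e
  t_smul : ∀ (γ : Γ) (e : E), X.t (γ • e) = γ • X.t e
  smul_inv : ∀ (γ : Γ) (e : E), X.inv (γ • e) = γ • X.inv e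
  vert_smul : ∀ (γ : Γ) (x : V), vert (γ • x) = vert x
  edge_smul : ∀ (γ : Γ) (e : E), edge (γ • e) = edge e
  free : ∀ (γ : Γ) (x : V), γ • x = x → γ = 1
  transitive : ∀ x y, vert x = vert y → ∃ γ : Γ, y = γ • x

namespace RegularCovering

variable {Γ : Type*} [Group Γ] {V E V₀ E₀ : Type*} [MulAction Γ V] [MulAction Γ E]
  {X : OrientedGraph V E} {X₀ : OrientedGraph V₀ E₀} (π : RegularCovering Γ X X₀)

theorem exists_lift (e₀ : E₀) : ∃ e, π.edge e = e₀ := by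
  obtain ⟨x, hx⟩ := π.vert_surjective (X₀.o e₀)
  obtain ⟨e, he, -⟩ := π.star_bijective x e₀ hx.symm
  exact ⟨e, he.2⟩

theorem exists_smul_eq {e e' : E} (h : π.edge e = π.edge e') : ∃ γ : Γ, e' = γ • e := by
  obtain ⟨γ, hγ⟩ := π.transitive (X.o e) (X.o e') (by rw [← π.o_edge, ← π.o_edge, h])
  refine ⟨γ, ?_⟩
  exact (π.star_bijective (X.o e') (π.edge e') (π.o_edge e')).unique ⟨rfl, rfl⟩
    ⟨by rw [π.o_smul, hγ], by rw [π.edge_smul, h]⟩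

/-- A lift of an edge of `X₀` to `X`. -/
def liftEdge (e₀ : E₀) : E := (π.exists_lift e₀).choose

theorem edge_liftEdge (e₀ : E₀) : π.edge (π.liftEdge e₀) = e₀ := (π.exists_lift e₀).choose_spec

/-- The element `h` of `Γ` that carries the chosen vertex of the fibre through `x` to `x`. -/
def sheet (x : V) : Γ :=
  (π.transitive (π.vert_surjective (π.vert x)).choose x
    (π.vert_surjective (π.vert x)).choose_spec).choose

theorem sheet_spec (x : V) : x = π.sheet x • (π.vert_surjective (π.vert x)).choose :=
  (π.transitive (π.vert_surjective (π.vert x)).choose x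
    (π.vert_surjective (π.vert x)).choose_spec).choose_spec

theorem sheet_smul (γ : Γ) (x : V) : π.sheet (γ • x) = γ * π.sheet x := by
  have h1 := π.sheet_spec (γ • x)
  have h2 := π.sheet_spec x
  simp only [π.vert_smul] at h1
  set y := (π.vert_surjective (π.vert x)).choose
  have h3 : (π.sheet (γ • x)) • y = (γ * π.sheet x) • y := by
    rw [mul_smul, ← h2, ← h1]
  rw [← inv_mul_eq_one]
  refine inv_inj.mp ?_
  rw [inv_one]
  refine π.free _ y ?_
  rw [inv_smul_eq_iff, mul_smul, ← h3, inv_smul_smul]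

theorem sheet_diff_eq {M : Type*} [AddCommGroup M] (ℓ : Γ → M)
    (hℓ : ∀ γ γ', ℓ (γ * γ') = ℓ γ + ℓ γ') {e e' : E} (h : π.edge e = π.edge e') :
    ℓ (π.sheet (X.t e)) - ℓ (π.sheet (X.o e)) = ℓ (π.sheet (X.t e')) - ℓ (π.sheet (X.o e')) := by
  obtain ⟨γ, rfl⟩ := π.exists_smul_eq h
  rw [π.o_smul, π.t_smul, π.sheet_smul, π.sheet_smul, hℓ, hℓ]
  abel

/-- An additive map `ℓ` from `Γ` to a real vector space, extended to the 1-chains of `X₀`: an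
edge `e₀` with a lift `e` is sent to `ℓ h₂ - ℓ h₁`, where `h₁`, `h₂` are the elements of `Γ` that carry
the chosen vertices of the fibres to `o e`, `t e`. -/
def inducedChain {M : Type*} [AddCommGroup M] [Module ℝ M] (ℓ : Γ → M)
    (hℓ : ∀ γ γ', ℓ (γ * γ') = ℓ γ + ℓ γ') : X₀.Chain →ₗ[ℝ] M :=
  X₀.liftChain
    (fun e₀ => ℓ (π.sheet (X.t (π.liftEdge e₀))) - ℓ (π.sheet (X.o (π.liftEdge e₀)))) (by
      intro e₀
      rw [π.sheet_diff_eq ℓ hℓ (e' := X.inv (π.liftEdge e₀))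
        (by rw [π.edge_liftEdge, π.edge_inv, π.edge_liftEdge]), X.o_inv, X.t_inv]
      abel)

/-- The linear map `H₁(X₀, ℝ) → M` induced by the canonical surjective homomorphism
`π₁(X₀) → Γ`, followed by an additive map `ℓ : Γ → M`. It is characterised by
`induced_closedPath`: the class of a closed path of `X₀` that lifts to a path from `x` to `γ x` is
sent to `ℓ γ`. -/
def induced {M : Type*} [AddCommGroup M] [Module ℝ M] (ℓ : Γ → M)
    (hℓ : ∀ γ γ', ℓ (γ * γ') = ℓ γ + ℓ γ') : X₀.H1 →ₗ[ℝ] M :=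
  π.inducedChain ℓ hℓ ∘ₗ X₀.H1.subtype

theorem inducedChain_path {M : Type*} [AddCommGroup M] [Module ℝ M] (ℓ : Γ → M)
    (hℓ : ∀ γ γ', ℓ (γ * γ') = ℓ γ + ℓ γ') (l : List E) (x y : V) (hl : X.IsPath x l y) :
    π.inducedChain ℓ hℓ (l.map fun e => X₀.edge (π.edge e)).sum =
      ℓ (π.sheet y) - ℓ (π.sheet x) := by
  induction l generalizing x with
  | nil =>
    obtain rfl : x = y := hl
    simp
  | cons e l ih =>
    obtain ⟨rfl, h⟩ := hl
    rw [List.map_cons, List.sum_cons, map_add, ih _ h, inducedChain, OrientedGraph.liftChain_edge,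
      π.sheet_diff_eq ℓ hℓ (e' := e) (π.edge_liftEdge _)]
    abel

theorem induced_closedPath {M : Type*} [AddCommGroup M] [Module ℝ M] (ℓ : Γ → M)
    (hℓ : ∀ γ γ', ℓ (γ * γ') = ℓ γ + ℓ γ') (l : List E) (x : V) (γ : Γ)
    (hl : X.IsPath x l (γ • x)) (z : X₀.H1)
    (hz : (z : X₀.Chain) = (l.map fun e => X₀.edge (π.edge e)).sum) :
    π.induced ℓ hℓ z = ℓ γ := by
  rw [induced, LinearMap.comp_apply, Submodule.subtype_apply, hz, π.inducedChain_path ℓ hℓ l _ _ hl,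
    π.sheet_smul, hℓ]
  abel

/-- The canonical linear map `ρ_ℝ : H₁(X₀, ℝ) → 𝔤⁽¹⁾` of a covering whose transformation group
`Γ` is a lattice in `G`: it is induced by `π₁(X₀) → Γ` and `γ ↦ log γ |_{𝔤⁽¹⁾}`. -/
def rhoR {𝔤 : Type*} [LieRing 𝔤] [LieAlgebra ℝ 𝔤] [LieRing.IsNilpotent 𝔤] {W : Submodule ℝ 𝔤}
    (hW : IsCompl W (commutatorPart 𝔤)) (ι : Γ →ₙ* NilpotentLieGroup 𝔤) : X₀.H1 →ₗ[ℝ] W :=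
  π.induced (fun γ => logOne hW (ι γ)) fun γ γ' => by rw [map_mul, logOne_mul]

end RegularCovering

/-! ### Random walks, the Albanese metric -/

open Classical in
/-- A transition probability on a finite graph: `p(e) > 0` for every oriented edge `e`, and
`∑_{o(e) = x} p(e) = 1` for every vertex `x`. -/
structure TransitionProbability {V₀ E₀ : Type*} [Fintype E₀] (X₀ : OrientedGraph V₀ E₀) where
  p : E₀ → ℝ
  pos : ∀ e, 0 < p e
  sum_eq_one : ∀ x, ∑ e with X₀.o e = x, p e = 1

open Classical in
/-- A normalized invariant measure of the random walk on a finite graph with transition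
probability `p`. -/
structure InvariantMeasure {V₀ E₀ : Type*} [Fintype V₀] [Fintype E₀] {X₀ : OrientedGraph V₀ E₀}
    (P : TransitionProbability X₀) where
  m : V₀ → ℝ
  pos : ∀ x, 0 < m x
  sum_eq_one : ∑ x, m x = 1
  invariant : ∀ x, ∑ e with X₀.t e = x, P.p e * m (X₀.o e) = m x

namespace InvariantMeasure

variable {V₀ E₀ : Type*} [Fintype V₀] [Fintype E₀] {X₀ : OrientedGraph V₀ E₀}
  {P : TransitionProbability X₀} (μ : InvariantMeasure P)

/-- `m̃(e) = p(e) m(o(e))`. -/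
def mTilde (e : E₀) : ℝ := P.p e * μ.m (X₀.o e)

theorem sum_mTilde_boundary :
    X₀.boundary (∑ e, μ.mTilde e • X₀.edge e) = 0 := by
  classical
  rw [map_sum]
  ext x
  have h1 : ∑ e with X₀.o e = x, μ.mTilde e = μ.m x := by
    rw [← one_mul (μ.m x), ← P.sum_eq_one x, Finset.sum_mul]
    refine Finset.sum_congr (by congr) fun e he => ?_
    rw [mTilde, (Finset.mem_filter.mp he).2]
  have h2 : ∑ e with X₀.t e = x, μ.mTilde e = μ.m x := by
    rw [← μ.invariant x]
    exact Finset.sum_congr (by congr) fun e he => rfl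
  simp only [map_smul, OrientedGraph.boundary, OrientedGraph.liftChain_edge, Finsupp.coe_finsetSum,
    Finset.sum_apply, Finsupp.smul_apply, Finsupp.sub_apply, Finsupp.single_apply, smul_eq_mul,
    mul_sub, Finset.sum_sub_distrib, mul_ite, mul_one, mul_zero, ← Finset.sum_filter,
    Finsupp.coe_zero, Pi.zero_apply]
  rw [h1, h2, sub_self]

/-- The homological direction `γ_p = ∑ m̃(e) e ∈ H₁(X₀, ℝ)`. -/
def gammaP : X₀.H1 := ⟨∑ e, μ.mTilde e • X₀.edge e, μ.sum_mTilde_boundary⟩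

open Classical in
/-- Modified harmonic 1-forms: 1-cochains `ω` with
`∑_{o(e) = x} p(e) ω(e) = ⟨γ_p, ω⟩` for every vertex `x`. -/
def IsModifiedHarmonic (ω : Module.Dual ℝ X₀.Chain) : Prop :=
  ∀ x, ∑ e with X₀.o e = x, P.p e * ω (X₀.edge e) = ω μ.gammaP

/-- The modified harmonic 1-form that represents a class of `H¹(X₀, ℝ) = H₁(X₀, ℝ)*`; it exists
and is unique by the discrete Hodge–Kodaira theorem, which identifies `H¹(X₀, ℝ)` with the space of
modified harmonic 1-forms. -/
def harmonicForm (κ : Module.Dual ℝ X₀.H1) : Module.Dual ℝ X₀.Chain :=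
  Classical.epsilon fun ω => μ.IsModifiedHarmonic ω ∧ ω ∘ₗ X₀.H1.subtype = κ

/-- The inner product `⟪ω₁, ω₂⟫_p = ∑ m̃(e) ω₁(e) ω₂(e) - ⟨γ_p, ω₁⟩ ⟨γ_p, ω₂⟩` on `H¹(X₀, ℝ)`,
where `ω₁(e)`, `ω₂(e)` are the values of the modified harmonic forms. -/
def innerP (κ₁ κ₂ : Module.Dual ℝ X₀.H1) : ℝ :=
  ∑ e, μ.mTilde e * μ.harmonicForm κ₁ (X₀.edge e) * μ.harmonicForm κ₂ (X₀.edge e) -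
    κ₁ μ.gammaP * κ₂ μ.gammaP

section Albanese

variable {W : Type*} [AddCommGroup W] [Module ℝ W] (ρ : X₀.H1 →ₗ[ℝ] W)

/-- The inner product of `Hom(W, ℝ)` as a subspace of `H¹(X₀, ℝ)` through the transpose of `ρ`. -/
def innerDual (ω₁ ω₂ : Module.Dual ℝ W) : ℝ := μ.innerP (ω₁ ∘ₗ ρ) (ω₂ ∘ₗ ρ)

/-- The element of `Hom(W, ℝ)` that represents the evaluation at `Y` for the inner product of
`Hom(W, ℝ)`. -/
def rieszRep (Y : W) : Module.Dual ℝ W :=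
  Classical.epsilon fun ω => ∀ η : Module.Dual ℝ W, μ.innerDual ρ ω η = η Y

/-- The Albanese metric `g₀`: the inner product of `W = 𝔤⁽¹⁾` dual to the inner product of
`Hom(W, ℝ)`. -/
def albanese (Y Y' : W) : ℝ := μ.innerDual ρ (μ.rieszRep ρ Y) (μ.rieszRep ρ Y')

/-- The Gram matrix `Σ⁻¹` of a basis of `W` for the Albanese metric. -/
def albaneseGram {d : ℕ} (b : Module.Basis (Fin d) ℝ W) : Matrix (Fin d) (Fin d) ℝ :=
  Matrix.of fun i j => μ.albanese ρ (b i) (b j)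

end Albanese

end InvariantMeasure

/-- The space `Ω_x(X)` of infinite paths starting from `x`; the `(n+1)`-st edge of `c` is
`c.1 n`. It carries the σ-algebra generated by the coordinates. -/
abbrev PathSpace {V E : Type*} (X : OrientedGraph V E) (x : V) : Type _ :=
  {c : ℕ → E // X.o (c 0) = x ∧ ∀ n, X.o (c (n + 1)) = X.t (c n)}

/-- `ℙ` is the law of the random walk with transition probability `p`: the set of the infinite
paths with the same first `n` edges as `c` has probability `p(e₁) ⋯ p(eₙ)`. (Every finite path from
`x` extends to an infinite path.) -/
def IsRandomWalkLaw {V E : Type*} [MeasurableSpace E] (X : OrientedGraph V E) (p : E → ℝ) (x : V)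
    (ℙ : Measure (PathSpace X x)) : Prop :=
  ∀ (n : ℕ) (c : PathSpace X x),
    ℙ {c' | ∀ i < n, c'.1 i = c.1 i} = ENNReal.ofReal (∏ i ∈ Finset.range n, p (c.1 i))

/-! ### The path space `AC₀([0, 1]; ℝᵈ)` and interpolated paths -/

/-- The absolutely continuous paths `h : [0, 1] → ℝᵈ` with `h(0) = 0`, with the topology of uniform
convergence. -/
abbrev AC0 (d : ℕ) : Type :=
  {h : C(unitInterval, EuclideanSpace ℝ (Fin d)) //
    h 0 = 0 ∧ AbsolutelyContinuousOnInterval (Set.IccExtend zero_le_one h) 0 1}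

section Interpolation

variable {F : Type*} [NormedAddCommGroup F] [NormedSpace ℝ F]

/-- `w₁ + ⋯ + w_{[nt]} + (nt - [nt]) w_{[nt]+1}`, where `w k` stands for `w_{k+1}`. -/
def interpolate (n : ℕ) (w : ℕ → F) (t : ℝ) : F :=
  ∑ k ∈ Finset.range ⌊n * t⌋₊, w k + (n * t - ⌊n * t⌋₊) • w ⌊n * t⌋₊

theorem interpolate_eq_sum (n : ℕ) (w : ℕ → F) {t : ℝ} (h0 : 0 ≤ t) (h1 : t ≤ 1) :
    interpolate n w t = ∑ k ∈ Finset.range n, max 0 (min 1 (n * t - k)) • w k := by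
  have hs0 : 0 ≤ n * t := by positivity
  have hsn : n * t ≤ n := mul_le_of_le_one_right (by positivity) h1
  unfold interpolate
  set s := n * t
  have hf := Nat.floor_le hs0
  have hf' := Nat.lt_floor_add_one s
  have hmn : ⌊s⌋₊ ≤ n := by
    have := hf.trans hsn
    exact_mod_cast this
  set m := ⌊s⌋₊
  have hc : ∀ k ∈ Finset.range n, max 0 (min 1 (s - k)) • w k =
      (if k < m then w k else 0) + (if k = m then (s - m) • w m else 0) := by
    intro k _
    rcases lt_trichotomy k m with h | h | h
    · have : (k : ℝ) + 1 ≤ m := by exact_mod_cast h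
      rw [if_pos h, if_neg h.ne, min_eq_left (by linarith), max_eq_right zero_le_one]
      simp
    · subst h
      rw [if_neg (lt_irrefl _), if_pos rfl, min_eq_right (by linarith),
        max_eq_right (by linarith), zero_add]
    · have : (m : ℝ) + 1 ≤ k := by exact_mod_cast h
      rw [if_neg (by omega), if_neg (by omega), min_eq_right (by linarith),
        max_eq_left (by linarith)]
      simp
  rw [Finset.sum_congr rfl hc, Finset.sum_add_distrib, Finset.sum_ite_eq', ← Finset.sum_filter]
  congr 1
  · refine Finset.sum_congr ?_ fun _ _ => rfl
    ext k
    simp only [Finset.mem_range, Finset.mem_filter]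
    omega
  · split_ifs with h
    · rfl
    · have hm : m = n := by
        simp only [Finset.mem_range] at h
        omega
      have : s - m = 0 := by
        rw [hm] at hf ⊢
        linarith
      rw [this, zero_smul]

theorem interpolate_lipschitz (n : ℕ) (w : ℕ → F) :
    ∃ K : ℝ≥0, LipschitzOnWith K (interpolate n w) (Set.Icc 0 1) := by
  refine ⟨Real.toNNReal (∑ k ∈ Finset.range n, n * ‖w k‖), LipschitzOnWith.of_dist_le_mul ?_⟩
  intro t ht t' ht'
  rw [Real.coe_toNNReal _ (Finset.sum_nonneg fun _ _ => by positivity),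
    interpolate_eq_sum n w ht.1 ht.2, interpolate_eq_sum n w ht'.1 ht'.2, dist_eq_norm,
    ← Finset.sum_sub_distrib, Finset.sum_mul]
  refine (norm_sum_le _ _).trans (Finset.sum_le_sum fun k _ => ?_)
  rw [← sub_smul, norm_smul, Real.norm_eq_abs, Real.dist_eq]
  have h1 : |max 0 (min 1 (n * t - k)) - max 0 (min 1 (n * t' - k))| ≤ n * |t - t'| := by
    have h2 := abs_max_sub_max_le_max 0 (min 1 (n * t - k)) 0 (min 1 (n * t' - k))
    have h3 := abs_min_sub_min_le_max 1 (n * t - k) 1 (n * t' - k)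
    refine (h2.trans (max_le (by simp) (h3.trans (max_le (by simp) le_rfl)))).trans (le_of_eq ?_)
    rw [show n * t - k - (n * t' - k) = n * (t - t') by ring, abs_mul, Nat.abs_cast]
  calc _ ≤ n * |t - t'| * ‖w k‖ := by gcongr
    _ = _ := by ring

/-- The interpolation of `w` as an element of `AC₀([0, 1]; ℝᵈ)`. -/
def interpolatedPath {d : ℕ} (n : ℕ) (w : ℕ → EuclideanSpace ℝ (Fin d)) : AC0 d :=
  ⟨⟨fun t => interpolate n w t, by
      obtain ⟨K, hK⟩ := interpolate_lipschitz n w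
      exact hK.continuousOn.domRestrict⟩, by
    constructor
    · simp [interpolate]
    · obtain ⟨K, hK⟩ := interpolate_lipschitz n w
      refine LipschitzOnWith.absolutelyContinuousOnInterval (K := K) ?_
      rw [Set.uIcc_of_le zero_le_one]
      intro t ht t' ht'
      rw [Set.IccExtend_of_mem _ _ ht, Set.IccExtend_of_mem _ _ ht']
      exact hK ht ht'⟩

end Interpolation

/-! ### The moderate deviation principle -/

section LDP

/-- A good rate function: lower semicontinuous with compact sublevel sets. -/
def IsGoodRateFunction {S : Type*} [TopologicalSpace S] (J : S → ℝ≥0∞) : Prop :=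
  LowerSemicontinuous J ∧ ∀ r : ℝ≥0, IsCompact {y | J y ≤ r}

/-- The large deviation bounds with speed `v` and rate function `J` for the sequence `(Z n)` of
`S`-valued random variables: for every Borel set `A`,
`-inf_{A°} J ≤ liminf (1 / v n) log ℙ(Z n ∈ A) ≤ limsup (1 / v n) log ℙ(Z n ∈ A) ≤ -inf_{Ā} J`,
in the extended reals, with `log 0 = -∞`. -/
def SatisfiesLDP {Ω S : Type*} [MeasurableSpace Ω] [TopologicalSpace S] (ℙ : Measure Ω)
    (Z : ℕ → Ω → S) (v : ℕ → ℝ) (J : S → ℝ≥0∞) : Prop :=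
  ∀ A : Set S, MeasurableSet[borel S] A →
    -(⨅ y ∈ interior A, (J y : EReal)) ≤
        liminf (fun n => (((v n)⁻¹ : ℝ) : EReal) * ENNReal.log (ℙ {ω | Z n ω ∈ A})) atTop ∧
      liminf (fun n => (((v n)⁻¹ : ℝ) : EReal) * ENNReal.log (ℙ {ω | Z n ω ∈ A})) atTop ≤
        limsup (fun n => (((v n)⁻¹ : ℝ) : EReal) * ENNReal.log (ℙ {ω | Z n ω ∈ A})) atTop ∧
      limsup (fun n => (((v n)⁻¹ : ℝ) : EReal) * ENNReal.log (ℙ {ω | Z n ω ∈ A})) atTop ≤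
        -(⨅ y ∈ closure A, (J y : EReal))

/-- `J(h) = ∫₀¹ ½ ⟨Q ḣ(t), ḣ(t)⟩ dt ∈ [0, ∞]`. -/
def quadraticAction {d : ℕ} (Q : Matrix (Fin d) (Fin d) ℝ) (h : AC0 d) : ℝ≥0∞ :=
  ∫⁻ t in Set.Icc (0 : ℝ) 1, ENNReal.ofReal
    (1 / 2 * inner ℝ (Matrix.toEuclideanLin Q (deriv (Set.IccExtend zero_le_one h.1) t))
      (deriv (Set.IccExtend zero_le_one h.1) t))

end LDP

section Walk

variable {𝔤 : Type*} [LieRing 𝔤] [LieAlgebra ℝ 𝔤] {W : Submodule ℝ 𝔤}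
  (hW : IsCompl W (commutatorPart 𝔤))

/-- `W̄ₖ₊₁(c) = Ξₖ₊₁(c) - Ξₖ(c) - ρ`, where `Ξₖ(c) = log Φ(wₖ(c)) |_{𝔤⁽¹⁾}` and `wₖ(c)` is the
origin of the `(k+1)`-st edge of `c`. -/
def centredStep {V E : Type*} (X : OrientedGraph V E) (Φ : V → NilpotentLieGroup 𝔤) (ρ : W) {x : V}
    (c : PathSpace X x) (k : ℕ) : W :=
  logOne hW (Φ (X.o (c.1 (k + 1)))) - logOne hW (Φ (X.o (c.1 k))) - ρ

/-- The path `Z⁽ⁿ⁾(c)`, in the coordinates of a basis `b` of `𝔤⁽¹⁾`. -/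
def scaledPath {V E : Type*} (X : OrientedGraph V E) (Φ : V → NilpotentLieGroup 𝔤) (ρ : W) {d : ℕ}
    (b : Module.Basis (Fin d) ℝ W) (a : ℕ → ℝ) {x : V} (n : ℕ) (c : PathSpace X x) : AC0 d :=
  interpolatedPath n fun k => (a n)⁻¹ • WithLp.toLp 2 (b.equivFun (centredStep hW X Φ ρ c k))

end Walk

end CoveringMDP
end

/-!
The path `Z⁽ⁿ⁾` is the scaled interpolation of an additive functional of a finite Markov chain,
and its moderate deviations are those of a Brownian motion whose covariance is the asymptotic
variance of the functional.

*Reduction to the finite graph.* The component in `𝔤⁽¹⁾` of `log` is a homomorphism `G → 𝔤⁽¹⁾`, so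
the increments of `log Φ |_{𝔤⁽¹⁾}` along an edge only depend on its projection to `X₀`
(`RegularCovering.incrementChain`), and on cycles they give `ρ_ℝ`
(`RegularCovering.incrementChain_comp_subtype`). The projected edges have the law of the walk on
`X₀` (`IsRandomWalkLaw.measure_projectedEdges`). The expectations of that walk over `n` steps are
finite sums, recorded as positive linear functionals (`Expectation`,
`TransitionProbability.walk`).

*The variance.* For `η` in `Hom(𝔤⁽¹⁾, ℝ)` the increments of `η ∘ log Φ` form a cochain that
differs from the modified harmonic form of its class by a coboundary. The centred harmonic form
has mean zero at each vertex, which is the martingale approximation, and the solution of one more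
Poisson equation makes its conditional variance constant, equal to `⟪η, η⟫_p`
(`InvariantMeasure.hasAsymptoticVariance`). The Poisson equations are solvable by the maximum
principle (`InvariantMeasure.exists_poisson`). As `Γ` is cocompact the transpose of `ρ_ℝ` is
injective (`RegularCovering.eq_zero_of_comp_rhoR_eq_zero`), so the Albanese metric is an inner
product, its Gram matrix is `B* B` with `B` invertible, and `θ ↦ ⟨θ, B ·⟩` is an isometry onto
`Hom(𝔤⁽¹⁾, ℝ)` (`InvariantMeasure.exists_sqrt_albaneseGram`).

*Moderate deviations.* Expanding the exponential to second order gives uniform two-sided bounds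
for the exponential moments of the functional and an exponential maximal inequality. By the Markov
property the logarithmic moment generating functions of the increments of `Z⁽ⁿ⁾` over a grid of
`N` cells, divided by `a_n² / n`, converge to those of a standard Gaussian vector
(`hasGaussianCgf_gridVector`), and the oscillation of `Z⁽ⁿ⁾` in a cell is negligible as `N → ∞`
(`exponentiallySmallOscillation_listPath`). A quadratic Gärtner–Ellis theorem in finite dimension
(`HasGaussianCgf.eventually_prob_le`, `HasGaussianCgf.eventually_le_prob`) and the approximation
of paths by polygons then give the bounds on path space (`satisfiesLDP_of_gaussian`).

*The rate function.* The action of a path is at most `r` exactly when all its energies over finite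
families of disjoint intervals are. The latter condition is closed under pointwise convergence and
implies a uniform Hölder estimate, so the sublevel sets are compact by Arzelà–Ascoli
(`isGoodRateFunction_quadraticAction`).
-/

noncomputable section

namespace CoveringMDP

/-! ### The action functional and its sublevel sets -/

section Action

open AbsolutelyContinuousOnInterval

theorem absolutelyContinuousOnInterval_comp_lipschitz {X Y : Type*} [PseudoMetricSpace X]
    [PseudoMetricSpace Y] {f : ℝ → X} {g : X → Y} {K : ℝ≥0} {a b : ℝ} (hg : LipschitzWith K g)
    (hf : AbsolutelyContinuousOnInterval f a b) :
    AbsolutelyContinuousOnInterval (fun t => g (f t)) a b := by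
  have h := Tendsto.const_mul (K : ℝ) hf
  rw [mul_zero] at h
  refine squeeze_zero (fun E => Finset.sum_nonneg fun _ _ => dist_nonneg) (fun E => ?_) h
  rw [Finset.mul_sum]
  exact Finset.sum_le_sum fun i _ => hg.dist_le_mul _ _

variable {F : Type*} [NormedAddCommGroup F] [InnerProductSpace ℝ F]

theorem ae_differentiableAt_of_absolutelyContinuous [FiniteDimensional ℝ F] {f : ℝ → F} {a b : ℝ}
    (hf : AbsolutelyContinuousOnInterval f a b) :
    ∀ᵐ t, t ∈ Set.uIcc a b → DifferentiableAt ℝ f t :=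
  hf.boundedVariationOn.ae_differentiableAt_of_mem_uIcc

theorem ofReal_setIntegral_le {α : Type*} [MeasurableSpace α] {μ : Measure α} {g : α → ℝ} :
    ENNReal.ofReal (∫ x, g x ∂μ) ≤ ∫⁻ x, ENNReal.ofReal (g x) ∂μ := by
  by_cases hg : Integrable g μ
  · rw [integral_eq_lintegral_pos_part_sub_lintegral_neg_part hg]
    exact (ENNReal.ofReal_le_ofReal (sub_le_self _ ENNReal.toReal_nonneg)).trans
      ENNReal.ofReal_toReal_le
  · simp [integral_undef hg]

/-- The Cauchy–Schwarz inequality `|B (f b - f a)|² / (2 (b - a)) ≤ ∫ₐᵇ |B f'|² / 2`, obtained by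
integrating `⟪y, B f'⟫ ≤ (|y|² + |B f'|²) / 2` for the mean slope `y`. -/
theorem increment_le_action [FiniteDimensional ℝ F] (B : F →L[ℝ] F) {f : ℝ → F} {a b : ℝ}
    (hab : a ≤ b) (hf : AbsolutelyContinuousOnInterval f a b) :
    ENNReal.ofReal (‖B (f b - f a)‖ ^ 2 / (2 * (b - a))) ≤
      ∫⁻ t in Set.Ioc a b, ENNReal.ofReal (1 / 2 * ‖B (deriv f t)‖ ^ 2) := by
  rcases hab.eq_or_lt with rfl | hab
  · simp
  have hba : 0 < b - a := sub_pos.mpr hab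
  set y : F := (b - a)⁻¹ • B (f b - f a) with hy
  set ℓ : F →L[ℝ] ℝ := (innerSL ℝ y).comp B with hℓ
  have hg : AbsolutelyContinuousOnInterval (fun t => ℓ (f t)) a b :=
    absolutelyContinuousOnInterval_comp_lipschitz ℓ.lipschitz hf
  have h1 := hg.integral_deriv_eq_sub
  rw [intervalIntegral.integral_of_le hab.le] at h1
  have h2 : ℓ (f b) - ℓ (f a) = ‖B (f b - f a)‖ ^ 2 / (b - a) := by
    rw [← map_sub, hℓ, ContinuousLinearMap.comp_apply, innerSL_apply_apply, hy,
      inner_smul_left, real_inner_self_eq_norm_sq]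
    simp; field_simp
  have h3 : ENNReal.ofReal (‖B (f b - f a)‖ ^ 2 / (b - a)) ≤
      ∫⁻ t in Set.Ioc a b, (ENNReal.ofReal (1 / 2 * ‖y‖ ^ 2) +
        ENNReal.ofReal (1 / 2 * ‖B (deriv f t)‖ ^ 2)) := by
    rw [← h2, ← h1]
    refine ofReal_setIntegral_le.trans (lintegral_mono_ae ?_)
    rw [ae_restrict_iff' measurableSet_Ioc]
    filter_upwards [ae_differentiableAt_of_absolutelyContinuous hf] with t ht htm
    have hd := ht (Set.uIcc_of_le hab.le ▸ Set.Ioc_subset_Icc_self htm)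
    have h4 : deriv (fun t => ℓ (f t)) t = inner ℝ y (B (deriv f t)) :=
      (ℓ.hasFDerivAt.comp_hasDerivAt t hd.hasDerivAt).deriv
    rw [h4, ← ENNReal.ofReal_add (by positivity) (by positivity)]
    apply ENNReal.ofReal_le_ofReal
    nlinarith [real_inner_le_norm y (B (deriv f t)), sq_nonneg (‖y‖ - ‖B (deriv f t)‖)]
  have h5 : ENNReal.ofReal (1 / 2 * ‖y‖ ^ 2) * volume (Set.Ioc a b) =
      ENNReal.ofReal (‖B (f b - f a)‖ ^ 2 / (2 * (b - a))) := by
    rw [Real.volume_Ioc, ← ENNReal.ofReal_mul (by positivity), hy, norm_smul, Real.norm_eq_abs,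
      abs_of_pos (inv_pos.mpr hba)]
    congr 1
    field_simp
  rw [lintegral_add_left measurable_const, setLIntegral_const, h5,
    show ‖B (f b - f a)‖ ^ 2 / (b - a) = ‖B (f b - f a)‖ ^ 2 / (2 * (b - a)) +
      ‖B (f b - f a)‖ ^ 2 / (2 * (b - a)) by field_simp; ring,
    ENNReal.ofReal_add (by positivity) (by positivity)] at h3
  exact (ENNReal.add_le_add_iff_left ENNReal.ofReal_ne_top).mp h3

/-- All difference quotients of `f` on `[0, 1]` have energy at most `L`: for every finite family of
disjoint intervals, `∑ |B (f bᵢ - f aᵢ)|² / (2 |bᵢ - aᵢ|) ≤ L`. -/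
def EnergyLE (B : F →L[ℝ] F) (L : ℝ) (f : ℝ → F) : Prop :=
  ∀ E ∈ disjWithin 0 1, ∑ i ∈ Finset.range E.1,
    ‖B (f (E.2 i).2 - f (E.2 i).1)‖ ^ 2 / (2 * dist (E.2 i).1 (E.2 i).2) ≤ L

theorem energyLE_of_action_le [FiniteDimensional ℝ F] (B : F →L[ℝ] F) {f : ℝ → F} {L : ℝ}
    (hL : 0 ≤ L) (hf : AbsolutelyContinuousOnInterval f 0 1)
    (h : ∫⁻ t in Set.Icc (0 : ℝ) 1, ENNReal.ofReal (1 / 2 * ‖B (deriv f t)‖ ^ 2) ≤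
      ENNReal.ofReal L) : EnergyLE B L f := by
  intro E hE
  have key : ∀ i ∈ Finset.range E.1,
      ENNReal.ofReal (‖B (f (E.2 i).2 - f (E.2 i).1)‖ ^ 2 / (2 * dist (E.2 i).1 (E.2 i).2)) ≤
      ∫⁻ t in Set.uIoc (E.2 i).1 (E.2 i).2, ENNReal.ofReal (1 / 2 * ‖B (deriv f t)‖ ^ 2) := by
    intro i hi
    obtain ⟨h1, h2⟩ := hE.1 i hi
    have hf' := hf.mono (Set.uIcc_subset_uIcc h1 h2)
    rcases le_total (E.2 i).1 (E.2 i).2 with hle | hle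
    · rw [Set.uIoc_of_le hle, dist_comm, Real.dist_eq, abs_of_nonneg (sub_nonneg.mpr hle)]
      exact increment_le_action B hle hf'
    · rw [Set.uIoc_of_ge hle, Real.dist_eq, abs_of_nonneg (sub_nonneg.mpr hle), map_sub,
        norm_sub_rev, ← map_sub]
      exact increment_le_action B hle hf'.symm
  rw [← ENNReal.ofReal_le_ofReal_iff hL, ENNReal.ofReal_sum_of_nonneg fun _ _ => by positivity]
  refine (Finset.sum_le_sum key).trans (le_trans ?_ h)
  rw [← lintegral_biUnion_finset hE.2 (fun _ _ => measurableSet_uIoc)]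
  refine lintegral_mono_set ?_
  refine (biUnion_uIoc_subset_of_mem_disjWithin hE).trans ?_
  rw [Set.uIoc_of_le zero_le_one]
  exact Set.Ioc_subset_Icc_self

/-- The inequality of arithmetic and geometric means for `x² / (2 D)` and `D`, with a weight `η`. -/
theorem norm_le_of_sq_div_le {x D L η : ℝ} (hη : 0 < η) (hD : 0 ≤ D)
    (h0 : D = 0 → x = 0) (h : x ^ 2 / (2 * D) ≤ L) : x ≤ η * L + D / (2 * η) := by
  rcases hD.eq_or_lt with rfl | hD
  · rw [h0 rfl] at h ⊢
    simp only [zero_pow two_ne_zero, zero_div] at h ⊢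
    positivity
  · have h1 : x ≤ η * (x ^ 2 / (2 * D)) + D / (2 * η) := by
      have : η * (x ^ 2 / (2 * D)) + D / (2 * η) - x = (η * x - D) ^ 2 / (2 * D * η) := by
        field_simp; ring
      have h2 : 0 ≤ (η * x - D) ^ 2 / (2 * D * η) := by positivity
      linarith
    exact h1.trans (by gcongr)

/-- A weighted Cauchy–Schwarz inequality: the variation over a family of intervals of total length
`D` is at most `κ (η L + D / (2 η))` for every `η > 0`. -/
theorem EnergyLE.absolutelyContinuousOnInterval {B : F →L[ℝ] F} {κ : ℝ} (hκ : 0 < κ)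
    (hB : ∀ x, ‖x‖ ≤ κ * ‖B x‖) {L : ℝ} {f : ℝ → F} (h : EnergyLE B L f) :
    AbsolutelyContinuousOnInterval f 0 1 := by
  rw [absolutelyContinuousOnInterval_iff]
  intro ε hε
  have hL : 0 ≤ L := le_trans (by simp) (h (0, fun _ => (0, 0)) (by simp [disjWithin]))
  -- this weight makes the energy term at most `ε / 2`, the choice of the length the other one
  set η : ℝ := ε / (2 * κ * (L + 1)) with hη
  have hη0 : 0 < η := by positivity
  refine ⟨ε * η / κ, by positivity, fun E hE hlt => ?_⟩
  have h1 : ∀ i ∈ Finset.range E.1, dist (f (E.2 i).1) (f (E.2 i).2) ≤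
      κ * (η * (‖B (f (E.2 i).2 - f (E.2 i).1)‖ ^ 2 / (2 * dist (E.2 i).1 (E.2 i).2)) +
        dist (E.2 i).1 (E.2 i).2 / (2 * η)) := by
    intro i _
    rw [dist_comm, dist_eq_norm]
    refine (hB _).trans (mul_le_mul_of_nonneg_left ?_ hκ.le)
    refine norm_le_of_sq_div_le hη0 dist_nonneg (fun h0 => ?_) le_rfl
    rw [dist_eq_zero.mp h0]
    simp
  calc _ ≤ _ := Finset.sum_le_sum h1
    _ = κ * (η * ∑ i ∈ Finset.range E.1,
          (‖B (f (E.2 i).2 - f (E.2 i).1)‖ ^ 2 / (2 * dist (E.2 i).1 (E.2 i).2)) +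
        (∑ i ∈ Finset.range E.1, dist (E.2 i).1 (E.2 i).2) / (2 * η)) := by
      rw [← Finset.mul_sum, Finset.sum_add_distrib, ← Finset.mul_sum, Finset.sum_div]
    _ < κ * (η * L + (ε * η / κ) / (2 * η)) := by
      have := h E hE
      have h2 : (∑ i ∈ Finset.range E.1, dist (E.2 i).1 (E.2 i).2) / (2 * η) <
        (ε * η / κ) / (2 * η) := by gcongr
      gcongr κ * ?_
      exact add_lt_add_of_le_of_lt (by gcongr) h2
    _ ≤ ε := by
      have h3 : κ * (η * L) ≤ ε / 2 := by
        rw [hη]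
        calc κ * (ε / (2 * κ * (L + 1)) * L) = ε / 2 * (L / (L + 1)) := by field_simp
          _ ≤ ε / 2 * 1 := by
            gcongr
            rw [div_le_one (by positivity)]
            linarith
          _ = _ := mul_one _
      have h4 : κ * ((ε * η / κ) / (2 * η)) = ε / 2 := by field_simp
      rw [mul_add, h4]
      linarith

/-- The Hölder estimate with exponent `1/2`, from a family of one interval. -/
theorem EnergyLE.norm_sub_sq_le {B : F →L[ℝ] F} {L : ℝ} {f : ℝ → F} (h : EnergyLE B L f) {s t : ℝ}
    (hs : s ∈ Set.Icc (0 : ℝ) 1) (ht : t ∈ Set.Icc (0 : ℝ) 1) :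
    ‖B (f t - f s)‖ ^ 2 ≤ 2 * L * dist s t := by
  rcases eq_or_ne s t with rfl | hst
  · simp
  have h1 := h (1, fun _ => (s, t)) (by simp [disjWithin]; exact ⟨hs, ht⟩)
  have h2 : 0 < dist s t := dist_pos.mpr hst
  simp only [Finset.range_one, Finset.sum_singleton] at h1
  rw [div_le_iff₀ (by positivity)] at h1
  linarith

/-- `[0, 1]` is, up to a null set, the union of the intervals `(k / N, (k + 1) / N)`. -/
theorem lintegral_Icc_eq_sum {N : ℕ} (hN : 0 < N) (φ : ℝ → ℝ≥0∞) :
    ∫⁻ t in Set.Icc (0 : ℝ) 1, φ t =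
      ∑ k ∈ Finset.range N, ∫⁻ t in Set.Ioo (k / N : ℝ) ((k + 1) / N), φ t := by
  have hN' : (0 : ℝ) < N := by exact_mod_cast hN
  have key : ∀ K : ℕ, ∫⁻ t in Set.Ioc (0 : ℝ) (K / N), φ t =
      ∑ k ∈ Finset.range K, ∫⁻ t in Set.Ioo (k / N : ℝ) ((k + 1) / N), φ t := by
    intro K
    induction K with
    | zero => simp
    | succ K ih =>
      rw [Finset.sum_range_succ, ← ih, setLIntegral_congr Ioo_ae_eq_Ioc,
        ← lintegral_union measurableSet_Ioc (Set.Ioc_disjoint_Ioc_of_le le_rfl),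
        Set.Ioc_union_Ioc_eq_Ioc (by positivity) (by gcongr; linarith)]
      push_cast
      rfl
  have := key N
  rw [div_self hN'.ne'] at this
  rw [← this]
  exact setLIntegral_congr Ioc_ae_eq_Icc.symm

theorem setLIntegral_grid_const {N : ℕ} (hN : 0 < N) (k : ℕ) (c : ℝ≥0∞) :
    ∫⁻ _ in Set.Ioo (k / N : ℝ) ((k + 1) / N), c = c * (N : ℝ≥0∞)⁻¹ := by
  rw [setLIntegral_const, Real.volume_Ioo, ← sub_div, add_sub_cancel_left, one_div,
    ENNReal.ofReal_inv_of_pos (by exact_mod_cast hN), ENNReal.ofReal_natCast]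

end Action

section GridSlope

open AbsolutelyContinuousOnInterval

variable {F : Type*} [NormedAddCommGroup F] [InnerProductSpace ℝ F]

/-- The slope of `f` over the cell of the grid `ℤ / N` that contains `t`. -/
def gridSlope (N : ℕ) (f : ℝ → F) (t : ℝ) : F :=
  (N : ℝ) • (f ((⌊N * t⌋ + 1) / N) - f (⌊N * t⌋ / N))

theorem tendsto_gridSlope {f : ℝ → F} {t : ℝ} (hf : DifferentiableAt ℝ f t) :
    Tendsto (fun N => gridSlope N f t) atTop (𝓝 (deriv f t)) := by
  rw [Metric.tendsto_atTop]
  intro ε hε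
  have hd := hf.hasDerivAt.isLittleO
  rw [Asymptotics.isLittleO_iff] at hd
  have hd' := hd (show 0 < ε / 4 by positivity)
  obtain ⟨δ, hδ, hball⟩ := Metric.eventually_nhds_iff.mp hd'
  obtain ⟨N₀, hN₀⟩ := exists_nat_gt (1 / δ)
  refine ⟨N₀ + 1, fun N hN => ?_⟩
  have hN1 : (N₀ : ℝ) + 1 ≤ N := by exact_mod_cast hN
  have hN0 : (0 : ℝ) < N := lt_of_lt_of_le (by positivity) hN1
  have hNδ : 1 / (N : ℝ) < δ := by
    rw [div_lt_comm₀ hN0 hδ]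
    linarith
  set a : ℝ := ⌊N * t⌋ / N with ha
  set b : ℝ := (⌊N * t⌋ + 1) / N with hb
  have hab : b - a = 1 / N := by rw [ha, hb]; ring
  have hat : a ≤ t := by
    rw [ha, div_le_iff₀ hN0, mul_comm]
    exact Int.floor_le _
  have htb : t ≤ b := by
    rw [hb, le_div_iff₀ hN0, mul_comm]
    exact (Int.lt_floor_add_one _).le
  have hA : ‖f a - f t - (a - t) • deriv f t‖ ≤ ε / 4 * (1 / N) := by
    refine (hball (y := a) ?_).trans ?_
    · rw [Real.dist_eq, abs_lt]; constructor <;> linarith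
    · gcongr
      rw [Real.norm_eq_abs, abs_le]; constructor <;> linarith
  have hB : ‖f b - f t - (b - t) • deriv f t‖ ≤ ε / 4 * (1 / N) := by
    refine (hball (y := b) ?_).trans ?_
    · rw [Real.dist_eq, abs_lt]; constructor <;> linarith
    · gcongr
      rw [Real.norm_eq_abs, abs_le]; constructor <;> linarith
  have h1 : gridSlope N f t - deriv f t = (N : ℝ) • ((f b - f t - (b - t) • deriv f t) -
      (f a - f t - (a - t) • deriv f t)) := by
    have h2 : deriv f t = (N : ℝ) • ((b - a) • deriv f t) := by
      rw [smul_smul, hab, mul_one_div_cancel hN0.ne', one_smul]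
    rw [gridSlope, ← ha, ← hb]
    nth_rewrite 1 [h2]
    rw [← smul_sub]
    congr 1
    module
  rw [dist_eq_norm, h1, norm_smul, Real.norm_eq_abs, abs_of_pos hN0]
  calc N * ‖_‖ ≤ N * (ε / 4 * (1 / N) + ε / 4 * (1 / N)) := by
        gcongr
        exact (norm_sub_le _ _).trans (add_le_add hB hA)
    _ = ε / 2 := by field_simp; ring
    _ < ε := by linarith

/-- The energy over the cells of the grid `ℤ / N`. -/
theorem EnergyLE.grid {B : F →L[ℝ] F} {L : ℝ} {f : ℝ → F} (h : EnergyLE B L f) {N : ℕ}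
    (hN : 0 < N) :
    (N / 2 : ℝ) * ∑ k ∈ Finset.range N, ‖B (f ((k + 1) / N) - f (k / N))‖ ^ 2 ≤ L := by
  have hN' : (0 : ℝ) < N := by exact_mod_cast hN
  have hle : ∀ k : ℕ, (k / N : ℝ) ≤ (k + 1) / N := fun k => by gcongr; linarith
  refine le_trans (le_of_eq ?_) (h (N, fun k => (k / N, (k + 1) / N)) ⟨fun k hk => ?_, ?_⟩)
  · rw [Finset.mul_sum]
    refine Finset.sum_congr rfl fun k _ => ?_
    simp only
    rw [dist_comm, Real.dist_eq, abs_of_nonneg (sub_nonneg.mpr (hle k)), ← sub_div,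
      add_sub_cancel_left]
    field_simp
  · have hk' : (k : ℝ) + 1 ≤ N := by exact_mod_cast Finset.mem_range.mp hk
    rw [Set.uIcc_of_le zero_le_one]
    refine ⟨⟨by positivity, ?_⟩, ⟨by positivity, ?_⟩⟩ <;> rw [div_le_one hN'] <;> linarith
  · intro i _ j _ hij
    simp only [Function.onFun, Set.uIoc_of_le (hle _)]
    rcases lt_or_gt_of_ne hij with hij | hij
    · have : (i : ℝ) + 1 ≤ j := by exact_mod_cast hij
      exact Set.Ioc_disjoint_Ioc_of_le (by gcongr)
    · have : (j : ℝ) + 1 ≤ i := by exact_mod_cast hij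
      exact (Set.Ioc_disjoint_Ioc_of_le (by gcongr)).symm

theorem floor_mul_of_mem_cell {N k : ℕ} (hN : 0 < N) {t : ℝ}
    (ht : t ∈ Set.Ioo (k / N : ℝ) ((k + 1) / N)) : ⌊N * t⌋₊ = k ∧ ⌊N * t⌋ = k := by
  have hN' : (0 : ℝ) < N := by exact_mod_cast hN
  obtain ⟨h1, h2⟩ := ht
  rw [div_lt_iff₀ hN'] at h1
  rw [lt_div_iff₀ hN'] at h2
  constructor
  · rw [Nat.floor_eq_iff (by nlinarith [k.cast_nonneg (α := ℝ)])]
    constructor <;> linarith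
  · rw [Int.floor_eq_iff]
    push_cast
    constructor <;> linarith

/-- Fatou's lemma for the slopes of `f` over the grids `ℤ / N`. -/
theorem EnergyLE.action_le [FiniteDimensional ℝ F] {B : F →L[ℝ] F} {L : ℝ} {f : ℝ → F}
    (h : EnergyLE B L f) (hf : AbsolutelyContinuousOnInterval f 0 1) :
    ∫⁻ t in Set.Icc (0 : ℝ) 1, ENNReal.ofReal (1 / 2 * ‖B (deriv f t)‖ ^ 2) ≤
      ENNReal.ofReal L := by
  borelize F
  have hlim : ∀ᵐ t ∂volume.restrict (Set.Icc (0 : ℝ) 1),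
      liminf (fun N => ENNReal.ofReal (1 / 2 * ‖B (gridSlope N f t)‖ ^ 2)) atTop =
        ENNReal.ofReal (1 / 2 * ‖B (deriv f t)‖ ^ 2) := by
    rw [ae_restrict_iff' measurableSet_Icc]
    filter_upwards [ae_differentiableAt_of_absolutelyContinuous hf] with t ht htm
    have hc : Continuous fun y : F => ENNReal.ofReal (1 / 2 * ‖B y‖ ^ 2) :=
      ENNReal.continuous_ofReal.comp (by fun_prop)
    exact ((hc.tendsto _).comp
      (tendsto_gridSlope (ht (Set.uIcc_of_le (zero_le_one (α := ℝ)) ▸ htm)))).liminf_eq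
  rw [← lintegral_congr_ae hlim]
  refine (lintegral_liminf_le fun N => ?_).trans ?_
  · have hm : Measurable fun t => gridSlope N f t :=
      (measurable_from_top (f := fun z : ℤ => (N : ℝ) • (f ((z + 1) / N) - f (z / N)))).comp
        (Int.measurable_floor.comp (measurable_const.mul measurable_id))
    have hc : Continuous fun y : F => ENNReal.ofReal (1 / 2 * ‖B y‖ ^ 2) :=
      ENNReal.continuous_ofReal.comp (by fun_prop)
    exact hc.measurable.comp hm
  · refine liminf_le_of_frequently_le' (Eventually.frequently ?_)
    filter_upwards [eventually_gt_atTop 0] with N hN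
    have hN' : (0 : ℝ) < N := by exact_mod_cast hN
    rw [lintegral_Icc_eq_sum hN]
    refine le_trans (le_of_eq ?_) (ENNReal.ofReal_le_ofReal (h.grid hN))
    rw [Finset.mul_sum, ENNReal.ofReal_sum_of_nonneg fun _ _ => by positivity]
    refine Finset.sum_congr rfl fun k _ => ?_
    rw [setLIntegral_congr_fun measurableSet_Ioo (g := fun _ => ENNReal.ofReal
      (1 / 2 * ‖B ((N : ℝ) • (f ((k + 1) / N) - f (k / N)))‖ ^ 2)) fun t ht => ?_]
    · rw [setLIntegral_grid_const hN, ← ENNReal.ofReal_natCast, ← ENNReal.ofReal_inv_of_pos hN',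
        ← ENNReal.ofReal_mul (by positivity), map_smul, norm_smul, Real.norm_eq_abs,
        abs_of_pos hN']
      congr 1
      field_simp
    · simp only [gridSlope]
      rw [(floor_mul_of_mem_cell hN ht).2]
      push_cast
      rfl

end GridSlope

section PathAction

variable {d : ℕ} {Q : Matrix (Fin d) (Fin d) ℝ}
  {B : EuclideanSpace ℝ (Fin d) →L[ℝ] EuclideanSpace ℝ (Fin d)}

theorem quadraticAction_eq
    (hB : ∀ x : EuclideanSpace ℝ (Fin d), inner ℝ (Matrix.toEuclideanLin Q x) x = ‖B x‖ ^ 2)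
    (h : AC0 d) : quadraticAction Q h = ∫⁻ t in Set.Icc (0 : ℝ) 1,
      ENNReal.ofReal (1 / 2 * ‖B (deriv (Set.IccExtend zero_le_one h.1) t)‖ ^ 2) := by
  simp only [quadraticAction, hB]

theorem quadraticAction_le_iff
    (hB : ∀ x : EuclideanSpace ℝ (Fin d), inner ℝ (Matrix.toEuclideanLin Q x) x = ‖B x‖ ^ 2)
    {L : ℝ} (hL : 0 ≤ L) (h : AC0 d) :
    quadraticAction Q h ≤ ENNReal.ofReal L ↔ EnergyLE B L (Set.IccExtend zero_le_one h.1) := by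
  rw [quadraticAction_eq hB]
  exact ⟨energyLE_of_action_le B hL h.2.2, fun he => he.action_le h.2.2⟩

/-- The action of a polygonal path, whose slope is `N w k` on the cell `(k / N, (k + 1) / N)`. -/
theorem quadraticAction_interpolatedPath
    (hB : ∀ x : EuclideanSpace ℝ (Fin d), inner ℝ (Matrix.toEuclideanLin Q x) x = ‖B x‖ ^ 2)
    {N : ℕ} (hN : 0 < N) (w : ℕ → EuclideanSpace ℝ (Fin d)) :
    quadraticAction Q (interpolatedPath N w) =
      ENNReal.ofReal ((N / 2 : ℝ) * ∑ k ∈ Finset.range N, ‖B (w k)‖ ^ 2) := by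
  have hN' : (0 : ℝ) < N := by exact_mod_cast hN
  rw [quadraticAction_eq hB, lintegral_Icc_eq_sum hN, Finset.mul_sum,
    ENNReal.ofReal_sum_of_nonneg fun _ _ => by positivity]
  refine Finset.sum_congr rfl fun k hk => ?_
  have hk' : (k : ℝ) + 1 ≤ N := by exact_mod_cast Finset.mem_range.mp hk
  rw [setLIntegral_congr_fun measurableSet_Ioo (g := fun _ => ENNReal.ofReal
      (1 / 2 * ‖B ((N : ℝ) • w k)‖ ^ 2)) fun t ht => ?_]
  · rw [setLIntegral_grid_const hN, ← ENNReal.ofReal_natCast, ← ENNReal.ofReal_inv_of_pos hN',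
        ← ENNReal.ofReal_mul (by positivity), map_smul, norm_smul, Real.norm_eq_abs,
        abs_of_pos hN']
    congr 1
    field_simp
  · have hd : deriv (Set.IccExtend zero_le_one (interpolatedPath N w).1) t = (N : ℝ) • w k := by
      have he : Set.IccExtend zero_le_one (interpolatedPath N w).1 =ᶠ[𝓝 t] fun s =>
          ∑ j ∈ Finset.range k, w j + (N * s - k) • w k := by
        filter_upwards [isOpen_Ioo.mem_nhds ht] with s hs
        have hs01 : s ∈ Set.Icc (0 : ℝ) 1 := by
          refine ⟨le_trans (by positivity) hs.1.le, hs.2.le.trans ?_⟩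
          rw [div_le_one hN']
          exact hk'
        rw [Set.IccExtend_of_mem _ _ hs01]
        change interpolate N w s = _
        rw [interpolate, (floor_mul_of_mem_cell hN hs).1]
      rw [he.deriv_eq]
      have h1 : HasDerivAt (fun s : ℝ => (N : ℝ) * s - k) N t := by
        simpa using ((hasDerivAt_id t).const_mul (N : ℝ)).sub_const (k : ℝ)
      exact ((h1.smul_const (w k)).const_add _).deriv
    simp only [hd]

/-- The sublevel sets of the action are closed conditions on increments, hence closed under uniform
limits, and they are equicontinuous by the Cauchy–Schwarz inequality. -/
theorem isCompact_quadraticAction_le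
    (hB : ∀ x : EuclideanSpace ℝ (Fin d), inner ℝ (Matrix.toEuclideanLin Q x) x = ‖B x‖ ^ 2)
    {κ : ℝ} (hκ : 0 < κ) (hκB : ∀ x, ‖x‖ ≤ κ * ‖B x‖) {L : ℝ} (hL : 0 ≤ L) :
    IsCompact {h : AC0 d | quadraticAction Q h ≤ ENNReal.ofReal L} := by
  refine (Topology.IsInducing.isCompact_iff (f := (Subtype.val : AC0 d → _)) .subtypeVal).mpr ?_
  have himg : Subtype.val '' {h : AC0 d | quadraticAction Q h ≤ ENNReal.ofReal L} =
      {h : C(unitInterval, EuclideanSpace ℝ (Fin d)) | h 0 = 0 ∧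
        EnergyLE B L (Set.IccExtend zero_le_one h)} := by
    ext h
    constructor
    · rintro ⟨h, hh, rfl⟩
      exact ⟨h.2.1, (quadraticAction_le_iff hB hL h).mp hh⟩
    · rintro ⟨h0, hh⟩
      exact ⟨⟨h, h0, hh.absolutelyContinuousOnInterval hκ hκB⟩,
        (quadraticAction_le_iff hB hL _).mpr hh, rfl⟩
  rw [himg]
  set S := {h : C(unitInterval, EuclideanSpace ℝ (Fin d)) | h 0 = 0 ∧
        EnergyLE B L (Set.IccExtend zero_le_one h)} with hS
  have hinc : ∀ h ∈ S, ∀ s t : unitInterval, ‖h t - h s‖ ≤ κ * √(2 * L * dist s t) := by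
    intro h hh s t
    refine (hκB _).trans ?_
    gcongr
    refine Real.le_sqrt_of_sq_le ?_
    have := hh.2.norm_sub_sq_le s.2 t.2
    rwa [Set.IccExtend_val, Set.IccExtend_val] at this
  have hclosed : IsClosed ((fun h : C(unitInterval, EuclideanSpace ℝ (Fin d)) =>
      (h : unitInterval → EuclideanSpace ℝ (Fin d))) '' S) := by
    have : ((fun h : C(unitInterval, EuclideanSpace ℝ (Fin d)) =>
      (h : unitInterval → EuclideanSpace ℝ (Fin d))) '' S) =
      {h | h 0 = 0 ∧ EnergyLE B L (Set.IccExtend zero_le_one h)} := by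
      ext h
      constructor
      · rintro ⟨h, hh, rfl⟩
        exact hh
      · rintro ⟨h0, hh⟩
        have hc : Continuous h := by
          have := (hh.absolutelyContinuousOnInterval hκ hκB).continuousOn
          rw [Set.uIcc_of_le zero_le_one] at this
          have h2 : h = Set.domRestrict (Set.Icc 0 1) (Set.IccExtend zero_le_one h) := by
            ext1 t
            simp [Set.domRestrict]
          rw [h2]
          exact this.domRestrict
        exact ⟨⟨h, hc⟩, ⟨h0, hh⟩, rfl⟩
    rw [this, Set.ofPred_and]
    refine IsClosed.inter (isClosed_eq (continuous_apply _) continuous_const) ?_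
    simp only [EnergyLE, Set.ofPred_forall]
    refine isClosed_iInter fun E => isClosed_iInter fun _ => ?_
    refine isClosed_le (continuous_finsetSum _ fun i _ => ?_) continuous_const
    simp only [Set.IccExtend, Function.comp]
    fun_prop
  refine ArzelaAscoli.isCompact_of_equicontinuous S ?_ ?_
  · refine IsCompact.of_isClosed_subset (isCompact_univ_pi fun _ : unitInterval =>
      isCompact_closedBall (0 : EuclideanSpace ℝ (Fin d)) (κ * √(2 * L * 1))) hclosed ?_
    rintro _ ⟨h, hh, rfl⟩ t _
    rw [mem_closedBall_zero_iff]
    have := hinc h hh 0 t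
    rw [hh.1, sub_zero] at this
    refine this.trans ?_
    gcongr
    rw [Subtype.dist_eq, dist_comm, Real.dist_eq]
    simp [abs_of_nonneg t.2.1, t.2.2]
  · refine Metric.equicontinuous_of_continuity_modulus (fun r => κ * √(2 * L * r)) ?_ _ ?_
    · have : Continuous fun r : ℝ => κ * √(2 * L * r) := by fun_prop
      simpa using this.tendsto 0
    · intro s t h
      rw [dist_comm, dist_eq_norm]
      exact hinc h.1 h.2 s t

theorem isGoodRateFunction_quadraticAction
    (hB : ∀ x : EuclideanSpace ℝ (Fin d), inner ℝ (Matrix.toEuclideanLin Q x) x = ‖B x‖ ^ 2)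
    {κ : ℝ} (hκ : 0 < κ) (hκB : ∀ x, ‖x‖ ≤ κ * ‖B x‖) :
    IsGoodRateFunction (quadraticAction Q) := by
  have hc : ∀ r : ℝ≥0, IsCompact {h : AC0 d | quadraticAction Q h ≤ r} := fun r => by
    have := isCompact_quadraticAction_le hB hκ hκB r.coe_nonneg
    rwa [ENNReal.ofReal_coe_nnreal] at this
  refine ⟨?_, hc⟩
  rw [lowerSemicontinuous_iff_isClosed_preimage]
  intro r
  induction r with
  | top => simp
  | coe r => exact (hc r).isClosed

end PathAction

/-! ### Expectations and large deviations with a quadratic rate -/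

/-- A positive normalized linear functional on all functions `Ω → ℝ`. The expectation of a random
variable with finitely many values is of this form; no measurability has to be carried along. -/
structure Expectation (Ω : Type*) where
  /-- The underlying linear functional. -/
  toLinearMap : (Ω → ℝ) →ₗ[ℝ] ℝ
  nonneg : ∀ f, 0 ≤ f → 0 ≤ toLinearMap f
  one : toLinearMap 1 = 1

namespace Expectation

variable {Ω : Type*} (E : Expectation Ω)

instance : CoeFun (Expectation Ω) fun _ => (Ω → ℝ) → ℝ := ⟨fun E => E.toLinearMap⟩

theorem mono {f g : Ω → ℝ} (h : ∀ ω, f ω ≤ g ω) : E f ≤ E g := by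
  have := E.nonneg (g - f) fun ω => sub_nonneg.mpr (h ω)
  rwa [map_sub, sub_nonneg] at this

theorem const (c : ℝ) : E (fun _ => c) = c := by
  have : (fun _ : Ω => c) = c • (1 : Ω → ℝ) := by ext; simp
  rw [this, map_smul, E.one, smul_eq_mul, mul_one]

theorem const_mul (c : ℝ) (f : Ω → ℝ) : E (fun ω => c * f ω) = c * E f :=
  E.toLinearMap.map_smul c f

/-- Jensen's inequality for the exponential. -/
theorem exp_le (f : Ω → ℝ) : Real.exp (E f) ≤ E (fun ω => Real.exp (f ω)) := by
  have h : ∀ ω, Real.exp (E f) * (f ω + (1 - E f)) ≤ Real.exp (f ω) := fun ω => by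
    rw [show f ω = E f + (f ω - E f) by ring, Real.exp_add]
    gcongr
    have := Real.add_one_le_exp (f ω - E f)
    linarith
  refine le_trans (le_of_eq ?_) (E.mono h)
  rw [const_mul, show (fun ω => f ω + (1 - E f)) = f + fun _ => (1 - E f) from rfl, map_add,
    E.const]
  ring

theorem exp_pos (f : Ω → ℝ) : 0 < E (fun ω => Real.exp (f ω)) :=
  (Real.exp_pos _).trans_le (E.exp_le f)

/-- The probability of a set. -/
def prob (S : Set Ω) : ℝ := E (S.indicator 1)

theorem prob_nonneg (S : Set Ω) : 0 ≤ E.prob S :=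
  E.nonneg _ (Set.indicator_nonneg fun _ _ => zero_le_one)

theorem prob_mono {S T : Set Ω} (h : S ⊆ T) : E.prob S ≤ E.prob T :=
  E.mono fun ω => Set.indicator_le_indicator_of_subset h (fun _ => zero_le_one) ω

theorem prob_le_one (S : Set Ω) : E.prob S ≤ 1 := by
  rw [← E.one]
  exact E.mono fun ω => Set.indicator_le_self' (fun _ _ => zero_le_one) ω

theorem prob_union_le (S T : Set Ω) : E.prob (S ∪ T) ≤ E.prob S + E.prob T := by
  rw [prob, prob, prob, ← map_add]
  refine E.mono fun ω => ?_
  by_cases hS : ω ∈ S <;> by_cases hT : ω ∈ T <;> simp [hS, hT]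

theorem prob_biUnion_le {ι : Type*} (T : Finset ι) (S : ι → Set Ω) :
    E.prob (⋃ i ∈ T, S i) ≤ ∑ i ∈ T, E.prob (S i) := by
  classical
  induction T using Finset.induction_on with
  | empty => simpa [prob] using (E.const 0).le
  | insert a T ha ih =>
    rw [Finset.set_biUnion_insert, Finset.sum_insert ha]
    exact (E.prob_union_le _ _).trans (by gcongr)

theorem one_le_prob_add_prob_compl (S : Set Ω) : 1 ≤ E.prob S + E.prob Sᶜ := by
  rw [prob, prob, ← map_add, Set.indicator_self_add_compl, E.one]

/-- The exponential Chebyshev inequality. -/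
theorem prob_ge_le (f : Ω → ℝ) (c : ℝ) :
    E.prob {ω | c ≤ f ω} ≤ Real.exp (-c) * E fun ω => Real.exp (f ω) := by
  rw [← E.const_mul, prob]
  refine E.mono fun ω => ?_
  by_cases h : c ≤ f ω
  · rw [Set.indicator_of_mem (by exact h), ← Real.exp_add]
    exact Real.one_le_exp (by linarith)
  · rw [Set.indicator_of_notMem (by exact h)]
    positivity

/-- The expectation with density `exp g / E (exp g)`. -/
def tilt (g : Ω → ℝ) : Expectation Ω where
  toLinearMap := (E fun ω => Real.exp (g ω))⁻¹ •
    (E.toLinearMap ∘ₗ LinearMap.mulRight ℝ fun ω => Real.exp (g ω))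
  nonneg f hf := by
    have h1 := (E.exp_pos g).le
    have h2 := E.nonneg (f * fun ω => Real.exp (g ω)) fun ω => mul_nonneg (hf ω) (Real.exp_pos _).le
    simp only [LinearMap.smul_apply, LinearMap.comp_apply, LinearMap.mulRight_apply, smul_eq_mul]
    positivity
  one := by
    simp only [LinearMap.smul_apply, LinearMap.comp_apply, LinearMap.mulRight_apply, smul_eq_mul,
      one_mul]
    exact inv_mul_cancel₀ (E.exp_pos g).ne'

theorem tilt_apply (g f : Ω → ℝ) :
    E.tilt g f = (E fun ω => Real.exp (g ω))⁻¹ * E (fun ω => f ω * Real.exp (g ω)) := rfl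

end Expectation

section GaertnerEllis

variable {Ω H : Type*} [NormedAddCommGroup H] [InnerProductSpace ℝ H]

/-- The random variables `X n` have, on the scale `s n`, the logarithmic Laplace transform
`θ ↦ |θ|² / 2` of a standard Gaussian. -/
def HasGaussianCgf (E : ℕ → Expectation Ω) (s : ℕ → ℝ) (X : ℕ → Ω → H) : Prop :=
  ∀ θ : H, Tendsto (fun n => (s n)⁻¹ * Real.log (E n fun ω => Real.exp (s n * inner ℝ θ (X n ω))))
    atTop (𝓝 (‖θ‖ ^ 2 / 2))

variable {E : ℕ → Expectation Ω} {s : ℕ → ℝ} {X : ℕ → Ω → H}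

theorem HasGaussianCgf.eventually_le (h : HasGaussianCgf E s X) (hs : Tendsto s atTop atTop)
    (θ : H) {ε : ℝ} (hε : 0 < ε) : ∀ᶠ n in atTop,
      (E n fun ω => Real.exp (s n * inner ℝ θ (X n ω))) ≤ Real.exp (s n * (‖θ‖ ^ 2 / 2 + ε)) := by
  filter_upwards [(h θ).eventually_le_const (lt_add_of_pos_right _ hε), hs.eventually_gt_atTop 0]
    with n hn hs0
  rw [inv_mul_le_iff₀ hs0] at hn
  rwa [← Real.log_le_iff_le_exp ((E n).exp_pos _)]

theorem HasGaussianCgf.eventually_ge (h : HasGaussianCgf E s X) (hs : Tendsto s atTop atTop)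
    (θ : H) {ε : ℝ} (hε : 0 < ε) : ∀ᶠ n in atTop, Real.exp (s n * (‖θ‖ ^ 2 / 2 - ε)) ≤
      (E n fun ω => Real.exp (s n * inner ℝ θ (X n ω))) := by
  filter_upwards [(h θ).eventually_const_le (sub_lt_self _ hε), hs.eventually_gt_atTop 0]
    with n hn hs0
  rw [le_inv_mul_iff₀ hs0] at hn
  rwa [← Real.le_log_iff_exp_le ((E n).exp_pos _)]

theorem eventually_const_mul_exp_le (hs : Tendsto s atTop atTop) (K : ℝ) {a b : ℝ} (hab : a < b) :
    ∀ᶠ n in atTop, K * Real.exp (s n * a) ≤ Real.exp (s n * b) := by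
  have h1 : Tendsto (fun n => Real.exp (s n * (b - a))) atTop atTop :=
    Real.tendsto_exp_atTop.comp (hs.atTop_mul_const (sub_pos.mpr hab))
  filter_upwards [h1.eventually_ge_atTop K] with n hn
  calc K * Real.exp (s n * a) ≤ Real.exp (s n * (b - a)) * Real.exp (s n * a) := by gcongr
    _ = Real.exp (s n * b) := by rw [← Real.exp_add]; congr 1; ring

/-- The upper bound outside a ball: the complement of the ball is covered by finitely many half
spaces, to each of which the exponential Chebyshev inequality applies. -/
theorem HasGaussianCgf.eventually_prob_le [FiniteDimensional ℝ H] (h : HasGaussianCgf E s X)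
    (hs : Tendsto s atTop atTop) {L ε : ℝ} (hL : 0 < L) (hε : 0 < ε) : ∀ᶠ n in atTop,
      (E n).prob {ω | L ≤ ‖X n ω‖ ^ 2 / 2} ≤ Real.exp (s n * -(L - ε)) := by
  -- the margin in the cover below is used in the form `2 L - ε / 4 ≥ 0`
  wlog hεL : ε ≤ L generalizing ε
  · filter_upwards [this hL le_rfl, hs.eventually_gt_atTop 0] with n hn hs0
    refine hn.trans (Real.exp_le_exp.mpr ?_)
    gcongr
    exact (not_le.mp hεL).le
  set R := √(2 * L) with hR
  have hR2 : R ^ 2 = 2 * L := Real.sq_sqrt (by positivity)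
  have hR0 : 0 < R := Real.sqrt_pos.mpr (by positivity)
  obtain ⟨T, hTS, hT⟩ := (isCompact_sphere (0 : H) R).elim_nhds_subcover
    (fun θ => {y | 2 * L - ε / 4 < inner ℝ θ y}) fun θ hθ => by
      refine (isOpen_lt continuous_const (by fun_prop)).mem_nhds ?_
      rw [Set.mem_ofPred_eq, real_inner_self_eq_norm_sq, mem_sphere_zero_iff_norm.mp hθ, hR2]
      linarith
  have hcover : ∀ n, {ω | L ≤ ‖X n ω‖ ^ 2 / 2} ⊆
      ⋃ θ ∈ T, {ω | s n * (2 * L - ε / 4) ≤ s n * inner ℝ θ (X n ω) ∨ s n ≤ 0} := by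
    intro n ω hω
    have hω : L ≤ ‖X n ω‖ ^ 2 / 2 := hω
    have hX : R ≤ ‖X n ω‖ := by
      rw [hR]
      exact Real.sqrt_le_iff.mpr ⟨norm_nonneg _, by linarith⟩
    have hX0 : 0 < ‖X n ω‖ := hR0.trans_le hX
    have hmem : (R / ‖X n ω‖) • X n ω ∈ Metric.sphere (0 : H) R := by
      rw [mem_sphere_zero_iff_norm, norm_smul, Real.norm_eq_abs, abs_of_pos (by positivity),
        div_mul_cancel₀ _ hX0.ne']
    obtain ⟨θ, hθ, hlt⟩ := Set.mem_iUnion₂.mp (hT hmem)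
    rw [Set.mem_ofPred_eq, inner_smul_right] at hlt
    refine Set.mem_iUnion₂.mpr ⟨θ, hθ, ?_⟩
    rcases le_or_gt (s n) 0 with h0 | h0
    · exact Or.inr h0
    · refine Or.inl (mul_le_mul_of_nonneg_left ?_ h0.le)
      have h1 : R / ‖X n ω‖ ≤ 1 := (div_le_one hX0).mpr hX
      have h2 : 0 ≤ R / ‖X n ω‖ := by positivity
      by_contra hc
      nlinarith
  have hev : ∀ᶠ n in atTop, ∀ θ ∈ T,
      (E n fun ω => Real.exp (s n * inner ℝ θ (X n ω))) ≤
        Real.exp (s n * (‖θ‖ ^ 2 / 2 + ε / 4)) :=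
    (Filter.eventually_all_finset T).mpr fun θ _ => h.eventually_le hs θ (by positivity)
  filter_upwards [hev, hs.eventually_gt_atTop 0,
    eventually_const_mul_exp_le hs T.card (show -(L - ε / 2) < -(L - ε) by linarith)]
    with n hn hs0 hcard
  refine le_trans ?_ hcard
  calc (E n).prob {ω | L ≤ ‖X n ω‖ ^ 2 / 2}
      ≤ ∑ θ ∈ T, (E n).prob {ω | s n * (2 * L - ε / 4) ≤ s n * inner ℝ θ (X n ω) ∨ s n ≤ 0} :=
        ((E n).prob_mono (hcover n)).trans ((E n).prob_biUnion_le _ _)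
    _ ≤ ∑ θ ∈ T, Real.exp (s n * -(L - ε / 2)) := by
        refine Finset.sum_le_sum fun θ hθ => ?_
        simp only [hs0.not_ge, or_false]
        refine ((E n).prob_ge_le _ _).trans ?_
        refine (mul_le_mul_of_nonneg_left (hn θ hθ) (Real.exp_pos _).le).trans (le_of_eq ?_)
        rw [← Real.exp_add, mem_sphere_zero_iff_norm.mp (hTS θ hθ), hR2]
        congr 1
        ring
    _ = T.card * Real.exp (s n * -(L - ε / 2)) := by rw [Finset.sum_const, nsmul_eq_mul]

/-- Tilting by `exp (s ⟪x, X⟫)` moves the centre of the Gaussian from `0` to `x`. -/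
theorem HasGaussianCgf.tilt (h : HasGaussianCgf E s X) (hs : Tendsto s atTop atTop) (x : H) :
    HasGaussianCgf (fun n => (E n).tilt fun ω => s n * inner ℝ x (X n ω)) s
      (fun n ω => X n ω - x) := by
  intro θ
  have h1 := ((h (θ + x)).sub (h x)).sub_const (inner ℝ θ x)
  have h2 : ‖θ + x‖ ^ 2 / 2 - ‖x‖ ^ 2 / 2 - inner ℝ θ x = ‖θ‖ ^ 2 / 2 := by
    rw [norm_add_sq_real]; ring
  rw [h2] at h1
  refine h1.congr' ?_
  filter_upwards [hs.eventually_gt_atTop 0] with n hs0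
  rw [Expectation.tilt_apply]
  have h3 : (fun ω => Real.exp (s n * inner ℝ θ (X n ω - x)) * Real.exp (s n * inner ℝ x (X n ω)))
      = fun ω => Real.exp (-(s n * inner ℝ θ x)) * Real.exp (s n * inner ℝ (θ + x) (X n ω)) := by
    ext ω
    rw [← Real.exp_add, ← Real.exp_add, inner_add_left, inner_sub_right]
    congr 1
    ring
  rw [h3, Expectation.const_mul,
    Real.log_mul (inv_ne_zero ((E n).exp_pos _).ne')
      (mul_ne_zero (Real.exp_pos _).ne' ((E n).exp_pos _).ne'),
    Real.log_mul (Real.exp_pos _).ne' ((E n).exp_pos _).ne', Real.log_exp, Real.log_inv]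
  field_simp
  ring

/-- The lower bound in a small ball: under the tilted law the ball has probability at least `1/2`,
by the upper bound. -/
theorem HasGaussianCgf.eventually_le_prob [FiniteDimensional ℝ H] (h : HasGaussianCgf E s X)
    (hs : Tendsto s atTop atTop) (x : H) {δ ε : ℝ} (hδ : 0 < δ) (hε : 0 < ε) : ∀ᶠ n in atTop,
      Real.exp (s n * -(‖x‖ ^ 2 / 2 + ε)) ≤ (E n).prob {ω | ‖X n ω - x‖ < δ} := by
  -- on a small ball the density of the tilted law is almost constant
  wlog hδx : ‖x‖ * δ ≤ ε / 2 generalizing δ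
  · have hδ' : 0 < min δ (ε / 2 / (‖x‖ + 1)) := lt_min hδ (by positivity)
    filter_upwards [this hδ' (by
      calc ‖x‖ * min δ (ε / 2 / (‖x‖ + 1)) ≤ ‖x‖ * (ε / 2 / (‖x‖ + 1)) := by
            gcongr; exact min_le_right _ _
        _ = ε / 2 * (‖x‖ / (‖x‖ + 1)) := by ring
        _ ≤ ε / 2 * 1 := by
            gcongr
            rw [div_le_one (by positivity)]
            linarith
        _ = _ := mul_one _)] with n hn
    exact hn.trans ((E n).prob_mono fun ω (hω : ‖X n ω - x‖ < _) =>
      hω.trans_le (min_le_left _ _))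
  have h1 := (h.tilt hs x).eventually_prob_le hs (L := δ ^ 2 / 2) (ε := δ ^ 2 / 4)
    (by positivity) (by positivity)
  filter_upwards [h1, h.eventually_ge hs x (ε := ε / 4) (by positivity), hs.eventually_gt_atTop 0,
    eventually_const_mul_exp_le hs 2 (show -(δ ^ 2 / 2 - δ ^ 2 / 4) < 0 by nlinarith),
    eventually_const_mul_exp_le hs 2
      (show -(‖x‖ ^ 2 / 2 + ε) < -(‖x‖ ^ 2 / 2 + 3 * ε / 4) by linarith)] with n hn1 hn2 hs0 hn3 hn4
  set S := {ω | ‖X n ω - x‖ < δ} with hS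
  set Et := (E n).tilt fun ω => s n * inner ℝ x (X n ω) with hEt
  have hcompl : Sᶜ ⊆ {ω | δ ^ 2 / 2 ≤ ‖X n ω - x‖ ^ 2 / 2} := by
    intro ω hω
    have : δ ≤ ‖X n ω - x‖ := not_lt.mp hω
    rw [Set.mem_ofPred_eq]
    gcongr
  have h2 : 1 / 2 ≤ Et.prob S := by
    have h3 := Et.one_le_prob_add_prob_compl S
    have h4 := (Et.prob_mono hcompl).trans hn1
    simp only [mul_zero, Real.exp_zero] at hn3
    linarith
  have h5 : Et.prob S * (E n fun ω => Real.exp (s n * inner ℝ x (X n ω))) ≤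
      Real.exp (s n * (‖x‖ ^ 2 + ε / 2)) * (E n).prob S := by
    rw [Expectation.prob, hEt, Expectation.tilt_apply, mul_comm, ← mul_assoc,
      mul_inv_cancel₀ ((E n).exp_pos _).ne', one_mul, Expectation.prob, ← Expectation.const_mul]
    refine (E n).mono fun ω => ?_
    by_cases hω : ω ∈ S
    · rw [Set.indicator_of_mem hω, Pi.one_apply, one_mul, mul_one]
      refine Real.exp_le_exp.mpr (mul_le_mul_of_nonneg_left ?_ hs0.le)
      have h6 : inner ℝ x (X n ω) = ‖x‖ ^ 2 + inner ℝ x (X n ω - x) := by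
        rw [inner_sub_right, real_inner_self_eq_norm_sq]; ring
      have h7 := real_inner_le_norm x (X n ω - x)
      have h8 : ‖X n ω - x‖ ≤ δ := le_of_lt hω
      rw [h6]
      nlinarith [norm_nonneg x]
    · rw [Set.indicator_of_notMem hω, zero_mul, mul_zero]
  have h9 : 1 / 2 * Real.exp (s n * (‖x‖ ^ 2 / 2 - ε / 4)) ≤
      Real.exp (s n * (‖x‖ ^ 2 + ε / 2)) * (E n).prob S :=
    le_trans (mul_le_mul h2 hn2 (Real.exp_pos _).le (by linarith)) h5
  rw [← mul_le_mul_iff_right₀ (Real.exp_pos (s n * (‖x‖ ^ 2 + ε / 2)))]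
  refine le_trans ?_ h9
  rw [show Real.exp (s n * (‖x‖ ^ 2 / 2 - ε / 4)) = Real.exp (s n * (‖x‖ ^ 2 + ε / 2)) *
    Real.exp (s n * -(‖x‖ ^ 2 / 2 + 3 * ε / 4)) by rw [← Real.exp_add]; congr 1; ring]
  nlinarith [Real.exp_pos (s n * (‖x‖ ^ 2 + ε / 2))]

end GaertnerEllis

/-! ### From grid increments to paths -/

section Polygon

variable {d : ℕ}

/-- A path in `AC0 d`, extended to `ℝ` by constants. -/
abbrev AC0.ext (h : AC0 d) : ℝ → EuclideanSpace ℝ (Fin d) := Set.IccExtend zero_le_one h.1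

theorem AC0.ext_apply_of_mem (h : AC0 d) {t : ℝ} (ht : t ∈ Set.Icc (0 : ℝ) 1) :
    h.ext t = h.1 ⟨t, ht⟩ := Set.IccExtend_of_mem _ _ ht

theorem AC0.ext_zero (h : AC0 d) : h.ext 0 = 0 := by
  rw [AC0.ext_apply_of_mem h ⟨le_rfl, zero_le_one⟩]
  exact h.2.1

theorem AC0.dist_le_iff {h h' : AC0 d} {δ : ℝ} (hδ : 0 ≤ δ) :
    dist h h' ≤ δ ↔ ∀ t ∈ Set.Icc (0 : ℝ) 1, ‖h.ext t - h'.ext t‖ ≤ δ := by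
  rw [Subtype.dist_eq, ContinuousMap.dist_le hδ]
  constructor
  · intro H t ht
    rw [AC0.ext_apply_of_mem _ ht, AC0.ext_apply_of_mem _ ht, ← dist_eq_norm]
    exact H _
  · intro H t
    rw [dist_eq_norm]
    have := H t t.2
    rwa [AC0.ext_apply_of_mem _ t.2, AC0.ext_apply_of_mem _ t.2] at this

/-- The increments of a path over the cells of the grid `ℤ / N`. -/
def gridIncrement (N : ℕ) (h : AC0 d) (k : ℕ) : EuclideanSpace ℝ (Fin d) :=
  h.ext ((k + 1) / N) - h.ext (k / N)

theorem sum_gridIncrement (N : ℕ) (h : AC0 d) (m : ℕ) :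
    ∑ k ∈ Finset.range m, gridIncrement N h k = h.ext (m / N) := by
  have := Finset.sum_range_sub (fun k : ℕ => h.ext (k / N)) m
  simp only [Nat.cast_add, Nat.cast_one, Nat.cast_zero, zero_div, AC0.ext_zero, sub_zero] at this
  exact this

/-- The polygonal path that agrees with `h` on the grid `ℤ / N`. -/
def polygon (N : ℕ) (h : AC0 d) : AC0 d := interpolatedPath N (gridIncrement N h)

theorem interpolatedPath_ext (N : ℕ) (w : ℕ → EuclideanSpace ℝ (Fin d)) {t : ℝ}
    (ht : t ∈ Set.Icc (0 : ℝ) 1) : (interpolatedPath N w).ext t = interpolate N w t :=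
  AC0.ext_apply_of_mem _ ht

/-- The path `h` moves by less than `δ` within each cell of the grid `ℤ / N`. -/
def SmallOscillation (N : ℕ) (δ : ℝ) (h : AC0 d) : Prop :=
  ∀ j < N, ∀ t ∈ Set.Icc (j / N : ℝ) ((j + 1) / N), ‖h.ext t - h.ext (j / N)‖ < δ

theorem exists_cell {N : ℕ} (hN : 0 < N) {t : ℝ} (ht : t ∈ Set.Icc (0 : ℝ) 1) :
    ⌊N * t⌋₊ < N ∧ t ∈ Set.Icc (⌊N * t⌋₊ / N : ℝ) ((⌊N * t⌋₊ + 1) / N) ∨ t = 1 := by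
  have hN' : (0 : ℝ) < N := by exact_mod_cast hN
  rcases ht.2.eq_or_lt with h1 | h1
  · exact Or.inr h1
  have h0 : 0 ≤ N * t := mul_nonneg hN'.le ht.1
  refine Or.inl ⟨?_, ?_, ?_⟩
  · rw [Nat.floor_lt h0]
    nlinarith
  · rw [div_le_iff₀ hN', mul_comm t]
    exact Nat.floor_le h0
  · rw [le_div_iff₀ hN', mul_comm t]
    exact (Nat.lt_floor_add_one _).le

theorem SmallOscillation.dist_polygon_le {N : ℕ} (hN : 0 < N) {δ : ℝ} (hδ : 0 ≤ δ) {h : AC0 d}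
    (ho : SmallOscillation N δ h) : dist h (polygon N h) ≤ 2 * δ := by
  have hN' : (0 : ℝ) < N := by exact_mod_cast hN
  rw [AC0.dist_le_iff (by positivity)]
  intro t ht
  rw [polygon, interpolatedPath_ext _ _ ht, interpolate, sum_gridIncrement]
  rcases exists_cell hN ht with ⟨hk, htk⟩ | rfl
  · set k := ⌊N * t⌋₊
    have h1 := (ho k hk t htk).le
    have h2 := (ho k hk ((k + 1) / N) ⟨by gcongr; linarith, le_rfl⟩).le
    have h3 : ‖((N * t - k : ℝ)) • gridIncrement N h k‖ ≤ 1 * δ := by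
      rw [norm_smul, Real.norm_eq_abs]
      have h4 := (div_le_iff₀ hN').mp htk.1
      have h5 := (le_div_iff₀ hN').mp htk.2
      have h6 : |(N * t - k : ℝ)| ≤ 1 := by
        rw [abs_le]; constructor <;> linarith
      exact mul_le_mul h6 h2 (norm_nonneg _) zero_le_one
    rw [← sub_sub]
    refine (norm_sub_le _ _).trans ?_
    linarith
  · rw [mul_one, Nat.floor_natCast, sub_self, zero_smul, add_zero, div_self hN'.ne', sub_self,
      norm_zero]
    positivity

theorem dist_polygon_polygon_le (N : ℕ) (h h' : AC0 d) :
    dist (polygon N h) (polygon N h') ≤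
      ∑ k ∈ Finset.range N, ‖gridIncrement N h k - gridIncrement N h' k‖ := by
  rw [AC0.dist_le_iff (Finset.sum_nonneg fun _ _ => norm_nonneg _)]
  intro t ht
  rw [polygon, polygon, interpolatedPath_ext _ _ ht, interpolatedPath_ext _ _ ht,
    interpolate_eq_sum _ _ ht.1 ht.2, interpolate_eq_sum _ _ ht.1 ht.2, ← Finset.sum_sub_distrib]
  refine (norm_sum_le _ _).trans (Finset.sum_le_sum fun k _ => ?_)
  rw [← smul_sub, norm_smul, Real.norm_eq_abs, abs_of_nonneg (le_max_left _ _)]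
  exact mul_le_of_le_one_left (norm_nonneg _) (max_le zero_le_one (min_le_left _ _))

theorem eventually_smallOscillation (h : AC0 d) {δ : ℝ} (hδ : 0 < δ) :
    ∀ᶠ N in atTop, SmallOscillation N δ h := by
  have huc : UniformContinuous h.ext :=
    (CompactSpace.uniformContinuous_of_continuous h.1.continuous).comp
      (LipschitzWith.projIcc zero_le_one).uniformContinuous
  obtain ⟨η, hη, hd⟩ := Metric.uniformContinuous_iff.mp huc δ hδ
  obtain ⟨N₀, hN₀⟩ := exists_nat_gt (1 / η)
  filter_upwards [eventually_ge_atTop N₀] with N hN j hj t ht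
  have hN' : (0 : ℝ) < N := by exact_mod_cast (Nat.zero_le j).trans_lt hj
  have hN1 : (N₀ : ℝ) ≤ N := by exact_mod_cast hN
  have hNη : 1 / (N : ℝ) < η := by
    rw [div_lt_comm₀ hN' hη]
    linarith
  rw [← dist_eq_norm]
  apply hd
  rw [Real.dist_eq, abs_of_nonneg (sub_nonneg.mpr ht.1)]
  have := ht.2
  rw [add_div] at this
  linarith

variable {Q : Matrix (Fin d) (Fin d) ℝ}
  {B : EuclideanSpace ℝ (Fin d) →L[ℝ] EuclideanSpace ℝ (Fin d)}

/-- The increments over the grid `ℤ / N` as one Euclidean vector, normalized so that half of its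
squared norm is the action of the polygonal path. -/
def gridVector (B : EuclideanSpace ℝ (Fin d) →L[ℝ] EuclideanSpace ℝ (Fin d)) (N : ℕ) (h : AC0 d) :
    PiLp 2 (fun _ : Fin N => EuclideanSpace ℝ (Fin d)) :=
  WithLp.toLp 2 fun j => √N • B (gridIncrement N h j)

theorem norm_gridVector_sq (N : ℕ) (h : AC0 d) :
    ‖gridVector B N h‖ ^ 2 / 2 =
      (N / 2 : ℝ) * ∑ k ∈ Finset.range N, ‖B (gridIncrement N h k)‖ ^ 2 := by
  rw [PiLp.norm_sq_eq_of_L2, Finset.sum_range, Finset.mul_sum, Finset.sum_div]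
  refine Finset.sum_congr rfl fun k _ => ?_
  rw [gridVector, PiLp.toLp_apply, norm_smul, mul_pow, Real.norm_eq_abs, sq_abs,
    Real.sq_sqrt (Nat.cast_nonneg _)]
  ring

theorem quadraticAction_polygon
    (hB : ∀ x : EuclideanSpace ℝ (Fin d), inner ℝ (Matrix.toEuclideanLin Q x) x = ‖B x‖ ^ 2)
    {N : ℕ} (hN : 0 < N) (h : AC0 d) :
    quadraticAction Q (polygon N h) = ENNReal.ofReal (‖gridVector B N h‖ ^ 2 / 2) := by
  rw [polygon, quadraticAction_interpolatedPath hB hN, norm_gridVector_sq]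

theorem norm_gridVector_le
    (hB : ∀ x : EuclideanSpace ℝ (Fin d), inner ℝ (Matrix.toEuclideanLin Q x) x = ‖B x‖ ^ 2)
    {N : ℕ} (hN : 0 < N) {h : AC0 d} (hh : quadraticAction Q h ≠ ⊤) :
    ‖gridVector B N h‖ ^ 2 / 2 ≤ (quadraticAction Q h).toReal := by
  rw [norm_gridVector_sq]
  refine EnergyLE.grid ?_ hN
  rw [← quadraticAction_le_iff hB ENNReal.toReal_nonneg, ENNReal.ofReal_toReal hh]

theorem norm_gridIncrement_sub_le {κ : ℝ} (hκ : 0 < κ) (hκB : ∀ x, ‖x‖ ≤ κ * ‖B x‖) {N k : ℕ}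
    (hk : k < N) (h h' : AC0 d) : ‖gridIncrement N h k - gridIncrement N h' k‖ ≤
      κ * ‖gridVector B N h - gridVector B N h'‖ := by
  refine (hκB _).trans (mul_le_mul_of_nonneg_left ?_ hκ.le)
  refine le_trans ?_ (PiLp.norm_apply_le (gridVector B N h - gridVector B N h') ⟨k, hk⟩)
  rw [PiLp.sub_apply, gridVector, gridVector, PiLp.toLp_apply, PiLp.toLp_apply, ← smul_sub,
    ← map_sub, norm_smul, Real.norm_eq_abs, abs_of_nonneg (Real.sqrt_nonneg _)]
  refine le_mul_of_one_le_left (norm_nonneg _) (Real.one_le_sqrt.mpr ?_)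
  exact_mod_cast (Nat.zero_le k).trans_lt hk

end Polygon

section FreidlinWentzell

variable {Ω : Type*} {d : ℕ} {Q : Matrix (Fin d) (Fin d) ℝ}
  {B : EuclideanSpace ℝ (Fin d) →L[ℝ] EuclideanSpace ℝ (Fin d)}
  {E : ℕ → Expectation Ω} {s : ℕ → ℝ} {Z : ℕ → Ω → AC0 d}

/-- The oscillation of `Z n` within the cells of the grid `ℤ / N` is negligible on the scale `s n`,
to any exponential order, if `N` is large. -/
def ExponentiallySmallOscillation (E : ℕ → Expectation Ω) (s : ℕ → ℝ) (Z : ℕ → Ω → AC0 d) : Prop :=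
  ∀ δ > 0, ∀ L : ℝ, ∀ᶠ N in atTop, ∀ᶠ n in atTop,
    (E n).prob {ω | ¬ SmallOscillation N δ (Z n ω)} ≤ Real.exp (s n * -L)

/-- A closed set on which the action exceeds `L` has positive distance from the compact set of the
paths with action at most `L`. Therefore `Z n` can lie in it only if `Z n` is far from its polygonal
approximation or if this approximation has action more than `L`. -/
theorem eventually_prob_mem_closed_le
    (hB : ∀ x : EuclideanSpace ℝ (Fin d), inner ℝ (Matrix.toEuclideanLin Q x) x = ‖B x‖ ^ 2)
    {κ : ℝ} (hκ : 0 < κ) (hκB : ∀ x, ‖x‖ ≤ κ * ‖B x‖) (hs : Tendsto s atTop atTop)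
    (hgauss : ∀ N > 0, HasGaussianCgf E s fun n ω => gridVector B N (Z n ω))
    (hosc : ExponentiallySmallOscillation E s Z) {C : Set (AC0 d)} (hC : IsClosed C) {L ε : ℝ}
    (hL : 0 < L) (hε : 0 < ε) (hCL : ∀ h ∈ C, ENNReal.ofReal L < quadraticAction Q h) :
    ∀ᶠ n in atTop, (E n).prob {ω | Z n ω ∈ C} ≤ Real.exp (s n * -(L - ε)) := by
  have hdisj : Disjoint {h : AC0 d | quadraticAction Q h ≤ ENNReal.ofReal L} C :=
    Set.disjoint_left.mpr fun h hh hhC => (hCL h hhC).not_ge hh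
  obtain ⟨δ, hδ, hthick⟩ := hdisj.exists_thickenings
    (isCompact_quadraticAction_le hB hκ hκB hL.le) hC
  obtain ⟨N, hN0, hN⟩ := ((eventually_gt_atTop 0).and (hosc (δ / 4) (by positivity) L)).exists
  filter_upwards [hN, (hgauss N hN0).eventually_prob_le hs hL (half_pos hε),
    hs.eventually_gt_atTop 0, eventually_const_mul_exp_le hs 2
      (show -(L - ε / 2) < -(L - ε) by linarith)] with n hn1 hn2 hs0 hn3
  have hsub : {ω | Z n ω ∈ C} ⊆ {ω | ¬ SmallOscillation N (δ / 4) (Z n ω)} ∪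
      {ω | L ≤ ‖gridVector B N (Z n ω)‖ ^ 2 / 2} := by
    intro ω hω
    by_contra hc
    simp only [Set.mem_union, Set.mem_ofPred_eq, not_or, not_not, not_le] at hc
    have h1 := hc.1.dist_polygon_le hN0 (by positivity)
    have h2 : polygon N (Z n ω) ∈ {h : AC0 d | quadraticAction Q h ≤ ENNReal.ofReal L} := by
      rw [Set.mem_ofPred_eq, quadraticAction_polygon hB hN0]
      exact ENNReal.ofReal_le_ofReal hc.2.le
    refine Set.disjoint_left.mp hthick (Metric.self_subset_thickening hδ _ h2)
      (Metric.mem_thickening_iff.mpr ⟨Z n ω, hω, ?_⟩)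
    rw [dist_comm]
    linarith
  refine ((E n).prob_mono hsub).trans (((E n).prob_union_le _ _).trans ?_)
  have h4 : Real.exp (s n * -L) ≤ Real.exp (s n * -(L - ε / 2)) := by
    gcongr; linarith
  linarith

/-- The path `Z n` is close to a path `h` of finite action as soon as its grid increments are close
to those of `h` and its oscillation is small; the grid increments of `h` have energy at most its
action. -/
theorem eventually_le_prob_mem_open
    (hB : ∀ x : EuclideanSpace ℝ (Fin d), inner ℝ (Matrix.toEuclideanLin Q x) x = ‖B x‖ ^ 2)
    {κ : ℝ} (hκ : 0 < κ) (hκB : ∀ x, ‖x‖ ≤ κ * ‖B x‖) (hs : Tendsto s atTop atTop)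
    (hgauss : ∀ N > 0, HasGaussianCgf E s fun n ω => gridVector B N (Z n ω))
    (hosc : ExponentiallySmallOscillation E s Z) {U : Set (AC0 d)} (hU : IsOpen U) {h : AC0 d}
    (hhU : h ∈ U) (hh : quadraticAction Q h ≠ ⊤) {ε : ℝ} (hε : 0 < ε) :
    ∀ᶠ n in atTop, Real.exp (s n * -((quadraticAction Q h).toReal + ε)) ≤
      (E n).prob {ω | Z n ω ∈ U} := by
  obtain ⟨δ, hδ, hball⟩ := Metric.isOpen_iff.mp hU h hhU
  set J := (quadraticAction Q h).toReal
  obtain ⟨N, hN0, hN, hNh⟩ := ((eventually_gt_atTop 0).and ((hosc (δ / 8) (by positivity)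
    (J + ε)).and (eventually_smallOscillation h (δ := δ / 8) (by positivity)))).exists
  have hN0' : (0 : ℝ) < N := by exact_mod_cast hN0
  -- `N` increments, each with an error of `κ δ / (4 N κ)`, add up to `δ / 4`
  have hη : 0 < δ / (4 * N * κ) := by positivity
  filter_upwards [hN, (hgauss N hN0).eventually_le_prob hs (gridVector B N h) hη
    (show 0 < ε / 2 / 2 by positivity), hs.eventually_gt_atTop 0,
    eventually_const_mul_exp_le hs 2 (show -(J + ε) < -(J + ε / 2 / 2) by linarith)]
    with n hn1 hn2 hs0 hn3
  have hsub : {ω | ‖gridVector B N (Z n ω) - gridVector B N h‖ < δ / (4 * N * κ)} ⊆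
      {ω | Z n ω ∈ U} ∪ {ω | ¬ SmallOscillation N (δ / 8) (Z n ω)} := by
    intro ω hω
    have hω : ‖gridVector B N (Z n ω) - gridVector B N h‖ < δ / (4 * N * κ) := hω
    by_cases ho : SmallOscillation N (δ / 8) (Z n ω)
    · refine Or.inl (hball ?_)
      have h1 := ho.dist_polygon_le hN0 (by positivity)
      have h2 := hNh.dist_polygon_le hN0 (by positivity)
      have h3 : dist (polygon N (Z n ω)) (polygon N h) ≤ δ / 4 := by
        refine (dist_polygon_polygon_le N _ _).trans ?_
        calc _ ≤ ∑ k ∈ Finset.range N, κ * (δ / (4 * N * κ)) :=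
              Finset.sum_le_sum fun k hk =>
                (norm_gridIncrement_sub_le hκ hκB (Finset.mem_range.mp hk) _ _).trans (by gcongr)
          _ = δ / 4 := by
              rw [Finset.sum_const, Finset.card_range, nsmul_eq_mul]
              field_simp
      rw [Metric.mem_ball]
      have h4 := dist_triangle4 (Z n ω) (polygon N (Z n ω)) (polygon N h) h
      rw [dist_comm (polygon N h) h] at h4
      linarith
    · exact Or.inr ho
  have h5 := ((E n).prob_mono hsub).trans ((E n).prob_union_le _ _)
  have h6 : Real.exp (s n * -(J + ε / 2 / 2)) ≤
      Real.exp (s n * -(‖gridVector B N h‖ ^ 2 / 2 + ε / 2 / 2)) := by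
    have := norm_gridVector_le hB hN0 hh
    gcongr
  linarith

theorem inv_mul_log_ofReal_le {r s c : ℝ} (hs : 0 < s) (h : r ≤ Real.exp (s * c)) :
    ((s⁻¹ : ℝ) : EReal) * ENNReal.log (ENNReal.ofReal r) ≤ c := by
  have h1 : ENNReal.log (ENNReal.ofReal r) ≤ ((s * c : ℝ) : EReal) := by
    rw [← Real.log_exp (s * c), ← ENNReal.log_ofReal_of_pos (Real.exp_pos _)]
    exact ENNReal.log_le_log (ENNReal.ofReal_le_ofReal h)
  calc _ ≤ ((s⁻¹ : ℝ) : EReal) * ((s * c : ℝ) : EReal) :=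
        mul_le_mul_of_nonneg_left h1 (by exact_mod_cast (inv_pos.mpr hs).le)
    _ = c := by
        rw [← EReal.coe_mul, inv_mul_cancel_left₀ hs.ne']

theorem le_inv_mul_log_ofReal {r s c : ℝ} (hs : 0 < s) (h : Real.exp (s * c) ≤ r) :
    c ≤ ((s⁻¹ : ℝ) : EReal) * ENNReal.log (ENNReal.ofReal r) := by
  have h1 : ((s * c : ℝ) : EReal) ≤ ENNReal.log (ENNReal.ofReal r) := by
    rw [← Real.log_exp (s * c), ← ENNReal.log_ofReal_of_pos (Real.exp_pos _)]
    exact ENNReal.log_le_log (ENNReal.ofReal_le_ofReal h)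
  calc (c : EReal) = ((s⁻¹ : ℝ) : EReal) * ((s * c : ℝ) : EReal) := by
        rw [← EReal.coe_mul, inv_mul_cancel_left₀ hs.ne']
    _ ≤ _ := mul_le_mul_of_nonneg_left h1 (by exact_mod_cast (inv_pos.mpr hs).le)

/-- The large deviation principle of Freidlin–Wentzell type for a measure `ℙ` under which `Z' n` has
the law of `Z n` under `E n`. -/
theorem satisfiesLDP_of_gaussian
    (hB : ∀ x : EuclideanSpace ℝ (Fin d), inner ℝ (Matrix.toEuclideanLin Q x) x = ‖B x‖ ^ 2)
    {κ : ℝ} (hκ : 0 < κ) (hκB : ∀ x, ‖x‖ ≤ κ * ‖B x‖) (hs : Tendsto s atTop atTop)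
    (hgauss : ∀ N > 0, HasGaussianCgf E s fun n ω => gridVector B N (Z n ω))
    (hosc : ExponentiallySmallOscillation E s Z)
    {Ω' : Type*} [MeasurableSpace Ω'] {ℙ : Measure Ω'} [IsProbabilityMeasure ℙ]
    {Z' : ℕ → Ω' → AC0 d}
    (hlaw : ∀ n (A : Set (AC0 d)), ℙ {ω | Z' n ω ∈ A} =
      ENNReal.ofReal ((E n).prob {ω | Z n ω ∈ A})) :
    SatisfiesLDP ℙ Z' s (quadraticAction Q) := by
  intro A _
  refine ⟨?_, liminf_le_limsup, ?_⟩
  · rw [EReal.neg_le, le_iInf₂_iff]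
    intro h hh
    rw [EReal.neg_le]
    by_cases htop : quadraticAction Q h = ⊤
    · simp [htop]
    rw [← ENNReal.ofReal_toReal htop, EReal.coe_ennreal_ofReal, max_eq_left ENNReal.toReal_nonneg]
    set J := (quadraticAction Q h).toReal
    refine EReal.ge_of_forall_gt_iff_ge.mp fun z hz => ?_
    have hz' : z < -J := by exact_mod_cast hz
    refine le_liminf_of_le (by isBoundedDefault) ?_
    filter_upwards [eventually_le_prob_mem_open hB hκ hκB hs hgauss hosc isOpen_interior hh htop
      (show 0 < -J - z by linarith), hs.eventually_gt_atTop 0] with n hn hs0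
    rw [hlaw]
    refine le_inv_mul_log_ofReal hs0 (le_trans (le_of_eq ?_) (hn.trans ((E n).prob_mono ?_)))
    · congr 2
      ring
    · exact fun ω (hω : Z n ω ∈ interior A) => (interior_subset hω : Z n ω ∈ A)
  · refine EReal.le_of_forall_lt_iff_le.mp fun z hz => ?_
    refine limsup_le_of_le (by isBoundedDefault) ?_
    rcases le_or_gt 0 z with hz0 | hz0
    · filter_upwards [hs.eventually_gt_atTop 0] with n hs0
      refine le_trans ?_ (show ((0 : ℝ) : EReal) ≤ z by exact_mod_cast hz0)
      rw [← ENNReal.ofReal_toReal (measure_ne_top ℙ {ω | Z' n ω ∈ A})]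
      refine inv_mul_log_ofReal_le hs0 ?_
      rw [mul_zero, Real.exp_zero]
      exact measureReal_le_one
    · obtain ⟨L, hL1, hL2⟩ := EReal.lt_iff_exists_real_btwn.mp (EReal.neg_lt_comm.mp hz)
      have hL1' : -z < L := by exact_mod_cast hL1
      have hCL : ∀ h ∈ closure A, ENNReal.ofReal L < quadraticAction Q h := fun h hh => by
        have h1 := hL2.trans_le (iInf₂_le h hh)
        rw [← EReal.coe_ennreal_lt_coe_ennreal_iff, EReal.coe_ennreal_ofReal,
          max_eq_left (by linarith)]
        exact h1
      filter_upwards [eventually_prob_mem_closed_le hB hκ hκB hs hgauss hosc isClosed_closure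
        (by linarith) (show 0 < L + z by linarith) hCL, hs.eventually_gt_atTop 0] with n hn hs0
      rw [hlaw]
      refine inv_mul_log_ofReal_le hs0 (((E n).prob_mono ?_).trans (hn.trans (le_of_eq ?_)))
      · exact fun ω (hω : Z n ω ∈ A) => (subset_closure hω : Z n ω ∈ closure A)
      · congr 2
        ring

end FreidlinWentzell

/-! ### The random walk on a finite graph -/

theorem abs_exp_sub_taylor_one_le (x : ℝ) : |Real.exp x - 1 - x| ≤ x ^ 2 * Real.exp |x| := by
  have h := Complex.norm_exp_sub_sum_le_norm_mul_exp (x : ℂ) 2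
  have h2 : Complex.exp x - ∑ m ∈ Finset.range 2, (x : ℂ) ^ m / (m.factorial : ℂ) =
      ((Real.exp x - 1 - x : ℝ) : ℂ) := by
    simp [Finset.sum_range_succ]
    ring
  rwa [h2, Complex.norm_real, Complex.norm_real, Real.norm_eq_abs, Real.norm_eq_abs, sq_abs] at h

theorem abs_exp_sub_taylor_two_le (x : ℝ) :
    |Real.exp x - 1 - x - x ^ 2 / 2| ≤ |x| ^ 3 * Real.exp |x| := by
  have h := Complex.norm_exp_sub_sum_le_norm_mul_exp (x : ℂ) 3
  have h2 : Complex.exp x - ∑ m ∈ Finset.range 3, (x : ℂ) ^ m / (m.factorial : ℂ) =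
      ((Real.exp x - 1 - x - x ^ 2 / 2 : ℝ) : ℂ) := by
    simp [Finset.sum_range_succ, Nat.factorial]
    ring
  rwa [h2, Complex.norm_real, Complex.norm_real, Real.norm_eq_abs, Real.norm_eq_abs] at h

theorem exists_forall_abs_le {α : Type*} [Finite α] (f : α → ℝ) :
    ∃ K, 0 ≤ K ∧ ∀ a, |f a| ≤ K := by
  obtain ⟨K, hK⟩ := (Set.finite_range fun a => |f a|).bddAbove
  exact ⟨max K 0, le_max_right _ _, fun a => (hK ⟨a, rfl⟩).trans (le_max_left _ _)⟩

theorem exp_neg_two_mul_le {x : ℝ} (h0 : 0 ≤ x) (h : x ≤ 1 / 2) : Real.exp (-(2 * x)) ≤ 1 - x := by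
  rw [Real.exp_neg, inv_le_comm₀ (Real.exp_pos _) (by linarith),
    inv_le_iff_one_le_mul₀ (by linarith)]
  nlinarith [Real.add_one_le_exp (2 * x)]

theorem Expectation.abs_sub_le {Ω : Type*} (E : Expectation Ω) {f g : Ω → ℝ} {c : ℝ}
    (h : ∀ ω, |f ω - g ω| ≤ c) : |E f - E g| ≤ c := by
  rw [← map_sub, abs_le]
  constructor
  · rw [← E.const (-c)]
    exact E.mono fun ω => (abs_le.mp (h ω)).1
  · rw [← E.const c]
    exact E.mono fun ω => (abs_le.mp (h ω)).2

/-- The second order expansion of the exponential moment of `r D + r² w / 2`, for `D` centred and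
`w` that compensates the variance of `D`. -/
theorem Expectation.abs_exp_sub_one_le {Ω : Type*} (E : Expectation Ω) {D w : Ω → ℝ} {M₁ M₂ : ℝ}
    (hM₁0 : 0 ≤ M₁) (hM₂0 : 0 ≤ M₂) (hM₁ : ∀ ω, |D ω| ≤ M₁) (hM₂ : ∀ ω, |w ω| ≤ M₂)
    (hD : E D = 0) (hw : E (fun ω => D ω ^ 2 + w ω) = 0) {r : ℝ} (hr0 : 0 ≤ r) (hr1 : r ≤ 1) :
    |E (fun ω => Real.exp (r * D ω + r ^ 2 / 2 * w ω)) - 1| ≤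
      ((M₁ + M₂) ^ 3 * Real.exp (M₁ + M₂) + (M₁ + M₂) ^ 2 + 1) * r ^ 3 := by
  set M := M₁ + M₂ with hM
  have hM0 : 0 ≤ M := by positivity
  set F : Ω → ℝ := fun ω => r * D ω + r ^ 2 / 2 * w ω with hF
  have h1 : E (fun ω => 1 + r * D ω + r ^ 2 / 2 * (D ω ^ 2 + w ω)) = 1 := by
    have h2 : (fun ω => 1 + r * D ω + r ^ 2 / 2 * (D ω ^ 2 + w ω)) =
        (fun _ => (1 : ℝ)) + (fun ω => r * D ω) + (fun ω => r ^ 2 / 2 * (D ω ^ 2 + w ω)) := by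
      ext ω
      simp only [Pi.add_apply]
    rw [h2, map_add, map_add, E.const, E.const_mul, E.const_mul, hD, hw]
    ring
  refine h1 ▸ E.abs_sub_le fun e => ?_
  have hDe := hM₁ e
  have hwe := hM₂ e
  have hr2 : r ^ 2 / 2 ≤ r := by nlinarith
  have hFM : |F e| ≤ r * M := by
    calc |F e| ≤ |r * D e| + |r ^ 2 / 2 * w e| := abs_add_le _ _
      _ = r * |D e| + r ^ 2 / 2 * |w e| := by
          rw [abs_mul, abs_mul, abs_of_nonneg hr0, abs_of_nonneg (by positivity : 0 ≤ r ^ 2 / 2)]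
      _ ≤ r * M₁ + r * M₂ := by gcongr
      _ = r * M := by rw [hM]; ring
  have h3 : |F e| ^ 3 * Real.exp |F e| ≤ M ^ 3 * Real.exp M * r ^ 3 := by
    calc |F e| ^ 3 * Real.exp |F e| ≤ (r * M) ^ 3 * Real.exp M := by
          gcongr
          exact hFM.trans (mul_le_of_le_one_left hM0 hr1)
      _ = _ := by ring
  have h4 : |r ^ 3 / 2 * (D e * w e) + r ^ 4 / 8 * w e ^ 2| ≤ M ^ 2 * r ^ 3 := by
    have h5 : |D e * w e| ≤ M ^ 2 := by
      rw [abs_mul, sq]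
      gcongr <;> linarith
    have h6 : |w e ^ 2| ≤ M ^ 2 := by
      rw [abs_pow]
      gcongr
      linarith
    have h7 : r ^ 4 ≤ r ^ 3 := pow_le_pow_of_le_one hr0 hr1 (by norm_num)
    have h8 : 0 ≤ M ^ 2 := sq_nonneg M
    calc _ ≤ |r ^ 3 / 2 * (D e * w e)| + |r ^ 4 / 8 * w e ^ 2| := abs_add_le _ _
      _ = r ^ 3 / 2 * |D e * w e| + r ^ 4 / 8 * |w e ^ 2| := by
          rw [abs_mul (r ^ 3 / 2), abs_mul (r ^ 4 / 8), abs_of_nonneg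
            (by positivity : 0 ≤ r ^ 3 / 2), abs_of_nonneg (by positivity : 0 ≤ r ^ 4 / 8)]
      _ ≤ r ^ 3 / 2 * M ^ 2 + r ^ 3 / 8 * M ^ 2 := by gcongr
      _ ≤ M ^ 2 * r ^ 3 := by nlinarith [pow_nonneg hr0 3, mul_nonneg (pow_nonneg hr0 3) h8]
  have h9 : Real.exp (F e) - (1 + r * D e + r ^ 2 / 2 * (D e ^ 2 + w e)) =
      (Real.exp (F e) - 1 - F e - F e ^ 2 / 2) +
        (r ^ 3 / 2 * (D e * w e) + r ^ 4 / 8 * w e ^ 2) := by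
    rw [hF]
    ring
  rw [h9]
  refine (abs_add_le _ _).trans ?_
  have h10 := abs_exp_sub_taylor_two_le (F e)
  have h11 : 0 ≤ r ^ 3 := pow_nonneg hr0 3
  nlinarith

section Walk

variable {V₀ E₀ : Type*} [Fintype E₀] {X₀ : OrientedGraph V₀ E₀}

namespace TransitionProbability

variable (P : TransitionProbability X₀)

open Classical in
/-- The expectation for one step of the walk from the vertex `y`. -/
def step (y : V₀) : Expectation E₀ where
  toLinearMap :=
    { toFun := fun f => ∑ e with X₀.o e = y, P.p e * f e
      map_add' := fun f g => by simp only [Pi.add_apply, mul_add, Finset.sum_add_distrib]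
      map_smul' := fun c f => by
        simp only [Pi.smul_apply, smul_eq_mul, RingHom.id_apply, Finset.mul_sum]
        exact Finset.sum_congr rfl fun e _ => by ring }
  nonneg f hf := Finset.sum_nonneg fun e _ => mul_nonneg (P.pos e).le (hf e)
  one := by
    simp only [LinearMap.coe_mk, AddHom.coe_mk, Pi.one_apply, mul_one]
    exact P.sum_eq_one y

open Classical in
theorem step_apply (y : V₀) (f : E₀ → ℝ) : P.step y f = ∑ e with X₀.o e = y, P.p e * f e := rfl

theorem step_mono {y : V₀} {f g : E₀ → ℝ} (h : ∀ e, X₀.o e = y → f e ≤ g e) :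
    P.step y f ≤ P.step y g := by
  classical
  rw [step_apply, step_apply]
  exact Finset.sum_le_sum fun e he =>
    mul_le_mul_of_nonneg_left (h e (Finset.mem_filter.mp he).2) (P.pos e).le

theorem step_congr {y : V₀} {f g : E₀ → ℝ} (h : ∀ e, X₀.o e = y → f e = g e) :
    P.step y f = P.step y g :=
  le_antisymm (P.step_mono fun e he => (h e he).le) (P.step_mono fun e he => (h e he).ge)

/-- The expectation for the list of the first `n` edges of the walk from the vertex `y`. -/
def walk : ℕ → V₀ → Expectation (List E₀)
  | 0, _ =>
    { toLinearMap := LinearMap.proj []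
      nonneg := fun f hf => hf _
      one := rfl }
  | n + 1, y =>
    { toLinearMap :=
        { toFun := fun f => P.step y fun e => walk n (X₀.t e) fun l => f (e :: l)
          map_add' := fun f g => by
            rw [← map_add]
            congr 1
            ext e
            exact (walk n (X₀.t e)).toLinearMap.map_add _ _
          map_smul' := fun c f => by
            rw [RingHom.id_apply, ← map_smul]
            congr 1
            ext e
            exact (walk n (X₀.t e)).toLinearMap.map_smul _ _ }
      nonneg := fun f hf => (P.step y).nonneg _ fun e =>
        (walk n (X₀.t e)).nonneg _ fun l => hf (e :: l)
      one := by
        have : (fun e => walk n (X₀.t e) fun l => (1 : List E₀ → ℝ) (e :: l)) = 1 := by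
          ext e
          exact (walk n (X₀.t e)).one
        simp only [LinearMap.coe_mk, AddHom.coe_mk, this]
        exact (P.step y).one }

theorem walk_zero (y : V₀) (f : List E₀ → ℝ) : P.walk 0 y f = f [] := rfl

theorem walk_succ (n : ℕ) (y : V₀) (f : List E₀ → ℝ) :
    P.walk (n + 1) y f = P.step y fun e => P.walk n (X₀.t e) fun l => f (e :: l) := rfl

theorem walk_mono {n : ℕ} {y : V₀} {f g : List E₀ → ℝ} (h : ∀ l, l.length = n → f l ≤ g l) :
    P.walk n y f ≤ P.walk n y g := by
  induction n generalizing y f g with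
  | zero => exact h [] rfl
  | succ n ih =>
    exact (P.step y).mono fun e => ih fun l hl => h _ (by rw [List.length_cons, hl])

theorem walk_congr {n : ℕ} {y : V₀} {f g : List E₀ → ℝ} (h : ∀ l, l.length = n → f l = g l) :
    P.walk n y f = P.walk n y g :=
  le_antisymm (P.walk_mono fun l hl => (h l hl).le) (P.walk_mono fun l hl => (h l hl).ge)

variable (X₀) in
/-- The terminus of a path that starts from `y`. -/
def endpoint : V₀ → List E₀ → V₀
  | y, [] => y
  | _, e :: l => endpoint (X₀.t e) l

/-- The Markov property. -/
theorem walk_add (m k : ℕ) (y : V₀) (f : List E₀ → ℝ) : P.walk (m + k) y f =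
    P.walk m y fun l => P.walk k (endpoint X₀ y l) fun l' => f (l ++ l') := by
  induction m generalizing y f with
  | zero => rw [zero_add]; rfl
  | succ m ih =>
    rw [Nat.add_right_comm, walk_succ, walk_succ]
    congr 1
    ext e
    rw [ih]
    rfl

/-- A bound for the walk of length `m`, uniform in the starting vertex, holds for each segment of
`m` steps of a longer walk. -/
theorem walk_segment_le {m : ℕ} {f : List E₀ → ℝ} {c : ℝ} (h : ∀ z, P.walk m z f ≤ c) (k r : ℕ)
    (y : V₀) : P.walk (k + m + r) y (fun l => f ((l.drop k).take m)) ≤ c := by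
  rw [Nat.add_assoc, walk_add, ← (P.walk k y).const c]
  refine P.walk_mono fun l hl => ?_
  rw [walk_add]
  refine le_trans (le_of_eq ?_) (h (endpoint X₀ y l))
  refine P.walk_congr fun l' hl' => ?_
  rw [← (P.walk r _).const (f l')]
  refine P.walk_congr fun l'' _ => ?_
  rw [List.drop_left' hl, List.take_left' hl']

/-- The additive functional `∑ g(eᵢ)` of the walk is centred with asymptotic variance `σ2` per step:
the two Poisson equations for the martingale approximation of `g` and for its conditional variance
have solutions. -/
def HasAsymptoticVariance (g : E₀ → ℝ) (σ2 : ℝ) : Prop :=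
  ∃ u v : V₀ → ℝ, (∀ y, P.step y (fun e => g e + (u (X₀.t e) - u (X₀.o e))) = 0) ∧
    ∀ y, P.step y (fun e => (g e + (u (X₀.t e) - u (X₀.o e))) ^ 2 +
      (v (X₀.t e) - v (X₀.o e))) = σ2

variable [Finite V₀]

/-- The exponential moments of the additive functional `∑ g(eᵢ)` of a finite Markov chain.
The corrector `u` turns `g` into the martingale difference `D = g + du`, and the corrector `v` makes
the conditional variance of `D` constant. Then one step of `D` has exponential moment
`exp (λ² σ² / 2 + O(λ³))` from every vertex, and the telescoping terms are `O(λ)`. -/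
theorem HasAsymptoticVariance.exists_exp_moment_bounds {g : E₀ → ℝ} {σ2 : ℝ}
    (h : P.HasAsymptoticVariance g σ2) :
    ∃ C > 0, ∃ r₀ > 0, ∀ r : ℝ, 0 ≤ r → r ≤ r₀ → ∀ (m : ℕ) (y : V₀),
      Real.exp (m * (r ^ 2 * σ2 / 2) - C * (r + m * r ^ 3)) ≤
        P.walk m y (fun l => Real.exp (r * (l.map g).sum)) ∧
      P.walk m y (fun l => Real.exp (r * (l.map g).sum)) ≤
        Real.exp (m * (r ^ 2 * σ2 / 2) + C * (r + m * r ^ 3)) := by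
  obtain ⟨u, v, hu, hv⟩ := h
  obtain ⟨K₁, hK₁0, hK₁⟩ := exists_forall_abs_le u
  obtain ⟨K₂, hK₂0, hK₂⟩ := exists_forall_abs_le v
  set D : E₀ → ℝ := fun e => g e + (u (X₀.t e) - u (X₀.o e)) with hD
  set w : E₀ → ℝ := fun e => v (X₀.t e) - v (X₀.o e) - σ2 with hw
  obtain ⟨M₁, hM₁0, hM₁⟩ := exists_forall_abs_le D
  obtain ⟨M₂, hM₂0, hM₂⟩ := exists_forall_abs_le w
  set M := M₁ + M₂ with hM
  have hM0 : 0 ≤ M := by positivity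
  set C₁ := M ^ 3 * Real.exp M + M ^ 2 + 1 with hC₁
  have hC₁0 : 0 < C₁ := by positivity
  refine ⟨2 * (K₁ + K₂) + 2 * C₁, by positivity, min 1 (1 / (2 * C₁)), by positivity,
    fun r hr0 hr m y => ?_⟩
  have hr1 : r ≤ 1 := hr.trans (min_le_left _ _)
  have hr3 : r ^ 3 ≤ r := by
    calc r ^ 3 ≤ r ^ 1 := pow_le_pow_of_le_one hr0 hr1 (by norm_num)
      _ = r := pow_one r
  have hrC : C₁ * r ^ 3 ≤ 1 / 2 := by
    have h1 : C₁ * r ^ 3 ≤ C₁ * (1 / (2 * C₁)) :=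
      mul_le_mul_of_nonneg_left (hr3.trans (hr.trans (min_le_right _ _))) hC₁0.le
    rwa [show C₁ * (1 / (2 * C₁)) = 1 / 2 by field_simp] at h1
  -- one step of the compensated exponent has an exponential moment of `1 + O(r³)`
  set F : E₀ → ℝ := fun e => r * D e + r ^ 2 / 2 * w e with hF
  have hstep : ∀ y, |P.step y (fun e => Real.exp (F e)) - 1| ≤ C₁ * r ^ 3 := fun y => by
    refine (P.step y).abs_exp_sub_one_le hM₁0 hM₂0 hM₁ hM₂ (hu y) ?_ hr0 hr1
    have h2 : (fun e => D e ^ 2 + w e) =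
        (fun e => D e ^ 2 + (v (X₀.t e) - v (X₀.o e))) - fun _ => σ2 := by
      ext e
      simp only [hw, Pi.sub_apply]
      ring
    rw [h2, map_sub, hv, Expectation.const, sub_self]
  have hup : ∀ y, P.step y (fun e => Real.exp (F e)) ≤ Real.exp (2 * (C₁ * r ^ 3)) := fun y => by
    have h1 := (abs_le.mp (hstep y)).2
    have h2 := Real.add_one_le_exp (2 * (C₁ * r ^ 3))
    have h3 : 0 ≤ C₁ * r ^ 3 := by positivity
    linarith
  have hlow : ∀ y, Real.exp (-(2 * (C₁ * r ^ 3))) ≤ P.step y (fun e => Real.exp (F e)) := by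
    intro y
    have h1 := (abs_le.mp (hstep y)).1
    have h2 := exp_neg_two_mul_le (x := C₁ * r ^ 3) (by positivity) hrC
    linarith
  -- the potential whose increments are the difference of `F` and `r g - r² σ² / 2`
  set φ : V₀ → ℝ := fun y => r * u y + r ^ 2 / 2 * v y with hφ
  have hφb : ∀ y, |φ y| ≤ r * (K₁ + K₂) := fun y => by
    have hr2 : r ^ 2 / 2 ≤ r := by nlinarith
    calc |φ y| ≤ |r * u y| + |r ^ 2 / 2 * v y| := abs_add_le _ _
      _ = r * |u y| + r ^ 2 / 2 * |v y| := by
          rw [abs_mul, abs_mul, abs_of_nonneg hr0, abs_of_nonneg (by positivity : 0 ≤ r ^ 2 / 2)]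
      _ ≤ r * K₁ + r * K₂ := by
          gcongr
          · exact hK₁ y
          · exact hK₂ y
      _ = _ := by ring
  have hgF : ∀ e, r * g e + φ (X₀.t e) = F e + r ^ 2 * σ2 / 2 + φ (X₀.o e) := fun e => by
    simp only [hF, hφ, hD, hw]
    ring
  have hrec : ∀ (m : ℕ) (y : V₀), P.walk (m + 1) y (fun l => Real.exp (r * (l.map g).sum)) =
      P.step y fun e => Real.exp (r * g e) *
        P.walk m (X₀.t e) (fun l => Real.exp (r * (l.map g).sum)) := by
    intro m y
    rw [walk_succ]
    congr 1
    ext e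
    rw [← Expectation.const_mul]
    congr 1
    ext l
    rw [List.map_cons, List.sum_cons, mul_add, Real.exp_add]
  have key : ∀ (m : ℕ) (y : V₀),
      Real.exp (m * (r ^ 2 * σ2 / 2 - 2 * (C₁ * r ^ 3)) + φ y - r * (K₁ + K₂)) ≤
        P.walk m y (fun l => Real.exp (r * (l.map g).sum)) ∧
      P.walk m y (fun l => Real.exp (r * (l.map g).sum)) ≤
        Real.exp (m * (r ^ 2 * σ2 / 2 + 2 * (C₁ * r ^ 3)) + φ y + r * (K₁ + K₂)) := by
    intro m
    induction m with
    | zero =>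
      intro y
      have := abs_le.mp (hφb y)
      simp only [walk_zero, List.map_nil, List.sum_nil, mul_zero, Nat.cast_zero, zero_mul, zero_add]
      constructor <;> refine Real.exp_le_exp.mpr ?_ <;> linarith
    | succ m ih =>
      intro y
      rw [hrec]
      constructor
      · calc Real.exp (↑(m + 1) * (r ^ 2 * σ2 / 2 - 2 * (C₁ * r ^ 3)) + φ y - r * (K₁ + K₂))
            = Real.exp (m * (r ^ 2 * σ2 / 2 - 2 * (C₁ * r ^ 3)) + r ^ 2 * σ2 / 2 + φ y -
                r * (K₁ + K₂)) * Real.exp (-(2 * (C₁ * r ^ 3))) := by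
              rw [← Real.exp_add]
              congr 1
              push_cast
              ring
          _ ≤ Real.exp (m * (r ^ 2 * σ2 / 2 - 2 * (C₁ * r ^ 3)) + r ^ 2 * σ2 / 2 + φ y -
                r * (K₁ + K₂)) * P.step y (fun e => Real.exp (F e)) := by gcongr; exact hlow y
          _ ≤ _ := by
              rw [← Expectation.const_mul]
              refine P.step_mono fun e he => ?_
              refine le_trans (le_of_eq ?_)
                (mul_le_mul_of_nonneg_left (ih (X₀.t e)).1 (Real.exp_pos _).le)
              rw [← Real.exp_add, ← Real.exp_add]
              congr 1
              have := hgF e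
              rw [he] at this
              linarith
      · calc _ ≤ Real.exp (m * (r ^ 2 * σ2 / 2 + 2 * (C₁ * r ^ 3)) + r ^ 2 * σ2 / 2 + φ y +
                r * (K₁ + K₂)) * P.step y (fun e => Real.exp (F e)) := by
              rw [← Expectation.const_mul]
              refine P.step_mono fun e he => ?_
              refine (mul_le_mul_of_nonneg_left (ih (X₀.t e)).2 (Real.exp_pos _).le).trans
                (le_of_eq ?_)
              rw [← Real.exp_add, ← Real.exp_add]
              congr 1
              have := hgF e
              rw [he] at this
              linarith
          _ ≤ Real.exp (m * (r ^ 2 * σ2 / 2 + 2 * (C₁ * r ^ 3)) + r ^ 2 * σ2 / 2 + φ y +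
                r * (K₁ + K₂)) * Real.exp (2 * (C₁ * r ^ 3)) := by gcongr; exact hup y
          _ = _ := by
              rw [← Real.exp_add]
              congr 1
              push_cast
              ring
  have hφy := abs_le.mp (hφb y)
  have hmr : 0 ≤ m * r ^ 3 := by positivity
  have hC₁r : 0 ≤ C₁ * r := by positivity
  have hKm : 0 ≤ (K₁ + K₂) * (m * r ^ 3) := by positivity
  refine ⟨le_trans (Real.exp_le_exp.mpr ?_) (key m y).1,
    (key m y).2.trans (Real.exp_le_exp.mpr ?_)⟩ <;> nlinarith

/-- The maximal inequality for the additive functional `∑ g(eᵢ)`. The exponential of its martingale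
approximation `∑ (g + du)(eᵢ)` grows at most by the factor `exp (C r²)` in a step. Instead of
stopping at the first passage of the level `c`, the bound is proved by induction on the number of
steps, for an arbitrary initial value `q` of the functional. -/
theorem HasAsymptoticVariance.exists_maximal_bound {g : E₀ → ℝ} {σ2 : ℝ}
    (h : P.HasAsymptoticVariance g σ2) :
    ∃ C > 0, ∀ r : ℝ, 0 ≤ r → r ≤ 1 → ∀ (m : ℕ) (y : V₀) (c : ℝ),
      (P.walk m y).prob {l | ∃ k, c ≤ r * ((l.take k).map g).sum} ≤
        Real.exp (-c + C * (r + m * r ^ 2)) := by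
  obtain ⟨u, -, hu, -⟩ := h
  obtain ⟨K, hK0, hK⟩ := exists_forall_abs_le u
  obtain ⟨M, hM0, hM⟩ := exists_forall_abs_le fun e => g e + (u (X₀.t e) - u (X₀.o e))
  set C := 2 * K + M ^ 2 * Real.exp M + 1 with hC
  have hCK : 2 * K ≤ C := by
    have : 0 ≤ M ^ 2 * Real.exp M := by positivity
    linarith
  have hCM : M ^ 2 * Real.exp M ≤ C := by linarith
  refine ⟨C, by positivity, fun r hr0 hr1 m y c => ?_⟩
  have hstep : ∀ y, P.step y (fun e => Real.exp (r * (g e + (u (X₀.t e) - u (X₀.o e))))) ≤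
      Real.exp (C * r ^ 2) := by
    intro y
    have h1 : ∀ e, Real.exp (r * (g e + (u (X₀.t e) - u (X₀.o e)))) ≤
        r * (g e + (u (X₀.t e) - u (X₀.o e))) + (1 + C * r ^ 2) := by
      intro e
      set D := g e + (u (X₀.t e) - u (X₀.o e)) with hD
      have hDM : |r * D| ≤ r * M := by
        rw [abs_mul, abs_of_nonneg hr0]
        exact mul_le_mul_of_nonneg_left (hM e) hr0
      have h2 := (abs_le.mp (abs_exp_sub_taylor_one_le (r * D))).2
      have h3 : (r * D) ^ 2 * Real.exp |r * D| ≤ (r * M) ^ 2 * Real.exp M := by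
        gcongr ?_ * Real.exp ?_
        · rw [← sq_abs]
          gcongr
        · exact hDM.trans (mul_le_of_le_one_left hM0 hr1)
      have h4 : (r * M) ^ 2 * Real.exp M ≤ C * r ^ 2 := by
        rw [mul_pow, mul_assoc, mul_comm]
        gcongr
      linarith
    refine ((P.step y).mono h1).trans ?_
    have h5 : P.step y (fun e => r * (g e + (u (X₀.t e) - u (X₀.o e))) + (1 + C * r ^ 2)) =
        1 + C * r ^ 2 := by
      rw [show (fun e => r * (g e + (u (X₀.t e) - u (X₀.o e))) + (1 + C * r ^ 2)) =
        (fun e => r * (g e + (u (X₀.t e) - u (X₀.o e)))) + fun _ => (1 + C * r ^ 2) from rfl,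
        map_add, Expectation.const_mul, hu, Expectation.const]
      ring
    rw [h5, add_comm]
    exact Real.add_one_le_exp _
  have hφ : ∀ y, 0 ≤ r * u y + r * K := fun y => by
    rw [← mul_add]
    exact mul_nonneg hr0 (by linarith [(abs_le.mp (hK y)).1])
  have key : ∀ (m : ℕ) (y : V₀) (q : ℝ),
      (P.walk m y).prob {l | ∃ k, c ≤ q + r * ((l.take k).map g).sum} ≤
        Real.exp (q - c + r * u y + r * K + m * (C * r ^ 2)) := by
    intro m
    induction m with
    | zero =>
      intro y q
      rw [Expectation.prob, walk_zero]
      by_cases h : c ≤ q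
      · rw [Set.indicator_of_mem (Set.mem_ofPred_eq ▸ ⟨0, by simpa using h⟩)]
        refine Real.one_le_exp ?_
        have := hφ y
        simp only [Nat.cast_zero, zero_mul, add_zero]
        linarith
      · rw [Set.indicator_of_notMem (by simpa using h)]
        positivity
    | succ m ih =>
      intro y q
      by_cases h : c ≤ q
      · refine ((P.walk (m + 1) y).prob_le_one _).trans (Real.one_le_exp ?_)
        have := hφ y
        have : 0 ≤ ((m + 1 : ℕ) : ℝ) * (C * r ^ 2) := by positivity
        linarith
      · have hset : ∀ e : E₀, (fun l : List E₀ => {l : List E₀ |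
              ∃ k, c ≤ q + r * ((l.take k).map g).sum}.indicator (1 : List E₀ → ℝ) (e :: l)) =
            {l : List E₀ | ∃ k, c ≤ q + r * g e + r * ((l.take k).map g).sum}.indicator 1 := by
          intro e
          ext l
          refine Set.indicator_eq_indicator (f := (1 : List E₀ → ℝ)) (g := 1) ?_ rfl
          simp only [Set.mem_ofPred_eq]
          constructor
          · rintro ⟨k, hk⟩
            cases k with
            | zero => exact absurd (by simpa using hk) h
            | succ k =>
              refine ⟨k, ?_⟩
              simp only [List.take_succ_cons, List.map_cons, List.sum_cons] at hk
              linarith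
          · rintro ⟨k, hk⟩
            refine ⟨k + 1, ?_⟩
            simp only [List.take_succ_cons, List.map_cons, List.sum_cons]
            linarith
        rw [Expectation.prob, walk_succ]
        simp only [hset]
        calc _ ≤ P.step y fun e => Real.exp (q - c + r * u y + r * K + m * (C * r ^ 2)) *
                Real.exp (r * (g e + (u (X₀.t e) - u (X₀.o e)))) := by
              refine P.step_mono fun e he => (ih (X₀.t e) (q + r * g e)).trans (le_of_eq ?_)
              rw [← Real.exp_add, he]
              congr 1
              ring
          _ ≤ Real.exp (q - c + r * u y + r * K + m * (C * r ^ 2)) * Real.exp (C * r ^ 2) := by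
              rw [Expectation.const_mul]
              gcongr
              exact hstep y
          _ = _ := by
              rw [← Real.exp_add]
              congr 1
              push_cast
              ring
  have h := key m y 0
  simp only [zero_add] at h
  refine h.trans (Real.exp_le_exp.mpr ?_)
  have h6 : r * u y ≤ r * K := mul_le_mul_of_nonneg_left ((le_abs_self _).trans (hK y)) hr0
  have h7 : r * (2 * K) ≤ r * C := mul_le_mul_of_nonneg_left hCK hr0
  linarith

end TransitionProbability

end Walk

/-! ### Moderate deviations of additive functionals of the walk -/

/-- The sum of `ξ` over the entries of `l` at the positions `i ≤ k < j`. -/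
def segmentSum {α M : Type*} [AddCommMonoid M] (ξ : α → M) (i j : ℕ) (l : List α) : M :=
  (((l.drop i).take (j - i)).map ξ).sum

theorem map_segmentSum {α M M' : Type*} [AddCommMonoid M] [AddCommMonoid M'] (f : M →+ M')
    (ξ : α → M) (i j : ℕ) (l : List α) :
    f (segmentSum ξ i j l) = segmentSum (fun e => f (ξ e)) i j l := by
  rw [segmentSum, map_list_sum, List.map_map]
  rfl

theorem segmentSum_append_left {α M : Type*} [AddCommMonoid M] (ξ : α → M) {i j : ℕ}
    {l : List α} (hij : i ≤ j) (hj : j ≤ l.length) (l' : List α) :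
    segmentSum ξ i j (l ++ l') = segmentSum ξ i j l := by
  rw [segmentSum, List.drop_append_of_le_length (hij.trans hj), List.take_append_of_le_length]
  · rfl
  · rw [List.length_drop]
    omega

theorem segmentSum_append_right {α M : Type*} [AddCommMonoid M] (ξ : α → M) {i j : ℕ}
    {l l' : List α} (hi : l.length = i) (hj : l'.length = j - i) :
    segmentSum ξ i j (l ++ l') = (l'.map ξ).sum := by
  rw [segmentSum, List.drop_left' hi, ← hj, List.take_length]

theorem segmentSum_zero_left {α M : Type*} [AddCommMonoid M] (ξ : α → M) (j : ℕ) (l : List α) :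
    segmentSum ξ 0 j l = ((l.take j).map ξ).sum := rfl

theorem segmentSum_add {α M : Type*} [AddCommMonoid M] (ξ : α → M) {i j k : ℕ} (hij : i ≤ j)
    (hjk : j ≤ k) (l : List α) :
    segmentSum ξ i j l + segmentSum ξ j k l = segmentSum ξ i k l := by
  have h1 : (l.drop i).take (k - i) = (l.drop i).take (j - i) ++ (l.drop j).take (k - j) := by
    rw [show k - i = (j - i) + (k - j) by omega, List.take_add, List.drop_drop,
      show i + (j - i) = j by omega]
  rw [segmentSum, segmentSum, segmentSum, h1, List.map_append, List.sum_append]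

theorem sum_getD_eq_segmentSum {α M : Type*} [AddCommMonoid M] (ξ : α → M) (j : ℕ) (l : List α) :
    ∑ k ∈ Finset.range j, (l.map ξ).getD k 0 = segmentSum ξ 0 j l := by
  rw [segmentSum_zero_left]
  induction j generalizing l with
  | zero => simp
  | succ j ih =>
    cases l with
    | nil => simp
    | cons e l =>
      rw [Finset.sum_range_succ', add_comm]
      simp only [List.map_cons, List.getD_cons_zero, List.getD_cons_succ, List.take_succ_cons,
        List.sum_cons]
      rw [ih]

theorem norm_getD_le {α F : Type*} [NormedAddCommGroup F] {ξ : α → F} {K : ℝ} (hK0 : 0 ≤ K)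
    (hK : ∀ e, ‖ξ e‖ ≤ K) (l : List α) (k : ℕ) : ‖(l.map ξ).getD k 0‖ ≤ K := by
  rw [List.getD_eq_getElem?_getD, List.getElem?_map]
  cases l[k]? <;> simp [hK0, hK]

section ListPath

variable {E₀ : Type*} {d : ℕ}

/-- The interpolated path of the partial sums of `ξ` along a list of edges, scaled by `a n`. -/
def listPath (ξ : E₀ → EuclideanSpace ℝ (Fin d)) (a : ℕ → ℝ) (n : ℕ) (l : List E₀) : AC0 d :=
  interpolatedPath n fun k => (a n)⁻¹ • (l.map ξ).getD k 0

variable {ξ : E₀ → EuclideanSpace ℝ (Fin d)} {a : ℕ → ℝ}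

/-- Between two times the scaled path moves by a segment sum, up to the two interpolated steps. -/
theorem norm_listPath_sub_le {K : ℝ} (hK0 : 0 ≤ K) (hK : ∀ e, ‖ξ e‖ ≤ K) (n : ℕ) (hn : 0 < a n)
    (l : List E₀) {s t : ℝ} (hs : s ∈ Set.Icc (0 : ℝ) 1) (ht : t ∈ Set.Icc (0 : ℝ) 1)
    (hst : s ≤ t) :
    ‖((listPath ξ a n l).ext t - (listPath ξ a n l).ext s) -
      (a n)⁻¹ • segmentSum ξ ⌊n * s⌋₊ ⌊n * t⌋₊ l‖ ≤ 2 * K * (a n)⁻¹ := by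
  have h1 : ∀ t ∈ Set.Icc (0 : ℝ) 1, ‖(listPath ξ a n l).ext t -
      (a n)⁻¹ • segmentSum ξ 0 ⌊n * t⌋₊ l‖ ≤ K * (a n)⁻¹ := by
    intro t ht
    rw [listPath, interpolatedPath_ext _ _ ht, interpolate, ← Finset.smul_sum,
      sum_getD_eq_segmentSum, add_sub_cancel_left, norm_smul, norm_smul, Real.norm_eq_abs,
      Real.norm_eq_abs, abs_of_pos (inv_pos.mpr hn), mul_comm K]
    have h2 : 0 ≤ n * t := mul_nonneg n.cast_nonneg ht.1
    have h3 : |n * t - ⌊n * t⌋₊| ≤ 1 := by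
      rw [abs_of_nonneg (sub_nonneg.mpr (Nat.floor_le h2))]
      linarith [Nat.lt_floor_add_one (n * t)]
    calc _ ≤ 1 * ((a n)⁻¹ * K) := by
          gcongr
          exact norm_getD_le hK0 hK l _
      _ = _ := one_mul _
  have h2 : ⌊n * s⌋₊ ≤ ⌊n * t⌋₊ := Nat.floor_mono (by gcongr)
  rw [show ((listPath ξ a n l).ext t - (listPath ξ a n l).ext s) -
      (a n)⁻¹ • segmentSum ξ ⌊n * s⌋₊ ⌊n * t⌋₊ l =
      ((listPath ξ a n l).ext t - (a n)⁻¹ • segmentSum ξ 0 ⌊n * t⌋₊ l) -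
      ((listPath ξ a n l).ext s - (a n)⁻¹ • segmentSum ξ 0 ⌊n * s⌋₊ l) by
    rw [← segmentSum_add ξ (Nat.zero_le _) h2, smul_add]
    abel]
  refine (norm_sub_le _ _).trans ?_
  linarith [h1 t ht, h1 s hs]

end ListPath

section Walk

variable {V₀ E₀ : Type*} [Fintype E₀] {X₀ : OrientedGraph V₀ E₀} (P : TransitionProbability X₀)

/-- Bounds for the exponential moments over blocks, uniform in the starting vertex, multiply. -/
theorem TransitionProbability.walk_blocks_bounds {g : ℕ → E₀ → ℝ} {lo up : ℕ → ℝ} {k : ℕ → ℕ}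
    (hk : Monotone k) (hk0 : k 0 = 0) {r : ℝ} {N : ℕ}
    (hb : ∀ j < N, ∀ z, Real.exp (lo j) ≤
        P.walk (k (j + 1) - k j) z (fun l => Real.exp (r * (l.map (g j)).sum)) ∧
      P.walk (k (j + 1) - k j) z (fun l => Real.exp (r * (l.map (g j)).sum)) ≤ Real.exp (up j))
    (y : V₀) :
    Real.exp (∑ j ∈ Finset.range N, lo j) ≤ P.walk (k N) y (fun l => Real.exp
        (r * ∑ j ∈ Finset.range N, segmentSum (g j) (k j) (k (j + 1)) l)) ∧
      P.walk (k N) y (fun l => Real.exp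
        (r * ∑ j ∈ Finset.range N, segmentSum (g j) (k j) (k (j + 1)) l)) ≤
      Real.exp (∑ j ∈ Finset.range N, up j) := by
  induction N with
  | zero => simp [hk0, walk_zero]
  | succ N ih =>
    have hrec : P.walk (k (N + 1)) y (fun l => Real.exp
        (r * ∑ j ∈ Finset.range (N + 1), segmentSum (g j) (k j) (k (j + 1)) l)) =
        P.walk (k N) y (fun l =>
          Real.exp (r * ∑ j ∈ Finset.range N, segmentSum (g j) (k j) (k (j + 1)) l) *
          P.walk (k (N + 1) - k N) (endpoint X₀ y l)
            (fun l' => Real.exp (r * (l'.map (g N)).sum))) := by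
      have hkN : k N + (k (N + 1) - k N) = k (N + 1) :=
        Nat.add_sub_of_le (hk (Nat.le_add_right N 1))
      nth_rewrite 1 [← hkN]
      rw [walk_add]
      refine P.walk_congr fun l hl => ?_
      rw [← Expectation.const_mul]
      refine P.walk_congr fun l' hl' => ?_
      have hsum : ∑ j ∈ Finset.range N, segmentSum (g j) (k j) (k (j + 1)) (l ++ l') =
          ∑ j ∈ Finset.range N, segmentSum (g j) (k j) (k (j + 1)) l :=
        Finset.sum_congr rfl fun j hj => segmentSum_append_left _ (hk (Nat.le_add_right j 1))
          (hl ▸ hk (Nat.succ_le_of_lt (Finset.mem_range.mp hj))) _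
      rw [← Real.exp_add, ← mul_add, Finset.sum_range_succ, segmentSum_append_right _ hl hl', hsum]
    obtain ⟨ih1, ih2⟩ := ih fun j hj => hb j (hj.trans (Nat.lt_succ_self N))
    rw [hrec, Finset.sum_range_succ, Finset.sum_range_succ, Real.exp_add, Real.exp_add]
    constructor
    · refine (mul_le_mul_of_nonneg_right ih1 (Real.exp_pos _).le).trans ?_
      rw [mul_comm, ← Expectation.const_mul]
      refine P.walk_mono fun l _ => ?_
      rw [mul_comm]
      exact mul_le_mul_of_nonneg_left (hb N (Nat.lt_succ_self N) _).1 (Real.exp_pos _).le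
    · refine le_trans ?_ (mul_le_mul_of_nonneg_right ih2 (Real.exp_pos _).le)
      rw [mul_comm _ (Real.exp (up N)), ← Expectation.const_mul]
      refine P.walk_mono fun l _ => ?_
      rw [mul_comm (Real.exp (up N))]
      exact mul_le_mul_of_nonneg_left (hb N (Nat.lt_succ_self N) _).2 (Real.exp_pos _).le

variable {d : ℕ} {ξ : E₀ → EuclideanSpace ℝ (Fin d)} {a : ℕ → ℝ}

theorem tendsto_speed (ha_sqrt : Tendsto (fun n : ℕ => a n / √n) atTop atTop) :
    Tendsto (fun n : ℕ => a n ^ 2 / n) atTop atTop := by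
  have h := ha_sqrt.atTop_mul_atTop₀ ha_sqrt
  refine h.congr fun n => ?_
  rw [div_mul_div_comm, Real.mul_self_sqrt n.cast_nonneg, sq]

theorem tendsto_scale (ha_sqrt : Tendsto (fun n : ℕ => a n / √n) atTop atTop) :
    Tendsto a atTop atTop := by
  have h := ha_sqrt.atTop_mul_atTop₀
    (Real.tendsto_sqrt_atTop.comp tendsto_natCast_atTop_atTop)
  refine h.congr' ?_
  filter_upwards [eventually_gt_atTop 0] with n hn
  have : (0 : ℝ) < n := by exact_mod_cast hn
  rw [Function.comp_apply, div_mul_cancel₀ _ (Real.sqrt_pos.mpr this).ne']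

/-- The end of the `j`-th block of the grid `ℤ / N`, in steps of the walk. -/
def blockEnd (N n j : ℕ) : ℕ := ⌊(n : ℝ) * (j / N : ℝ)⌋₊

theorem blockEnd_mono (N n : ℕ) : Monotone (blockEnd N n) := fun i j hij => by
  have : (i : ℝ) ≤ j := by exact_mod_cast hij
  exact Nat.floor_mono (by gcongr)

theorem blockEnd_zero (N n : ℕ) : blockEnd N n 0 = 0 := by simp [blockEnd]

theorem blockEnd_self {N : ℕ} (hN : 0 < N) (n : ℕ) : blockEnd N n N = n := by
  have : (N : ℝ) ≠ 0 := by exact_mod_cast hN.ne'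
  rw [blockEnd, div_self this, mul_one, Nat.floor_natCast]

theorem tendsto_block_length (N j : ℕ) :
    Tendsto (fun n : ℕ => ((blockEnd N n (j + 1) - blockEnd N n j : ℕ) : ℝ) / n) atTop
      (𝓝 (1 / N)) := by
  have h : ∀ j : ℕ, Tendsto (fun n : ℕ => (blockEnd N n j : ℝ) / n) atTop (𝓝 (j / N)) := by
    intro j
    have := (tendsto_nat_floor_mul_div_atTop (show (0 : ℝ) ≤ j / N by positivity)).comp
      (tendsto_natCast_atTop_atTop (R := ℝ))
    refine this.congr fun n => ?_
    simp only [Function.comp_apply, blockEnd]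
    rw [mul_comm]
  have h2 := (h (j + 1)).sub (h j)
  rw [← sub_div, Nat.cast_add, Nat.cast_one, add_sub_cancel_left] at h2
  refine h2.congr fun n => ?_
  rw [Nat.cast_sub (blockEnd_mono N n (Nat.le_succ j)), sub_div]

variable [Finite V₀] {B : EuclideanSpace ℝ (Fin d) →L[ℝ] EuclideanSpace ℝ (Fin d)}

theorem exists_forall_norm_le {α F : Type*} [Finite α] [NormedAddCommGroup F] (ξ : α → F) :
    ∃ K, 0 ≤ K ∧ ∀ a, ‖ξ a‖ ≤ K := by
  obtain ⟨K, hK0, hK⟩ := exists_forall_abs_le fun a => ‖ξ a‖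
  exact ⟨K, hK0, fun a => by simpa using hK a⟩

/-- A cell of the grid is a block of about `n / N` steps, and the exponential moment over a block
with parameter `r = a n / n` is `exp ((n / N) r² |ϑ|² / 2)` up to the factor `exp (O (r + n r³))`.
On the scale `a n ^ 2 / n = n r²` the errors are `O (1 / a n + a n / n)`. -/
theorem hasGaussianCgf_gridVector
    (hvar : ∀ θ, P.HasAsymptoticVariance (fun e => inner ℝ θ (B (ξ e))) (‖θ‖ ^ 2))
    (ha_pos : ∀ n, 0 < a n) (ha_sqrt : Tendsto (fun n : ℕ => a n / √n) atTop atTop)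
    (ha_lin : Tendsto (fun n : ℕ => a n / n) atTop (𝓝 0)) (y : V₀) {N : ℕ} (hN : 0 < N) :
    HasGaussianCgf (fun n => P.walk n y) (fun n => a n ^ 2 / n)
      (fun n l => gridVector B N (listPath ξ a n l)) := by
  intro θ
  have hN' : (0 : ℝ) < N := by exact_mod_cast hN
  obtain ⟨K, hK0, hK⟩ := exists_forall_norm_le ξ
  set ϑ : ℕ → EuclideanSpace ℝ (Fin d) := fun j => if h : j < N then √N • θ ⟨j, h⟩ else 0 with hϑ
  choose C hC0 r₀ hr₀ hCr using fun j => (hvar (ϑ j)).exists_exp_moment_bounds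
  set C' : ℝ := ∑ j ∈ Finset.range N, ‖ϑ j‖ * (‖B‖ * (2 * K)) with hC'
  -- the exponent, up to an error of the order of a single step, is a sum over blocks
  have hexp : ∀ n : ℕ, 0 < n → ∀ l : List E₀,
      |a n ^ 2 / n * inner ℝ θ (gridVector B N (listPath ξ a n l)) -
        a n / n * ∑ j ∈ Finset.range N, segmentSum (fun e => inner ℝ (ϑ j) (B (ξ e)))
          (blockEnd N n j) (blockEnd N n (j + 1)) l| ≤ a n / n * C' := by
    intro n hn l
    have hn' : (0 : ℝ) < n := by exact_mod_cast hn
    have ha := ha_pos n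
    have h1 : inner ℝ θ (gridVector B N (listPath ξ a n l)) =
        ∑ j ∈ Finset.range N, inner ℝ (ϑ j) (B (gridIncrement N (listPath ξ a n l) j)) := by
      rw [PiLp.inner_apply, Finset.sum_range]
      refine Finset.sum_congr rfl fun j _ => ?_
      rw [gridVector, PiLp.toLp_apply, hϑ]
      simp only [Fin.is_lt, dite_true, Fin.eta]
      rw [real_inner_smul_right, real_inner_smul_left]
    have h2 : a n / n * ∑ j ∈ Finset.range N, segmentSum (fun e => inner ℝ (ϑ j) (B (ξ e)))
          (blockEnd N n j) (blockEnd N n (j + 1)) l =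
        a n ^ 2 / n * ∑ j ∈ Finset.range N, inner ℝ (ϑ j)
          (B ((a n)⁻¹ • segmentSum ξ (blockEnd N n j) (blockEnd N n (j + 1)) l)) := by
      rw [Finset.mul_sum, Finset.mul_sum]
      refine Finset.sum_congr rfl fun j _ => ?_
      have h3 := map_segmentSum (((innerSL ℝ (ϑ j)).comp B).toLinearMap.toAddMonoidHom) ξ
        (blockEnd N n j) (blockEnd N n (j + 1)) l
      simp only [LinearMap.toAddMonoidHom_coe, ContinuousLinearMap.coe_coe,
        ContinuousLinearMap.comp_apply, innerSL_apply_apply] at h3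
      rw [← h3, map_smul, real_inner_smul_right]
      field_simp
    rw [h1, h2, ← mul_sub, ← Finset.sum_sub_distrib, abs_mul, abs_of_nonneg (by positivity),
      show a n / n * C' = a n ^ 2 / n * (C' * (a n)⁻¹) by field_simp]
    refine mul_le_mul_of_nonneg_left ?_ (by positivity)
    rw [hC', Finset.sum_mul]
    refine (Finset.abs_sum_le_sum_abs _ _).trans (Finset.sum_le_sum fun j hj => ?_)
    have hj' : (j : ℝ) + 1 ≤ N := by exact_mod_cast Finset.mem_range.mp hj
    have h4 := norm_listPath_sub_le hK0 hK n ha l (s := j / N) (t := (j + 1) / N)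
      ⟨by positivity, by rw [div_le_one hN']; linarith⟩
      ⟨by positivity, by rw [div_le_one hN']; exact hj'⟩ (by gcongr; linarith)
    rw [← inner_sub_right, ← map_sub]
    calc _ ≤ ‖ϑ j‖ * ‖B _‖ := abs_real_inner_le_norm _ _
      _ ≤ ‖ϑ j‖ * (‖B‖ * (2 * K * (a n)⁻¹)) := by
          gcongr
          refine (B.le_opNorm _).trans ?_
          gcongr
          refine le_trans (le_of_eq ?_) h4
          simp only [gridIncrement, blockEnd]
          push_cast
          rfl
      _ = _ := by ring
  clear_value C'
  set m : ℕ → ℕ → ℝ := fun n j => ((blockEnd N n (j + 1) - blockEnd N n j : ℕ) : ℝ) with hm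
  have hinv : Tendsto (fun n => (a n)⁻¹) atTop (𝓝 0) :=
    tendsto_inv_atTop_zero.comp (tendsto_scale ha_sqrt)
  have hlim : ∀ c : ℝ, Tendsto (fun n : ℕ => ∑ j ∈ Finset.range N, (m n j / n * (‖ϑ j‖ ^ 2 / 2) +
      c * (C j * ((a n)⁻¹ + m n j / n * (a n / n)))) + c * ((a n)⁻¹ * C')) atTop
      (𝓝 (‖θ‖ ^ 2 / 2)) := by
    intro c
    have hval : ‖θ‖ ^ 2 / 2 = ∑ j ∈ Finset.range N, (1 / N * (‖ϑ j‖ ^ 2 / 2) +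
        c * (C j * (0 + 1 / N * 0))) + c * (0 * C') := by
      rw [PiLp.norm_sq_eq_of_L2, Finset.sum_range, Finset.sum_div]
      simp only [mul_zero, add_zero, zero_mul]
      refine Finset.sum_congr rfl fun j _ => ?_
      rw [hϑ]
      simp only [Fin.is_lt, dite_true, Fin.eta]
      rw [norm_smul, mul_pow, Real.norm_eq_abs, sq_abs, Real.sq_sqrt hN'.le]
      field_simp
    rw [hval]
    refine Tendsto.add (tendsto_finsetSum _ fun j _ => ?_) ((hinv.mul_const _).const_mul _)
    have h5 := tendsto_block_length N j
    exact (h5.mul_const _).add (((hinv.add (h5.mul ha_lin)).const_mul _).const_mul _)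
  have hsmall : ∀ᶠ n : ℕ in atTop, ∀ j ∈ Finset.range N, a n / n ≤ r₀ j :=
    (Filter.eventually_all_finset _).mpr fun j _ => ha_lin.eventually_le_const (hr₀ j)
  have hbounds : ∀ᶠ n : ℕ in atTop,
      (∑ j ∈ Finset.range N, (m n j / n * (‖ϑ j‖ ^ 2 / 2) +
        (-1) * (C j * ((a n)⁻¹ + m n j / n * (a n / n)))) + (-1) * ((a n)⁻¹ * C')) ≤
      (a n ^ 2 / n)⁻¹ * Real.log (P.walk n y fun l =>
        Real.exp (a n ^ 2 / n * inner ℝ θ (gridVector B N (listPath ξ a n l)))) ∧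
      (a n ^ 2 / n)⁻¹ * Real.log (P.walk n y fun l =>
        Real.exp (a n ^ 2 / n * inner ℝ θ (gridVector B N (listPath ξ a n l)))) ≤
      (∑ j ∈ Finset.range N, (m n j / n * (‖ϑ j‖ ^ 2 / 2) +
        1 * (C j * ((a n)⁻¹ + m n j / n * (a n / n)))) + 1 * ((a n)⁻¹ * C')) := by
    filter_upwards [hsmall, eventually_gt_atTop 0] with n hsm hn
    have hn' : (0 : ℝ) < n := by exact_mod_cast hn
    have ha := ha_pos n
    have hb := P.walk_blocks_bounds (blockEnd_mono N n) (blockEnd_zero N n) (N := N)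
      (fun j hj z => hCr j (a n / n) (by positivity) (hsm j (Finset.mem_range.mpr hj))
        (blockEnd N n (j + 1) - blockEnd N n j) z) y
    rw [blockEnd_self hN] at hb
    have hs0 : 0 < a n ^ 2 / n := by positivity
    rw [le_inv_mul_iff₀ hs0, inv_mul_le_iff₀ hs0, Real.le_log_iff_exp_le ((P.walk n y).exp_pos _),
      Real.log_le_iff_le_exp ((P.walk n y).exp_pos _)]
    constructor
    · calc _ = Real.exp (-(a n / n * C')) * Real.exp (∑ j ∈ Finset.range N,
            (m n j * ((a n / n) ^ 2 * ‖ϑ j‖ ^ 2 / 2) -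
              C j * (a n / n + m n j * (a n / n) ^ 3))) := by
            rw [← Real.exp_add, add_comm (-(a n / n * C')), mul_add, Finset.mul_sum]
            refine congrArg Real.exp (congrArg₂ (· + ·) (Finset.sum_congr rfl fun j _ => ?_) ?_)
            · field_simp
              ring
            · field_simp
        _ ≤ _ := mul_le_mul_of_nonneg_left hb.1 (Real.exp_pos _).le
        _ ≤ _ := by
            rw [← Expectation.const_mul]
            refine (P.walk n y).mono fun l => ?_
            rw [← Real.exp_add]
            refine Real.exp_le_exp.mpr ?_
            linarith [(abs_le.mp (hexp n hn l)).1]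
    · calc _ ≤ Real.exp (a n / n * C') * P.walk n y (fun l => Real.exp (a n / n *
            ∑ j ∈ Finset.range N, segmentSum (fun e => inner ℝ (ϑ j) (B (ξ e)))
              (blockEnd N n j) (blockEnd N n (j + 1)) l)) := by
            rw [← Expectation.const_mul]
            refine (P.walk n y).mono fun l => ?_
            rw [← Real.exp_add]
            refine Real.exp_le_exp.mpr ?_
            linarith [(abs_le.mp (hexp n hn l)).2]
        _ ≤ _ := mul_le_mul_of_nonneg_left hb.2 (Real.exp_pos _).le
        _ = _ := by
            rw [← Real.exp_add, add_comm (a n / n * C'), mul_add, Finset.mul_sum]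
            refine congrArg Real.exp (congrArg₂ (· + ·) (Finset.sum_congr rfl fun j _ => ?_) ?_)
            · simp only [hm]
              field_simp
            · field_simp
  exact tendsto_of_tendsto_of_tendsto_of_le_of_le' (hlim (-1)) (hlim 1)
    (hbounds.mono fun n hn => hn.1) (hbounds.mono fun n hn => hn.2)

end Walk

/-- A vector with a large norm has a large coordinate, up to sign. -/
theorem exists_coordinate_ge {d : ℕ} {x : EuclideanSpace ℝ (Fin d)} {r : ℝ} (hr : 0 < r)
    (hx : r ≤ ‖x‖) : ∃ p : Fin d × Bool,
      r / (d + 1) ≤ inner ℝ (EuclideanSpace.single p.1 (if p.2 then (1 : ℝ) else -1)) x := by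
  by_contra! hc
  have h1 : ∀ i, x i ^ 2 ≤ (r / (d + 1)) ^ 2 := fun i => by
    have h2 := hc (i, true)
    have h3 := hc (i, false)
    simp only [EuclideanSpace.inner_single_left, if_true, Bool.false_eq_true, if_false, map_one,
      one_mul, map_neg, neg_mul] at h2 h3
    exact sq_le_sq' (by linarith) h2.le
  have h4 : ‖x‖ ^ 2 ≤ d * (r / (d + 1)) ^ 2 := by
    rw [EuclideanSpace.real_norm_sq_eq]
    refine (Finset.sum_le_sum fun i _ => h1 i).trans ?_
    simp
  have h5 : d * (r / (d + 1)) ^ 2 < r ^ 2 := by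
    rw [div_pow, ← mul_div_assoc, div_lt_iff₀ (by positivity), mul_comm]
    have : (d : ℝ) < (d + 1) ^ 2 := by nlinarith [d.cast_nonneg (α := ℝ)]
    gcongr
  have h6 : r ^ 2 ≤ ‖x‖ ^ 2 := by gcongr
  linarith

section Walk

variable {V₀ E₀ : Type*} [Fintype E₀] {X₀ : OrientedGraph V₀ E₀} (P : TransitionProbability X₀)
  {d : ℕ} {ξ : E₀ → EuclideanSpace ℝ (Fin d)} {a : ℕ → ℝ}
  [Finite V₀] {B : EuclideanSpace ℝ (Fin d) →L[ℝ] EuclideanSpace ℝ (Fin d)}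

/-- Within a block of about `n / N` steps the maximal inequality, with an exponential parameter
proportional to `a n / n`, bounds the oscillation at any exponential order as `N → ∞`. -/
theorem exponentiallySmallOscillation_listPath
    (hvar : ∀ θ, P.HasAsymptoticVariance (fun e => inner ℝ θ (B (ξ e))) (‖θ‖ ^ 2))
    {κ : ℝ} (hκ : 0 < κ) (hκB : ∀ x, ‖x‖ ≤ κ * ‖B x‖)
    (ha_pos : ∀ n, 0 < a n) (ha_sqrt : Tendsto (fun n : ℕ => a n / √n) atTop atTop)
    (ha_lin : Tendsto (fun n : ℕ => a n / n) atTop (𝓝 0)) (y : V₀) :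
    ExponentiallySmallOscillation (fun n => P.walk n y) (fun n => a n ^ 2 / n)
      (listPath ξ a) := by
  intro δ hδ L
  obtain ⟨K, hK0, hK⟩ := exists_forall_norm_le ξ
  set g : Fin d × Bool → E₀ → ℝ := fun p e =>
    inner ℝ (EuclideanSpace.single p.1 (if p.2 then (1 : ℝ) else -1)) (B (ξ e)) with hg
  choose C' hC'0 hC' using fun p : Fin d × Bool =>
    (hvar (EuclideanSpace.single p.1 (if p.2 then (1 : ℝ) else -1))).exists_maximal_bound
  set C := ∑ p, C' p + 1 with hC
  have hC0 : 0 < C := add_pos_of_nonneg_of_pos (Finset.sum_nonneg fun p _ => (hC'0 p).le) one_pos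
  have hCC : ∀ p, C' p ≤ C := fun p =>
    (Finset.single_le_sum (fun p _ => (hC'0 p).le) (Finset.mem_univ p)).trans (by linarith)
  set δ' := δ / 2 / κ / (d + 1) with hδ'
  have hδ'0 : 0 < δ' := by positivity
  -- the exponential parameter is `τ a n / n`; a passage of the level `δ' a n` then costs
  -- `(|L| + 3) a n ^ 2 / n`, and two units of this are left for the error terms
  set τ := (|L| + 3) / δ' with hτ
  have hτ0 : 0 < τ := by positivity
  have hτδ : τ * δ' = |L| + 3 := div_mul_cancel₀ _ hδ'0.ne'
  obtain ⟨N₀, hN₀⟩ := exists_nat_ge (C * τ ^ 2 * 2)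
  filter_upwards [eventually_ge_atTop N₀, eventually_gt_atTop 0] with N hN hN0
  have hN' : (0 : ℝ) < N := by exact_mod_cast hN0
  have hN₀N : (N₀ : ℝ) ≤ N := by exact_mod_cast hN
  have hCN : C * τ ^ 2 * (2 / N) ≤ 1 := by
    rw [← mul_div_assoc, div_le_one hN']
    linarith
  have hs := tendsto_speed ha_sqrt
  have hinv : Tendsto (fun n => 2 * K * (a n)⁻¹) atTop (𝓝 0) := by
    simpa using (tendsto_inv_atTop_zero.comp (tendsto_scale ha_sqrt)).const_mul (2 * K)
  have hlen : ∀ᶠ n : ℕ in atTop, ∀ j ∈ Finset.range N,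
      ((blockEnd N n (j + 1) - blockEnd N n j : ℕ) : ℝ) / n ≤ 2 / N :=
    (Filter.eventually_all_finset _).mpr fun j _ =>
      (tendsto_block_length N j).eventually_le_const (by gcongr; norm_num)
  have hr : Tendsto (fun n : ℕ => τ * (a n / n)) atTop (𝓝 0) := by
    simpa using ha_lin.const_mul τ
  filter_upwards [eventually_gt_atTop 0, hinv.eventually_le_const (half_pos hδ), hlen,
    hr.eventually_le_const one_pos, hr.eventually_le_const (inv_pos.mpr hC0),
    hs.eventually_ge_atTop 1, eventually_const_mul_exp_le hs
      (((Finset.range N) ×ˢ (Finset.univ : Finset (Fin d × Bool))).card : ℝ)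
      (show -(|L| + 1) < -L by linarith [le_abs_self L])]
    with n hn hKn hlen hr1 hrC hs1 hcount
  have hn' : (0 : ℝ) < n := by exact_mod_cast hn
  have ha := ha_pos n
  set r := τ * (a n / n) with hrdef
  have hr0 : 0 < r := by positivity
  set k := blockEnd N n with hk
  set S : ℕ × (Fin d × Bool) → Set (List E₀) := fun q =>
    {l | ∃ i, r * (a n * δ') ≤
      r * (((((l.drop (k q.1)).take (k (q.1 + 1) - k q.1)).take i).map (g q.2)).sum)} with hS
  have hsub : {l | ¬ SmallOscillation N δ (listPath ξ a n l)} ⊆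
      ⋃ q ∈ (Finset.range N) ×ˢ (Finset.univ : Finset (Fin d × Bool)), S q := by
    intro l hl
    simp only [SmallOscillation, Set.mem_ofPred_eq, not_forall, not_lt] at hl
    obtain ⟨j, hj, t, ht, hδt⟩ := hl
    have hj' : (j : ℝ) + 1 ≤ N := by exact_mod_cast hj
    have hjN : (j / N : ℝ) ∈ Set.Icc (0 : ℝ) 1 :=
      ⟨by positivity, by rw [div_le_one hN']; linarith⟩
    have ht01 : t ∈ Set.Icc (0 : ℝ) 1 :=
      ⟨hjN.1.trans ht.1, ht.2.trans (by rw [div_le_one hN']; exact hj')⟩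
    have h1 := norm_listPath_sub_le hK0 hK n ha l hjN ht01 ht.1
    have hkt : ⌊n * t⌋₊ ≤ k (j + 1) := Nat.floor_mono (by
      have := ht.2
      push_cast
      gcongr)
    set x := segmentSum ξ ⌊(n : ℝ) * (j / N)⌋₊ ⌊n * t⌋₊ l with hx
    have h2 : δ / 2 ≤ (a n)⁻¹ * ‖x‖ := by
      have h3 := norm_sub_norm_le ((listPath ξ a n l).ext t - (listPath ξ a n l).ext (j / N))
        ((a n)⁻¹ • x)
      rw [norm_smul, Real.norm_eq_abs, abs_of_pos (inv_pos.mpr ha)] at h3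
      linarith
    have h4 : a n * (δ / 2 / κ) ≤ ‖B x‖ := by
      rw [le_inv_mul_iff₀ ha] at h2
      rw [mul_div_assoc', div_le_iff₀ hκ, mul_comm _ κ]
      exact h2.trans (hκB x)
    obtain ⟨p, hp⟩ := exists_coordinate_ge (by positivity) h4
    refine Set.mem_iUnion₂.mpr ⟨(j, p), by simp [hj], ⌊n * t⌋₊ - k j, ?_⟩
    have h5 : ((((l.drop (k j)).take (k (j + 1) - k j)).take (⌊n * t⌋₊ - k j)).map (g p)).sum =
        inner ℝ (EuclideanSpace.single p.1 (if p.2 then (1 : ℝ) else -1)) (B x) := by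
      have h6 := map_segmentSum (((innerSL ℝ (EuclideanSpace.single p.1
        (if p.2 then (1 : ℝ) else -1))).comp B).toLinearMap.toAddMonoidHom) ξ
        ⌊(n : ℝ) * (j / N)⌋₊ ⌊n * t⌋₊ l
      simp only [LinearMap.toAddMonoidHom_coe, ContinuousLinearMap.coe_coe,
        ContinuousLinearMap.comp_apply, innerSL_apply_apply] at h6
      rw [hx, h6, List.take_take, min_eq_left (Nat.sub_le_sub_right hkt _)]
      rfl
    simp only
    rw [h5]
    refine mul_le_mul_of_nonneg_left (le_trans (le_of_eq ?_) hp) hr0.le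
    rw [hδ', mul_div_assoc]
  refine (((P.walk n y).prob_mono hsub).trans ((P.walk n y).prob_biUnion_le _ _)).trans ?_
  refine le_trans ?_ hcount
  rw [← nsmul_eq_mul]
  refine Finset.sum_le_card_nsmul _ _ _ fun q hq => ?_
  have hq1 : q.1 < N := by
    rw [Finset.mem_product, Finset.mem_range] at hq
    exact hq.1
  set m := k (q.1 + 1) - k q.1 with hm
  have hsplit : k q.1 + m + (n - k (q.1 + 1)) = n := by
    have h7 : k q.1 ≤ k (q.1 + 1) := blockEnd_mono N n (Nat.le_add_right _ 1)
    have h8 : k (q.1 + 1) ≤ k N := blockEnd_mono N n (Nat.succ_le_of_lt hq1)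
    rw [hk, blockEnd_self hN0, ← hk] at h8
    omega
  have hbound := P.walk_segment_le (f := {l | ∃ i, r * (a n * δ') ≤
      r * ((l.take i).map (g q.2)).sum}.indicator 1)
    (fun z => hC' q.2 r hr0.le hr1 m z (r * (a n * δ'))) (k q.1) (n - k (q.1 + 1)) y
  rw [hsplit] at hbound
  refine le_trans (le_of_eq ?_) (hbound.trans (Real.exp_le_exp.mpr ?_))
  · rfl
  · have h9 : r * (a n * δ') = a n ^ 2 / n * (|L| + 3) := by
      rw [← hτδ, hrdef]
      field_simp
    have h10 : C' q.2 * (r + m * r ^ 2) ≤ C * (r + m * r ^ 2) :=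
      mul_le_mul_of_nonneg_right (hCC _) (by positivity)
    have h11 : C * r ≤ 1 := by
      rw [← mul_inv_cancel₀ hC0.ne']
      exact mul_le_mul_of_nonneg_left hrC hC0.le
    have h12 : C * (m * r ^ 2) ≤ a n ^ 2 / n := by
      calc C * (m * r ^ 2) = C * τ ^ 2 * (m / n) * (a n ^ 2 / n) := by
            rw [hrdef]
            field_simp
        _ ≤ C * τ ^ 2 * (2 / N) * (a n ^ 2 / n) := by
            exact mul_le_mul_of_nonneg_right (mul_le_mul_of_nonneg_left
              (hlen q.1 (Finset.mem_range.mpr hq1)) (by positivity)) (by positivity)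
        _ ≤ 1 * (a n ^ 2 / n) := by gcongr
        _ = _ := one_mul _
    rw [h9]
    nlinarith

end Walk

/-! ### The Poisson equation on a finite connected graph -/

section Poisson

variable {V₀ E₀ : Type*} [Fintype E₀] {X₀ : OrientedGraph V₀ E₀}

theorem TransitionProbability.eq_zero_of_step_eq_zero (P : TransitionProbability X₀) {f : E₀ → ℝ}
    (hf : ∀ e, 0 ≤ f e) {y : V₀} (h : P.step y f = 0) {e : E₀} (he : X₀.o e = y) : f e = 0 := by
  classical
  rw [P.step_apply, Finset.sum_eq_zero_iff_of_nonneg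
    fun e _ => mul_nonneg (P.pos e).le (hf e)] at h
  exact (mul_eq_zero.mp (h e (Finset.mem_filter.mpr ⟨Finset.mem_univ e, he⟩))).resolve_left
    (P.pos e).ne'

/-- The maximum principle: harmonic functions on a connected finite graph are constant. -/
theorem TransitionProbability.eq_of_harmonic [Finite V₀] (P : TransitionProbability X₀)
    (hX₀ : X₀.Connected) {u : V₀ → ℝ}
    (hu : ∀ y, P.step y (fun e => u (X₀.t e) - u (X₀.o e)) = 0) (y z : V₀) : u y = u z := by
  have : Nonempty V₀ := ⟨y⟩
  obtain ⟨x, hx⟩ := Finite.exists_max u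
  have key : ∀ (l : List E₀) (v w : V₀), u v = u x → X₀.IsPath v l w → u w = u x := by
    intro l
    induction l with
    | nil =>
      intro v w hv hl
      obtain rfl : v = w := hl
      exact hv
    | cons e l ih =>
      intro v w hv hl
      obtain ⟨ho, hl⟩ := hl
      refine ih _ _ ?_ hl
      have h1 : P.step v (fun e => u x - u (X₀.t e)) = 0 := by
        rw [← neg_zero, ← hu v, ← map_neg]
        refine P.step_congr fun e he => ?_
        rw [Pi.neg_apply, he, hv]
        ring
      have h2 := P.eq_zero_of_step_eq_zero (fun e => sub_nonneg.mpr (hx (X₀.t e))) h1 ho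
      linarith
  obtain ⟨l, hl⟩ := hX₀ x y
  obtain ⟨l', hl'⟩ := hX₀ x z
  rw [key l x y rfl hl, key l' x z rfl hl']

namespace InvariantMeasure

variable [Fintype V₀] {P : TransitionProbability X₀} (μ : InvariantMeasure P)

theorem mTilde_pos (e : E₀) : 0 < μ.mTilde e := mul_pos (P.pos e) (μ.pos _)

theorem sum_m_mul_step (f : E₀ → ℝ) :
    ∑ y, μ.m y * P.step y f = ∑ e, μ.mTilde e * f e := by
  classical
  simp only [P.step_apply, Finset.mul_sum]
  rw [← Finset.sum_fiberwise Finset.univ X₀.o]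
  refine Finset.sum_congr rfl fun y _ => Finset.sum_congr (by congr) fun e he => ?_
  rw [mTilde, (Finset.mem_filter.mp he).2]
  ring

theorem sum_mTilde : ∑ e, μ.mTilde e = 1 := by
  have h := μ.sum_m_mul_step fun _ => 1
  simp only [Expectation.const, mul_one, μ.sum_eq_one] at h
  exact h.symm

theorem sum_mTilde_mul_t (u : V₀ → ℝ) :
    ∑ e, μ.mTilde e * u (X₀.t e) = ∑ y, μ.m y * u y := by
  classical
  rw [← Finset.sum_fiberwise Finset.univ X₀.t]
  refine Finset.sum_congr rfl fun y _ => ?_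
  rw [← μ.invariant y, Finset.sum_mul]
  refine Finset.sum_congr (by congr) fun e he => ?_
  rw [mTilde, (Finset.mem_filter.mp he).2]

theorem sum_mTilde_mul_o (u : V₀ → ℝ) :
    ∑ e, μ.mTilde e * u (X₀.o e) = ∑ y, μ.m y * u y := by
  rw [← μ.sum_m_mul_step]
  refine Finset.sum_congr rfl fun y _ => ?_
  rw [P.step_congr (g := fun _ => u y) fun e he => by rw [he], Expectation.const]

theorem sum_m_mul_laplacian (u : V₀ → ℝ) :
    ∑ y, μ.m y * P.step y (fun e => u (X₀.t e) - u (X₀.o e)) = 0 := by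
  rw [μ.sum_m_mul_step]
  simp only [mul_sub, Finset.sum_sub_distrib, sum_mTilde_mul_t, sum_mTilde_mul_o, sub_self]

/-- The Fredholm alternative for the Laplacian `L` of the walk. With `M f = ∑ m(y) f(y)`, the
operator `u ↦ L u + M u` is injective by the maximum principle, hence surjective. -/
theorem exists_poisson (hX₀ : X₀.Connected) {f : V₀ → ℝ} (hf : ∑ y, μ.m y * f y = 0) :
    ∃ u : V₀ → ℝ, ∀ y, P.step y (fun e => u (X₀.t e) - u (X₀.o e)) = f y := by
  let T : (V₀ → ℝ) →ₗ[ℝ] (V₀ → ℝ) :=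
    LinearMap.pi (fun y => (P.step y).toLinearMap ∘ₗ
      (LinearMap.funLeft ℝ ℝ X₀.t - LinearMap.funLeft ℝ ℝ X₀.o)) +
    LinearMap.pi fun _ => ∑ z, μ.m z • LinearMap.proj z
  have hT : ∀ u y, T u y = P.step y (fun e => u (X₀.t e) - u (X₀.o e)) + ∑ z, μ.m z * u z := by
    intro u y
    simp only [T, LinearMap.add_apply, Pi.add_apply, LinearMap.pi_apply, LinearMap.comp_apply,
      LinearMap.sum_apply, LinearMap.smul_apply, LinearMap.proj_apply, smul_eq_mul]
    rfl
  have hM : ∀ u, ∑ y, μ.m y * T u y = ∑ z, μ.m z * u z := fun u => by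
    simp only [hT, mul_add, Finset.sum_add_distrib, μ.sum_m_mul_laplacian, ← Finset.sum_mul,
      μ.sum_eq_one, one_mul, zero_add]
  have hinj : Function.Injective T := by
    rw [← LinearMap.ker_eq_bot, LinearMap.ker_eq_bot']
    intro u hu
    have h1 : ∑ z, μ.m z * u z = 0 := by
      rw [← hM, hu]
      simp
    have h2 : ∀ y z, u y = u z := P.eq_of_harmonic hX₀ fun y => by
      have := hT u y
      rw [hu, h1, Pi.zero_apply, add_zero] at this
      exact this.symm
    ext y
    simp only [fun z => h2 z y, ← Finset.sum_mul, μ.sum_eq_one, one_mul] at h1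
    exact h1
  obtain ⟨u, rfl⟩ := LinearMap.injective_iff_surjective.mp hinj f
  refine ⟨u, fun y => ?_⟩
  rw [hM] at hf
  rw [hT, hf, add_zero]

end InvariantMeasure

end Poisson

/-! ### Modified harmonic forms -/

section Hodge

variable {V₀ E₀ : Type*} {X₀ : OrientedGraph V₀ E₀}

variable (X₀) in
/-- The coboundary of a function on the vertices. -/
def coboundary (u : V₀ → ℝ) : Module.Dual ℝ X₀.Chain :=
  Finsupp.linearCombination ℝ u ∘ₗ X₀.boundary

theorem coboundary_edge (u : V₀ → ℝ) (e : E₀) :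
    coboundary X₀ u (X₀.edge e) = u (X₀.t e) - u (X₀.o e) := by
  simp [coboundary, OrientedGraph.boundary]

theorem coboundary_of_mem_H1 (u : V₀ → ℝ) {z : X₀.Chain} (hz : z ∈ X₀.H1) :
    coboundary X₀ u z = 0 := by
  rw [coboundary, LinearMap.comp_apply, LinearMap.mem_ker.mp hz, map_zero]

theorem edge_inv (e : E₀) : X₀.edge (X₀.inv e) = -X₀.edge e := by
  rw [eq_neg_iff_add_eq_zero, add_comm]
  simp only [OrientedGraph.edge, ← Submodule.Quotient.mk_add]
  exact (Submodule.Quotient.mk_eq_zero _).mpr (Submodule.subset_span ⟨e, rfl⟩)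

theorem chain_hom_ext {M : Type*} [AddCommGroup M] [Module ℝ M] {f g : X₀.Chain →ₗ[ℝ] M}
    (h : ∀ e, f (X₀.edge e) = g (X₀.edge e)) : f = g := by
  refine Submodule.linearMap_qext _ (Finsupp.lhom_ext' fun e => LinearMap.ext_ring ?_)
  exact h e

/-- A cochain that vanishes on the cycles is a coboundary. -/
theorem exists_eq_coboundary {ω : Module.Dual ℝ X₀.Chain} (h : ω ∘ₗ X₀.H1.subtype = 0) :
    ∃ u, ω = coboundary X₀ u := by
  have h1 : ω ∈ LinearMap.range X₀.boundary.dualMap := by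
    rw [LinearMap.range_dualMap_eq_dualAnnihilator_ker, Submodule.mem_dualAnnihilator]
    exact fun z hz => LinearMap.congr_fun h ⟨z, hz⟩
  obtain ⟨φ, rfl⟩ := h1
  refine ⟨fun y => φ (Finsupp.single y 1), chain_hom_ext fun e => ?_⟩
  rw [coboundary_edge]
  simp [OrientedGraph.boundary]

namespace InvariantMeasure

variable [Fintype V₀] [Fintype E₀] {P : TransitionProbability X₀} (μ : InvariantMeasure P)

theorem isModifiedHarmonic_iff {ω : Module.Dual ℝ X₀.Chain} : μ.IsModifiedHarmonic ω ↔
    ∀ y, P.step y (fun e => ω (X₀.edge e)) = ω μ.gammaP := Iff.rfl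

theorem apply_gammaP (ω : Module.Dual ℝ X₀.Chain) :
    ω μ.gammaP = ∑ e, μ.mTilde e * ω (X₀.edge e) := by
  simp [gammaP]

theorem IsModifiedHarmonic.add {ω₁ ω₂ : Module.Dual ℝ X₀.Chain} (h₁ : μ.IsModifiedHarmonic ω₁)
    (h₂ : μ.IsModifiedHarmonic ω₂) : μ.IsModifiedHarmonic (ω₁ + ω₂) := by
  rw [isModifiedHarmonic_iff] at h₁ h₂ ⊢
  intro y
  rw [LinearMap.add_apply, ← h₁ y, ← h₂ y, ← map_add]
  rfl

theorem IsModifiedHarmonic.smul {ω : Module.Dual ℝ X₀.Chain} (h : μ.IsModifiedHarmonic ω)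
    (c : ℝ) : μ.IsModifiedHarmonic (c • ω) := by
  rw [isModifiedHarmonic_iff] at h ⊢
  intro y
  rw [LinearMap.smul_apply, ← h y, ← map_smul]
  rfl

theorem exists_isModifiedHarmonic (hX₀ : X₀.Connected) (κ : Module.Dual ℝ X₀.H1) :
    ∃ ω, μ.IsModifiedHarmonic ω ∧ ω ∘ₗ X₀.H1.subtype = κ := by
  obtain ⟨ω, hω⟩ := LinearMap.exists_extend κ
  obtain ⟨u, hu⟩ := μ.exists_poisson hX₀
    (f := fun y => ω μ.gammaP - P.step y (fun e => ω (X₀.edge e))) (by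
      simp only [mul_sub, Finset.sum_sub_distrib, ← Finset.sum_mul, μ.sum_eq_one, one_mul,
        μ.sum_m_mul_step, μ.apply_gammaP, sub_self])
  refine ⟨ω + coboundary X₀ u, fun y => ?_, ?_⟩
  · change P.step y (fun e => (ω + coboundary X₀ u) (X₀.edge e)) = _
    have h1 : (fun e => (ω + coboundary X₀ u) (X₀.edge e)) =
        (fun e => ω (X₀.edge e)) + fun e => u (X₀.t e) - u (X₀.o e) := by
      ext e
      rw [LinearMap.add_apply, coboundary_edge, Pi.add_apply]
    rw [h1, map_add, hu, LinearMap.add_apply, coboundary_of_mem_H1 u μ.gammaP.2]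
    ring
  · ext z
    rw [← hω]
    simp [coboundary_of_mem_H1 u z.2]

theorem isModifiedHarmonic_harmonicForm (hX₀ : X₀.Connected) (κ : Module.Dual ℝ X₀.H1) :
    μ.IsModifiedHarmonic (μ.harmonicForm κ) :=
  (Classical.epsilon_spec (μ.exists_isModifiedHarmonic hX₀ κ)).1

theorem harmonicForm_comp_subtype (hX₀ : X₀.Connected) (κ : Module.Dual ℝ X₀.H1) :
    μ.harmonicForm κ ∘ₗ X₀.H1.subtype = κ :=
  (Classical.epsilon_spec (μ.exists_isModifiedHarmonic hX₀ κ)).2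

theorem harmonicForm_gammaP (hX₀ : X₀.Connected) (κ : Module.Dual ℝ X₀.H1) :
    μ.harmonicForm κ μ.gammaP = κ μ.gammaP :=
  LinearMap.congr_fun (μ.harmonicForm_comp_subtype hX₀ κ) μ.gammaP

theorem IsModifiedHarmonic.ext (hX₀ : X₀.Connected) {ω₁ ω₂ : Module.Dual ℝ X₀.Chain}
    (h₁ : μ.IsModifiedHarmonic ω₁) (h₂ : μ.IsModifiedHarmonic ω₂)
    (h : ω₁ ∘ₗ X₀.H1.subtype = ω₂ ∘ₗ X₀.H1.subtype) : ω₁ = ω₂ := by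
  obtain ⟨u, hu⟩ := exists_eq_coboundary (ω := ω₁ - ω₂) (by rw [LinearMap.sub_comp, h, sub_self])
  have h3 : ∀ y, P.step y (fun e => u (X₀.t e) - u (X₀.o e)) = 0 := fun y => by
    have h4 : (fun e => u (X₀.t e) - u (X₀.o e)) =
        (fun e => ω₁ (X₀.edge e)) - fun e => ω₂ (X₀.edge e) := by
      ext e
      rw [← coboundary_edge, ← hu]
      rfl
    have h5 : ω₁ μ.gammaP = ω₂ μ.gammaP := LinearMap.congr_fun h μ.gammaP
    rw [h4, map_sub, (μ.isModifiedHarmonic_iff.mp h₁) y, (μ.isModifiedHarmonic_iff.mp h₂) y, h5,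
      sub_self]
  have h6 := P.eq_of_harmonic hX₀ h3
  rw [← sub_eq_zero, hu]
  refine chain_hom_ext fun e => ?_
  rw [coboundary_edge, h6 (X₀.t e) (X₀.o e), sub_self, LinearMap.zero_apply]

theorem harmonicForm_add (hX₀ : X₀.Connected) (κ₁ κ₂ : Module.Dual ℝ X₀.H1) :
    μ.harmonicForm (κ₁ + κ₂) = μ.harmonicForm κ₁ + μ.harmonicForm κ₂ :=
  IsModifiedHarmonic.ext μ hX₀ (μ.isModifiedHarmonic_harmonicForm hX₀ _)
    (IsModifiedHarmonic.add μ (μ.isModifiedHarmonic_harmonicForm hX₀ _)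
      (μ.isModifiedHarmonic_harmonicForm hX₀ _))
    (by rw [LinearMap.add_comp]; simp only [μ.harmonicForm_comp_subtype hX₀])

theorem harmonicForm_smul (hX₀ : X₀.Connected) (c : ℝ) (κ : Module.Dual ℝ X₀.H1) :
    μ.harmonicForm (c • κ) = c • μ.harmonicForm κ :=
  IsModifiedHarmonic.ext μ hX₀ (μ.isModifiedHarmonic_harmonicForm hX₀ _)
    (IsModifiedHarmonic.smul μ (μ.isModifiedHarmonic_harmonicForm hX₀ _) c)
    (by rw [LinearMap.smul_comp]; simp only [μ.harmonicForm_comp_subtype hX₀])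

theorem innerP_comm (κ₁ κ₂ : Module.Dual ℝ X₀.H1) : μ.innerP κ₁ κ₂ = μ.innerP κ₂ κ₁ := by
  rw [innerP, innerP, mul_comm (κ₁ _)]
  congr 1
  exact Finset.sum_congr rfl fun e _ => by ring

theorem innerP_add_left (hX₀ : X₀.Connected) (κ₁ κ₂ κ₃ : Module.Dual ℝ X₀.H1) :
    μ.innerP (κ₁ + κ₂) κ₃ = μ.innerP κ₁ κ₃ + μ.innerP κ₂ κ₃ := by
  simp only [innerP, μ.harmonicForm_add hX₀, LinearMap.add_apply, mul_add, add_mul,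
    Finset.sum_add_distrib]
  ring

theorem innerP_smul_left (hX₀ : X₀.Connected) (c : ℝ) (κ₁ κ₂ : Module.Dual ℝ X₀.H1) :
    μ.innerP (c • κ₁) κ₂ = c * μ.innerP κ₁ κ₂ := by
  simp only [innerP, μ.harmonicForm_smul hX₀, LinearMap.smul_apply, smul_eq_mul, mul_sub,
    Finset.mul_sum]
  congr 1
  · exact Finset.sum_congr rfl fun e _ => by ring
  · ring

/-- The inner product is a variance. -/
theorem innerP_self (hX₀ : X₀.Connected) (κ : Module.Dual ℝ X₀.H1) : μ.innerP κ κ =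
    ∑ e, μ.mTilde e * (μ.harmonicForm κ (X₀.edge e) - κ μ.gammaP) ^ 2 := by
  have h1 : ∑ e, μ.mTilde e * μ.harmonicForm κ (X₀.edge e) = κ μ.gammaP := by
    rw [← apply_gammaP, μ.harmonicForm_gammaP hX₀]
  have h2 : ∀ e, μ.mTilde e * (μ.harmonicForm κ (X₀.edge e) - κ μ.gammaP) ^ 2 =
      μ.mTilde e * μ.harmonicForm κ (X₀.edge e) * μ.harmonicForm κ (X₀.edge e) -
        2 * κ μ.gammaP * (μ.mTilde e * μ.harmonicForm κ (X₀.edge e)) +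
        κ μ.gammaP ^ 2 * μ.mTilde e := fun e => by ring
  simp only [h2, Finset.sum_add_distrib, Finset.sum_sub_distrib, ← Finset.mul_sum, h1,
    μ.sum_mTilde, innerP]
  ring

theorem innerP_self_nonneg (hX₀ : X₀.Connected) (κ : Module.Dual ℝ X₀.H1) :
    0 ≤ μ.innerP κ κ := by
  rw [μ.innerP_self hX₀]
  exact Finset.sum_nonneg fun e _ => mul_nonneg (μ.mTilde_pos e).le (sq_nonneg _)

/-- If the variance vanishes, the harmonic form is constant on the oriented edges, hence zero as it
is odd. -/
theorem eq_zero_of_innerP_self_eq_zero (hX₀ : X₀.Connected) {κ : Module.Dual ℝ X₀.H1}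
    (h : μ.innerP κ κ = 0) : κ = 0 := by
  rw [μ.innerP_self hX₀, Finset.sum_eq_zero_iff_of_nonneg
    fun e _ => mul_nonneg (μ.mTilde_pos e).le (sq_nonneg _)] at h
  have h1 : ∀ e, μ.harmonicForm κ (X₀.edge e) = κ μ.gammaP := fun e =>
    sub_eq_zero.mp (pow_eq_zero_iff two_ne_zero |>.mp
      ((mul_eq_zero.mp (h e (Finset.mem_univ e))).resolve_left (μ.mTilde_pos e).ne'))
  have h2 : μ.harmonicForm κ = 0 := chain_hom_ext fun e => by
    have h3 := h1 (X₀.inv e)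
    rw [edge_inv, map_neg] at h3
    rw [LinearMap.zero_apply]
    linarith [h1 e]
  rw [← μ.harmonicForm_comp_subtype hX₀ κ, h2, LinearMap.zero_comp]

/-- The martingale approximation: a cochain that represents `κ` differs from the harmonic form by a
coboundary, and the centred harmonic form has mean zero at every vertex. -/
theorem hasAsymptoticVariance (hX₀ : X₀.Connected) {κ : Module.Dual ℝ X₀.H1}
    {ω : Module.Dual ℝ X₀.Chain} (hω : ω ∘ₗ X₀.H1.subtype = κ) :
    P.HasAsymptoticVariance (fun e => ω (X₀.edge e) - κ μ.gammaP) (μ.innerP κ κ) := by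
  obtain ⟨u, hu⟩ := exists_eq_coboundary (ω := μ.harmonicForm κ - ω)
    (by rw [LinearMap.sub_comp, hω, μ.harmonicForm_comp_subtype hX₀, sub_self])
  have h1 : ∀ e, ω (X₀.edge e) - κ μ.gammaP + (u (X₀.t e) - u (X₀.o e)) =
      μ.harmonicForm κ (X₀.edge e) - κ μ.gammaP := fun e => by
    rw [← coboundary_edge, ← hu, LinearMap.sub_apply]
    ring
  set D : E₀ → ℝ := fun e => μ.harmonicForm κ (X₀.edge e) - κ μ.gammaP with hD
  obtain ⟨v, hv⟩ := μ.exists_poisson hX₀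
    (f := fun y => μ.innerP κ κ - P.step y (fun e => D e ^ 2)) (by
      simp only [mul_sub, Finset.sum_sub_distrib, ← Finset.sum_mul, μ.sum_eq_one, one_mul,
        μ.sum_m_mul_step, μ.innerP_self hX₀]
      rw [hD, sub_self])
  refine ⟨u, v, fun y => ?_, fun y => ?_⟩
  · simp only [h1]
    have h2 : D = (fun e => μ.harmonicForm κ (X₀.edge e)) - fun _ => κ μ.gammaP := rfl
    rw [← hD, h2, map_sub, Expectation.const,
      (μ.isModifiedHarmonic_iff.mp (μ.isModifiedHarmonic_harmonicForm hX₀ κ)) y,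
      μ.harmonicForm_gammaP hX₀, sub_self]
  · simp only [h1]
    have h2 : (fun e => D e ^ 2 + (v (X₀.t e) - v (X₀.o e))) =
        (fun e => D e ^ 2) + fun e => v (X₀.t e) - v (X₀.o e) := rfl
    change P.step y (fun e => D e ^ 2 + (v (X₀.t e) - v (X₀.o e))) = _
    rw [h2, map_add, hv]
    ring

end InvariantMeasure

end Hodge

/-! ### The Albanese metric -/

section Gram

open scoped MatrixOrder in
/-- The Gram matrix of the metric dual to an inner product `N` on `Hom(W, ℝ)` is `B* B` with `B`
invertible, and `θ ↦ ⟨θ, B ·⟩` is an isometry from the Euclidean space onto `Hom(W, ℝ)`. -/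
theorem exists_sqrt_gram {W : Type*} [AddCommGroup W] [Module ℝ W] {d : ℕ}
    (b : Module.Basis (Fin d) ℝ W) (N : Module.Dual ℝ W →ₗ[ℝ] Module.Dual ℝ W →ₗ[ℝ] ℝ)
    (hsymm : ∀ η η', N η η' = N η' η) (hpos : ∀ η, η ≠ 0 → 0 < N η η)
    {r : Fin d → Module.Dual ℝ W} (hr : ∀ i η, N (r i) η = η (b i)) :
    ∃ (B : EuclideanSpace ℝ (Fin d) →L[ℝ] EuclideanSpace ℝ (Fin d)) (κ : ℝ), 0 < κ ∧
      (∀ x, ‖x‖ ≤ κ * ‖B x‖) ∧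
      (∀ x, inner ℝ (Matrix.toEuclideanLin (Matrix.of fun i j => N (r i) (r j)) x) x =
        ‖B x‖ ^ 2) ∧
      ∀ θ (η : Module.Dual ℝ W),
        (∀ w, η w = inner ℝ θ (B (WithLp.toLp 2 (b.equivFun w)))) → N η η = ‖θ‖ ^ 2 := by
  set Q : Matrix (Fin d) (Fin d) ℝ := Matrix.of fun i j => N (r i) (r j) with hQ
  -- the form `∑ᵢ xᵢ rᵢ` represents the evaluation at `∑ᵢ xᵢ bᵢ`
  have hrep : ∀ (x : Fin d → ℝ) η, N (∑ i, x i • r i) η = η (∑ i, x i • b i) := fun x η => by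
    simp [hr]
  have hQx : ∀ x i, (Q.mulVec x) i = (∑ j, x j • r j) (b i) := fun x i => by
    rw [← hr, hQ, Matrix.mulVec, dotProduct, map_sum]
    refine Finset.sum_congr rfl fun j _ => ?_
    rw [Matrix.of_apply, map_smul, smul_eq_mul, mul_comm]
  have hQpos : Q.PosDef := by
    refine Matrix.PosDef.of_dotProduct_mulVec_pos ?_ fun x hx => ?_
    · ext i j
      simp [hQ, hsymm (r j)]
    · have h1 : star x ⬝ᵥ Q.mulVec x = N (∑ i, x i • r i) (∑ i, x i • r i) := by
        rw [hrep, map_sum, dotProduct]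
        refine Finset.sum_congr rfl fun i _ => ?_
        rw [hQx, map_smul, smul_eq_mul]
        rfl
      rw [h1]
      refine hpos _ fun h0 => hx ?_
      have h2 : ∑ i, x i • b i = 0 :=
        (Module.forall_dual_apply_eq_zero_iff ℝ _).mp fun η => by rw [← hrep, h0]; simp
      ext i
      exact Fintype.linearIndependent_iff.mp b.linearIndependent x h2 i
  obtain ⟨M, hM⟩ := CStarAlgebra.nonneg_iff_eq_star_mul_self.mp hQpos.posSemidef.nonneg
  have hMdet : IsUnit M := by
    have h1 : IsUnit (star M * M) := hM ▸ hQpos.isUnit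
    rw [Matrix.isUnit_iff_isUnit_det, Matrix.det_mul] at h1
    rw [Matrix.isUnit_iff_isUnit_det]
    exact (IsUnit.mul_iff.mp h1).2
  set B := Matrix.toEuclideanCLM (𝕜 := ℝ) M with hB
  set B' := Matrix.toEuclideanCLM (𝕜 := ℝ) M⁻¹ with hB'
  have hB'B : ∀ x, B' (B x) = x := fun x => by
    rw [← mul_apply_eq_comp, hB, hB', ← map_mul,
      Matrix.nonsing_inv_mul _ ((Matrix.isUnit_iff_isUnit_det _).mp hMdet), map_one,
      one_apply_eq_self]
  have hBB' : ∀ x, B (B' x) = x := fun x => by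
    rw [← mul_apply_eq_comp, hB, hB', ← map_mul,
      Matrix.mul_nonsing_inv _ ((Matrix.isUnit_iff_isUnit_det _).mp hMdet), map_one,
      one_apply_eq_self]
  have hBQ : ∀ x y, inner ℝ (Matrix.toEuclideanCLM (𝕜 := ℝ) Q x) y = inner ℝ (B x) (B y) :=
    fun x y => by
      rw [hM, map_mul, map_star, mul_apply_eq_comp, ContinuousLinearMap.star_eq_adjoint,
        ContinuousLinearMap.adjoint_inner_left]
  refine ⟨B, ‖B'‖ + 1, by positivity, fun x => ?_, fun x => ?_, fun θ η hη => ?_⟩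
  · calc ‖x‖ = ‖B' (B x)‖ := by rw [hB'B]
      _ ≤ ‖B'‖ * ‖B x‖ := B'.le_opNorm _
      _ ≤ _ := by gcongr; linarith
  · rw [← real_inner_self_eq_norm_sq, ← hBQ]
    rfl
  · set x := B' θ with hx
    have hθ : B x = θ := hBB' θ
    have h1 : η = ∑ i, x i • r i := b.ext fun i => by
      have h2 : WithLp.toLp 2 (b.equivFun (b i)) = EuclideanSpace.single i (1 : ℝ) := by
        ext j
        simp [eq_comm]
      rw [← hQx, hη, ← hθ, ← hBQ, h2, EuclideanSpace.inner_single_right]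
      simp
    have h2 : N η η = η (∑ i, x i • b i) := by
      conv_lhs => rw [h1]
      rw [← h1]
      exact (congrArg (fun ζ => N ζ η) h1).trans (hrep _ _)
    rw [h2, hη, ← b.equivFun_symm_apply, LinearEquiv.apply_symm_apply, WithLp.toLp_ofLp, hθ,
      real_inner_self_eq_norm_sq]

end Gram

namespace InvariantMeasure

variable {V₀ E₀ : Type*} [Fintype V₀] [Fintype E₀] {X₀ : OrientedGraph V₀ E₀}
  {P : TransitionProbability X₀} (μ : InvariantMeasure P)
  {W : Type*} [AddCommGroup W] [Module ℝ W] (ρ : X₀.H1 →ₗ[ℝ] W)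

theorem innerDual_comm (η η' : Module.Dual ℝ W) : μ.innerDual ρ η η' = μ.innerDual ρ η' η :=
  μ.innerP_comm _ _

/-- `innerDual` as a bilinear form. -/
def innerDualForm (hX₀ : X₀.Connected) : Module.Dual ℝ W →ₗ[ℝ] Module.Dual ℝ W →ₗ[ℝ] ℝ :=
  LinearMap.mk₂ ℝ (μ.innerDual ρ)
    (fun η₁ η₂ η₃ => μ.innerP_add_left hX₀ (η₁ ∘ₗ ρ) (η₂ ∘ₗ ρ) (η₃ ∘ₗ ρ))
    (fun c η₁ η₂ => μ.innerP_smul_left hX₀ c (η₁ ∘ₗ ρ) (η₂ ∘ₗ ρ))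
    (fun η₁ η₂ η₃ => by
      rw [μ.innerDual_comm, μ.innerDual_comm ρ η₁, μ.innerDual_comm ρ η₁]
      exact μ.innerP_add_left hX₀ (η₂ ∘ₗ ρ) (η₃ ∘ₗ ρ) (η₁ ∘ₗ ρ))
    (fun c η₁ η₂ => by
      rw [μ.innerDual_comm, μ.innerDual_comm ρ η₁]
      exact μ.innerP_smul_left hX₀ c (η₂ ∘ₗ ρ) (η₁ ∘ₗ ρ))

theorem innerDualForm_pos (hX₀ : X₀.Connected)
    (hρ : ∀ η : Module.Dual ℝ W, η ∘ₗ ρ = 0 → η = 0) (η : Module.Dual ℝ W) (hη : η ≠ 0) :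
    0 < μ.innerDualForm ρ hX₀ η η :=
  lt_of_le_of_ne (μ.innerP_self_nonneg hX₀ (η ∘ₗ ρ)) fun h =>
    hη (hρ η (μ.eq_zero_of_innerP_self_eq_zero hX₀ h.symm))

/-- The inner product identifies `Hom(W, ℝ)` with its dual, hence with `W`. -/
theorem innerDual_rieszRep [FiniteDimensional ℝ W] (hX₀ : X₀.Connected)
    (hρ : ∀ η : Module.Dual ℝ W, η ∘ₗ ρ = 0 → η = 0) (Y : W) (η : Module.Dual ℝ W) :
    μ.innerDual ρ (μ.rieszRep ρ Y) η = η Y := by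
  refine Classical.epsilon_spec (p := fun ω => ∀ η : Module.Dual ℝ W, μ.innerDual ρ ω η = η Y)
    ?_ η
  have hinj : Function.Injective (μ.innerDualForm ρ hX₀) := by
    rw [← LinearMap.ker_eq_bot, LinearMap.ker_eq_bot']
    intro ζ hζ
    by_contra h0
    have h1 := μ.innerDualForm_pos ρ hX₀ hρ ζ h0
    rw [hζ] at h1
    exact lt_irrefl _ h1
  have hsurj := (LinearMap.injective_iff_surjective_of_finrank_eq_finrank
    (Subspace.dual_finrank_eq (K := ℝ) (V := Module.Dual ℝ W)).symm).mp hinj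
  obtain ⟨ω, hω⟩ := hsurj (Module.Dual.eval ℝ W Y)
  exact ⟨ω, fun η => LinearMap.congr_fun hω η⟩

theorem exists_sqrt_albaneseGram (hX₀ : X₀.Connected)
    (hρ : ∀ η : Module.Dual ℝ W, η ∘ₗ ρ = 0 → η = 0) {d : ℕ} (b : Module.Basis (Fin d) ℝ W) :
    ∃ (B : EuclideanSpace ℝ (Fin d) →L[ℝ] EuclideanSpace ℝ (Fin d)) (κ : ℝ), 0 < κ ∧
      (∀ x, ‖x‖ ≤ κ * ‖B x‖) ∧
      (∀ x, inner ℝ (Matrix.toEuclideanLin (μ.albaneseGram ρ b) x) x = ‖B x‖ ^ 2) ∧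
      ∀ θ (η : Module.Dual ℝ W),
        (∀ w, η w = inner ℝ θ (B (WithLp.toLp 2 (b.equivFun w)))) →
          μ.innerP (η ∘ₗ ρ) (η ∘ₗ ρ) = ‖θ‖ ^ 2 := by
  have : FiniteDimensional ℝ W := b.finiteDimensional_of_finite
  exact exists_sqrt_gram b (μ.innerDualForm ρ hX₀) (μ.innerDual_comm ρ)
    (μ.innerDualForm_pos ρ hX₀ hρ) fun i η => μ.innerDual_rieszRep ρ hX₀ hρ (b i) η

end InvariantMeasure

/-! ### Equivariant maps and the induced map on homology -/

namespace RegularCovering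

variable {Γ : Type*} [Group Γ] {V E V₀ E₀ : Type*} [MulAction Γ V] [MulAction Γ E]
  {X : OrientedGraph V E} {X₀ : OrientedGraph V₀ E₀} (π : RegularCovering Γ X X₀)

theorem isPath_map {x y : V} {l : List E} (hl : X.IsPath x l y) :
    X₀.IsPath (π.vert x) (l.map π.edge) (π.vert y) := by
  induction l generalizing x with
  | nil =>
    obtain rfl : x = y := hl
    rfl
  | cons e l ih =>
    obtain ⟨rfl, h⟩ := hl
    refine ⟨π.o_edge e, ?_⟩
    rw [π.t_edge]
    exact ih h

theorem connected_base (π : RegularCovering Γ X X₀) (hX : X.Connected) :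
    X₀.Connected := fun y z => by
  obtain ⟨x, rfl⟩ := π.vert_surjective y
  obtain ⟨x', rfl⟩ := π.vert_surjective z
  obtain ⟨l, hl⟩ := hX x x'
  exact ⟨_, π.isPath_map hl⟩

theorem boundary_path {x y : V} {l : List E} (hl : X.IsPath x l y) :
    X₀.boundary (l.map fun e => X₀.edge (π.edge e)).sum =
      Finsupp.single (π.vert y) 1 - Finsupp.single (π.vert x) 1 := by
  induction l generalizing x with
  | nil =>
    obtain rfl : x = y := hl
    simp
  | cons e l ih =>
    obtain ⟨rfl, h⟩ := hl
    rw [List.map_cons, List.sum_cons, map_add, ih h, OrientedGraph.boundary,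
      OrientedGraph.liftChain_edge, π.o_edge, π.t_edge]
    abel

section Equivariant

variable {M : Type*} [AddCommGroup M] {ℓ : Γ → M} {φ : V → M}

theorem sub_eq_sub_of_edge_eq (hφ : ∀ (γ : Γ) y, φ (γ • y) = ℓ γ + φ y) {e e' : E}
    (h : π.edge e = π.edge e') : φ (X.t e) - φ (X.o e) = φ (X.t e') - φ (X.o e') := by
  obtain ⟨γ, rfl⟩ := π.exists_smul_eq h
  rw [π.o_smul, π.t_smul, hφ, hφ]
  abel

variable [Module ℝ M]

/-- The increments `φ (t e) - φ (o e)` of an equivariant map as a map on the 1-chains of the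
quotient graph. -/
def incrementChain (hφ : ∀ (γ : Γ) y, φ (γ • y) = ℓ γ + φ y) : X₀.Chain →ₗ[ℝ] M :=
  X₀.liftChain (fun e₀ => φ (X.t (π.liftEdge e₀)) - φ (X.o (π.liftEdge e₀))) fun e₀ => by
    rw [π.sub_eq_sub_of_edge_eq hφ (e' := X.inv (π.liftEdge e₀))
      (by rw [π.edge_liftEdge, π.edge_inv, π.edge_liftEdge]), X.o_inv, X.t_inv]
    abel

theorem incrementChain_edge (hφ : ∀ (γ : Γ) y, φ (γ • y) = ℓ γ + φ y) (e : E) :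
    π.incrementChain hφ (X₀.edge (π.edge e)) = φ (X.t e) - φ (X.o e) := by
  rw [incrementChain, OrientedGraph.liftChain_edge]
  exact π.sub_eq_sub_of_edge_eq hφ (π.edge_liftEdge _)

/-- On cycles, the increments of an equivariant map depend on its equivariance only. -/
theorem incrementChain_comp_subtype (hφ : ∀ (γ : Γ) y, φ (γ • y) = ℓ γ + φ y)
    (hℓ : ∀ γ γ', ℓ (γ * γ') = ℓ γ + ℓ γ') :
    π.incrementChain hφ ∘ₗ X₀.H1.subtype = π.induced ℓ hℓ := by
  set c : V₀ → M := fun y => φ (π.vert_surjective y).choose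
  have h1 : ∀ y, φ y = ℓ (π.sheet y) + c (π.vert y) := fun y => by
    conv_lhs => rw [π.sheet_spec y, hφ]
  have h2 : π.incrementChain hφ - π.inducedChain ℓ hℓ =
      Finsupp.linearCombination ℝ c ∘ₗ X₀.boundary := chain_hom_ext fun e₀ => by
    obtain ⟨e, rfl⟩ := π.exists_lift e₀
    rw [LinearMap.sub_apply, π.incrementChain_edge, inducedChain, OrientedGraph.liftChain_edge,
      π.sheet_diff_eq ℓ hℓ (e' := e) (π.edge_liftEdge _), LinearMap.comp_apply,
      OrientedGraph.boundary, OrientedGraph.liftChain_edge, h1 (X.t e), h1 (X.o e), π.o_edge,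
      π.t_edge, map_sub, Finsupp.linearCombination_single, Finsupp.linearCombination_single,
      one_smul, one_smul]
    abel
  refine LinearMap.ext fun z => sub_eq_zero.mp ?_
  have h3 := LinearMap.congr_fun h2 z
  rw [LinearMap.comp_apply, LinearMap.mem_ker.mp z.2, map_zero] at h3
  exact h3

end Equivariant

variable {𝔤 : Type*} [LieRing 𝔤] [LieAlgebra ℝ 𝔤] [FiniteDimensional ℝ 𝔤] [LieRing.IsNilpotent 𝔤]
  [TopologicalSpace 𝔤] [IsTopologicalAddGroup 𝔤] [ContinuousSMul ℝ 𝔤] [T2Space 𝔤]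
  {W : Submodule ℝ 𝔤} (hW : IsCompl W (commutatorPart 𝔤)) {ι : Γ →ₙ* NilpotentLieGroup 𝔤}

/-- The transpose of `ρ_ℝ` is injective: a linear form on `W` that vanishes on the image of the
lattice is a homomorphism `G → ℝ` that factors through the compact quotient, so it is bounded,
hence zero. -/
theorem eq_zero_of_comp_rhoR_eq_zero (hι : IsCocompactLattice ι) (hX : X.Connected) (x : V)
    (η : Module.Dual ℝ W) (hη : η ∘ₗ π.rhoR hW ι = 0) : η = 0 := by
  have h1 : ∀ γ, η (logOne hW (ι γ)) = 0 := fun γ => by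
    obtain ⟨l, hl⟩ := hX x (γ • x)
    have h2 : (l.map fun e => X₀.edge (π.edge e)).sum ∈ X₀.H1 := by
      rw [LinearMap.mem_ker, π.boundary_path hl, π.vert_smul, sub_self]
    have h3 := π.induced_closedPath (fun γ => logOne hW (ι γ))
      (fun γ γ' => by rw [map_mul, logOne_mul]) l x γ hl ⟨_, h2⟩ rfl
    rw [← h3]
    exact LinearMap.congr_fun hη ⟨_, h2⟩
  obtain ⟨K, hK, hcov⟩ := hι.cocompact
  have hcont : Continuous fun g : NilpotentLieGroup 𝔤 => η (logOne hW g) :=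
    (LinearMap.continuous_of_finiteDimensional
      (η ∘ₗ W.projectionOnto (commutatorPart 𝔤) hW)).comp continuous_induced_dom
  obtain ⟨C, hC⟩ := (hK.image hcont).isBounded.exists_norm_le
  have hbound : ∀ g, |η (logOne hW g)| ≤ C := fun g => by
    obtain ⟨γ, k, hk, rfl⟩ := hcov g
    rw [logOne_mul, map_add, h1, zero_add]
    exact hC _ ⟨k, hk, rfl⟩
  ext w
  have h4 : ∀ t : ℝ, |t * η w| ≤ C := fun t => by
    have h5 := hbound (.exp (t • (w : 𝔤)))
    rwa [logOne, map_smul, Submodule.projectionOnto_apply_left, map_smul, smul_eq_mul] at h5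
  by_contra h0
  have h6 := h4 ((C + 1) / η w)
  rw [div_mul_cancel₀ _ h0] at h6
  linarith [le_abs_self (C + 1)]

end RegularCovering

/-! ### The law of the projected walk -/

section Law

variable {Γ : Type*} [Group Γ] {V E V₀ E₀ : Type*} [MulAction Γ V] [MulAction Γ E]
  {X : OrientedGraph V E} {X₀ : OrientedGraph V₀ E₀} (π : RegularCovering Γ X X₀)

/-- The projection to the base graph of the edges of `c` at the positions `n, …, n + k - 1`. -/
def RegularCovering.projectedEdges {x : V} (c : PathSpace X x) (n k : ℕ) : List E₀ :=
  List.ofFn fun i : Fin k => π.edge (c.1 (n + i))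

theorem RegularCovering.projectedEdges_succ {x : V} (c : PathSpace X x) (n k : ℕ) :
    π.projectedEdges c n (k + 1) = π.edge (c.1 n) :: π.projectedEdges c (n + 1) k := by
  simp only [projectedEdges, List.ofFn_succ, Fin.val_zero, add_zero, Fin.val_succ]
  congr 2
  ext i
  rw [Nat.add_right_comm, Nat.add_assoc]

theorem PathSpace.o_eq_of_agree {x : V} {c c' : PathSpace X x} {n : ℕ}
    (h : ∀ i < n, c.1 i = c'.1 i) : X.o (c.1 n) = X.o (c'.1 n) := by
  cases n with
  | zero => rw [c.2.1, c'.2.1]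
  | succ n => rw [c.2.2, c'.2.2, h n (Nat.lt_succ_self n)]

variable [Fintype E₀]

theorem RegularCovering.exists_edge_from (π : RegularCovering Γ X X₀)
    (P : TransitionProbability X₀) (y : V) :
    ∃ e, X.o e = y := by
  classical
  have h1 : ∃ e₀, X₀.o e₀ = π.vert y := by
    by_contra! h
    have h2 := P.sum_eq_one (π.vert y)
    rw [Finset.sum_eq_zero fun e he => absurd (Finset.mem_filter.mp he).2 (h e)] at h2
    exact zero_ne_one h2
  obtain ⟨e₀, he₀⟩ := h1
  obtain ⟨e, he, -⟩ := π.star_bijective y e₀ he₀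
  exact ⟨e, he.1⟩

/-- The initial segment of a path followed by a given edge extends to an infinite path. -/
theorem RegularCovering.exists_agree_of_edge (π : RegularCovering Γ X X₀)
    (P : TransitionProbability X₀) {x : V} (c : PathSpace X x) (n : ℕ) {e : E}
    (he : X.o e = X.o (c.1 n)) :
    ∃ c' : PathSpace X x, (∀ i < n, c'.1 i = c.1 i) ∧ c'.1 n = e := by
  choose next hnext using fun e => π.exists_edge_from P (X.t e)
  have h0 : X.o (if 0 < n then c.1 0 else next^[0 - n] e) = x := by
    split_ifs with h
    · exact c.2.1
    · obtain rfl : n = 0 := by omega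
      exact he.trans c.2.1
  refine ⟨⟨fun i => if i < n then c.1 i else next^[i - n] e, h0, fun i => ?_⟩, fun i hi => ?_, ?_⟩
  · rcases lt_trichotomy (i + 1) n with h | h | h
    · simp only [if_pos h, if_pos (show i < n by omega)]
      exact c.2.2 i
    · subst h
      simp only [lt_irrefl, if_false, if_pos (Nat.lt_succ_self i), Nat.sub_self,
        Function.iterate_zero, id]
      rw [he, c.2.2]
    · simp only [if_neg (show ¬ i + 1 < n by omega), if_neg (show ¬ i < n by omega),
        show i + 1 - n = (i - n) + 1 by omega, Function.iterate_succ_apply', hnext]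
  · exact if_pos hi
  · simp

variable [MeasurableSpace E] [DiscreteMeasurableSpace E] {P : TransitionProbability X₀} {x : V}
  {ℙ : Measure (PathSpace X x)}

/-- Given the first `n` edges, the projections of the next `k` edges have the law of the walk on the
base graph; the induction splits the event along the projection of the next edge. -/
theorem IsRandomWalkLaw.measure_agree_projectedEdges
    (hℙ : IsRandomWalkLaw X (fun e => P.p (π.edge e)) x ℙ) (k n : ℕ) (c₀ : PathSpace X x)
    (S : Set (List E₀)) :
    ℙ {c | (∀ i < n, c.1 i = c₀.1 i) ∧ π.projectedEdges c n k ∈ S} =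
      ENNReal.ofReal ((∏ i ∈ Finset.range n, P.p (π.edge (c₀.1 i))) *
        (P.walk k (π.vert (X.o (c₀.1 n)))).prob S) := by
  induction k generalizing n c₀ S with
  | zero =>
    have h1 : ∀ c : PathSpace X x, π.projectedEdges c n 0 = [] := fun c => List.ofFn_zero
    simp only [h1, Expectation.prob, TransitionProbability.walk_zero]
    by_cases h : [] ∈ S
    · simp only [h, and_true, Set.indicator_of_mem, Pi.one_apply, mul_one]
      exact hℙ n c₀
    · simp [h]
  | succ k ih =>
    classical
    set A : Set (PathSpace X x) :=
      {c | (∀ i < n, c.1 i = c₀.1 i) ∧ π.projectedEdges c n (k + 1) ∈ S} with hA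
    set f : PathSpace X x → E₀ := fun c => π.edge (c.1 n) with hf
    have hcoord : Measurable fun c : PathSpace X x => c.1 n :=
      (measurable_pi_apply n).comp measurable_subtype_coe
    have hmeas : ∀ e₀ ∈ (Finset.univ : Finset E₀), MeasurableSet (f ⁻¹' {e₀}) := fun e₀ _ =>
      hcoord (MeasurableSet.of_discrete (s := π.edge ⁻¹' {e₀}))
    have hsum := sum_measure_preimage_singleton (μ := ℙ.restrict A) Finset.univ hmeas
    rw [Finset.coe_univ, Set.preimage_univ, Measure.restrict_apply_univ] at hsum
    have hterm : ∀ e₀, (ℙ.restrict A) (f ⁻¹' {e₀}) =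
        if X₀.o e₀ = π.vert (X.o (c₀.1 n)) then
          ENNReal.ofReal ((∏ i ∈ Finset.range n, P.p (π.edge (c₀.1 i))) *
            (P.p e₀ * (P.walk k (X₀.t e₀)).prob {l | e₀ :: l ∈ S}))
        else 0 := by
      intro e₀
      rw [Measure.restrict_apply (hmeas e₀ (Finset.mem_univ _))]
      split_ifs with ho
      · obtain ⟨e, ⟨he, rfl⟩, huniq⟩ := π.star_bijective _ _ ho
        obtain ⟨c₁, hc₁, hc₁n⟩ := π.exists_agree_of_edge P c₀ n he
        have hset : f ⁻¹' {π.edge e} ∩ A = {c | (∀ i < n + 1, c.1 i = c₁.1 i) ∧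
            π.projectedEdges c (n + 1) k ∈ {l | π.edge e :: l ∈ S}} := by
          ext c
          simp only [hA, hf, Set.mem_inter_iff, Set.mem_preimage, Set.mem_singleton_iff,
            Set.mem_ofPred_eq, π.projectedEdges_succ]
          constructor
          · rintro ⟨h1, h2, h3⟩
            refine ⟨fun i hi => ?_, h1 ▸ h3⟩
            rcases Nat.lt_succ_iff_lt_or_eq.mp hi with hi | rfl
            · rw [h2 i hi, hc₁ i hi]
            · rw [hc₁n]
              exact huniq _ ⟨PathSpace.o_eq_of_agree h2, h1⟩
          · rintro ⟨h1, h2⟩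
            have h3 : c.1 n = e := (h1 n (Nat.lt_succ_self n)).trans hc₁n
            refine ⟨by rw [h3], fun i hi => ?_, by rw [h3]; exact h2⟩
            rw [h1 i (Nat.lt_succ_of_lt hi), hc₁ i hi]
        have hprod : ∏ i ∈ Finset.range n, P.p (π.edge (c₁.1 i)) =
            ∏ i ∈ Finset.range n, P.p (π.edge (c₀.1 i)) :=
          Finset.prod_congr rfl fun i hi => by rw [hc₁ i (Finset.mem_range.mp hi)]
        rw [hset, ih, Finset.prod_range_succ, hprod, hc₁n, c₁.2.2, hc₁n, π.t_edge, mul_assoc]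
      · rw [← measure_empty (μ := ℙ)]
        congr 1
        refine Set.eq_empty_of_forall_notMem fun c hc => ho ?_
        obtain ⟨h1, h2, -⟩ := hc
        rw [← show π.edge (c.1 n) = e₀ from h1, π.o_edge, PathSpace.o_eq_of_agree h2]
    rw [← hsum, Finset.sum_congr rfl fun e₀ _ => hterm e₀, ← Finset.sum_filter,
      ← ENNReal.ofReal_sum_of_nonneg, ← Finset.mul_sum]
    · rfl
    · exact fun e₀ _ => mul_nonneg (Finset.prod_nonneg fun i _ => (P.pos _).le)
        (mul_nonneg (P.pos _).le (Expectation.prob_nonneg _ _))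

theorem IsRandomWalkLaw.measure_projectedEdges [IsProbabilityMeasure ℙ]
    (hℙ : IsRandomWalkLaw X (fun e => P.p (π.edge e)) x ℙ) (k : ℕ) (S : Set (List E₀)) :
    ℙ {c | π.projectedEdges c 0 k ∈ S} = ENNReal.ofReal ((P.walk k (π.vert x)).prob S) := by
  obtain ⟨c₀⟩ := nonempty_of_isProbabilityMeasure ℙ
  have h := hℙ.measure_agree_projectedEdges π k 0 c₀ S
  simpa [c₀.2.1] using h

end Law

section ScaledPath

theorem interpolatedPath_congr {d n : ℕ} {w w' : ℕ → EuclideanSpace ℝ (Fin d)}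
    (h : ∀ k < n, w k = w' k) : interpolatedPath n w = interpolatedPath n w' := by
  refine Subtype.ext (ContinuousMap.ext fun t => ?_)
  change interpolate n w t = interpolate n w' t
  rw [interpolate_eq_sum n w t.2.1 t.2.2, interpolate_eq_sum n w' t.2.1 t.2.2]
  exact Finset.sum_congr rfl fun k hk => by rw [h k (Finset.mem_range.mp hk)]

variable {𝔤 : Type*} [LieRing 𝔤] [LieAlgebra ℝ 𝔤] {W : Submodule ℝ 𝔤}
  {hW : IsCompl W (commutatorPart 𝔤)} {Γ : Type*} [Group Γ] {V E V₀ E₀ : Type*} [MulAction Γ V]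
  [MulAction Γ E] {X : OrientedGraph V E} {X₀ : OrientedGraph V₀ E₀}

/-- The centred steps of the realization depend on the projected edges only. -/
theorem scaledPath_eq_listPath (π : RegularCovering Γ X X₀) {Φ : V → NilpotentLieGroup 𝔤}
    {ℓ : Γ → W} (hφ : ∀ (γ : Γ) y, logOne hW (Φ (γ • y)) = ℓ γ + logOne hW (Φ y)) (v : W) {d : ℕ}
    (b : Module.Basis (Fin d) ℝ W) (a : ℕ → ℝ) {x : V} (n : ℕ) (c : PathSpace X x) :
    scaledPath hW X Φ v b a n c = listPath
      (fun e₀ => WithLp.toLp 2 (b.equivFun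
        (π.incrementChain (φ := fun y => logOne hW (Φ y)) hφ (X₀.edge e₀) - v))) a n
      (π.projectedEdges c 0 n) := by
  refine interpolatedPath_congr fun k hk => ?_
  rw [RegularCovering.projectedEdges, List.map_ofFn, List.getD_eq_getElem _ _ (by simpa using hk),
    List.getElem_ofFn]
  simp only [Function.comp_apply, zero_add]
  rw [RegularCovering.incrementChain_edge, centredStep, c.2.2]

end ScaledPath

end CoveringMDP

end

open CoveringMDP in
theorem mainTheorem3
    {𝔤 : Type*} [LieRing 𝔤] [LieAlgebra ℝ 𝔤] [FiniteDimensional ℝ 𝔤] [LieRing.IsNilpotent 𝔤]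
    [TopologicalSpace 𝔤] [IsTopologicalAddGroup 𝔤] [ContinuousSMul ℝ 𝔤] [T2Space 𝔤]
    (W : Submodule ℝ 𝔤) (hW : IsCompl W (commutatorPart 𝔤))
    {d : ℕ} (b : Module.Basis (Fin d) ℝ W)
    {Γ : Type*} [Group Γ] (ι : Γ →ₙ* NilpotentLieGroup 𝔤) (hι : IsCocompactLattice ι)
    {V E V₀ E₀ : Type*} [Fintype V₀] [Fintype E₀] [MulAction Γ V] [MulAction Γ E]
    [MeasurableSpace E] [DiscreteMeasurableSpace E]
    (X : OrientedGraph V E) (X₀ : OrientedGraph V₀ E₀) (hX : X.Connected)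
    (π : RegularCovering Γ X X₀)
    (p : TransitionProbability X₀) (m : InvariantMeasure p)
    (Φ : V → NilpotentLieGroup 𝔤) (hΦ : ∀ (γ : Γ) (y : V), Φ (γ • y) = ι γ * Φ y)
    (x : V) (ℙ : MeasureTheory.Measure (PathSpace X x)) [MeasureTheory.IsProbabilityMeasure ℙ]
    (hℙ : IsRandomWalkLaw X (fun e => p.p (π.edge e)) x ℙ)
    (a : ℕ → ℝ) (ha_pos : ∀ n, 0 < a n) (ha_mono : Monotone a)
    (ha_sqrt : Filter.Tendsto (fun n : ℕ => a n / Real.sqrt n) Filter.atTop Filter.atTop)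
    (ha_lin : Filter.Tendsto (fun n : ℕ => a n / n) Filter.atTop (nhds 0)) :
    IsGoodRateFunction (quadraticAction (m.albaneseGram (π.rhoR hW ι) b)) ∧
      SatisfiesLDP ℙ (scaledPath hW X Φ (π.rhoR hW ι m.gammaP) b a) (fun n => a n ^ 2 / n)
        (quadraticAction (m.albaneseGram (π.rhoR hW ι) b)) := by
  have hX₀ : X₀.Connected := π.connected_base hX
  obtain ⟨B, κ, hκ, hκB, hB, hN⟩ := m.exists_sqrt_albaneseGram (π.rhoR hW ι) hX₀
    (π.eq_zero_of_comp_rhoR_eq_zero hW hι hX x) b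
  refine ⟨isGoodRateFunction_quadraticAction hB hκ hκB, ?_⟩
  have hℓ : ∀ γ γ', logOne hW (ι (γ * γ')) = logOne hW (ι γ) + logOne hW (ι γ') := fun γ γ' => by
    rw [map_mul, logOne_mul]
  have hφ : ∀ (γ : Γ) y, logOne hW (Φ (γ • y)) = logOne hW (ι γ) + logOne hW (Φ y) :=
    fun γ y => by rw [hΦ, logOne_mul]
  set D := π.incrementChain (φ := fun y => logOne hW (Φ y)) hφ
  set ξ : E₀ → EuclideanSpace ℝ (Fin d) := fun e₀ => WithLp.toLp 2
    (b.equivFun (D (X₀.edge e₀) - π.rhoR hW ι m.gammaP)) with hξ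
  have hvar : ∀ θ, p.HasAsymptoticVariance (fun e => inner ℝ θ (B (ξ e))) (‖θ‖ ^ 2) := fun θ => by
    set η : Module.Dual ℝ W := ((innerSL ℝ θ).comp B).toLinearMap ∘ₗ
      (WithLp.linearEquiv 2 ℝ (Fin d → ℝ)).symm.toLinearMap ∘ₗ b.equivFun.toLinearMap with hη
    have hη_apply : ∀ w, η w = inner ℝ θ (B (WithLp.toLp 2 (b.equivFun w))) := fun w => rfl
    have h1 : (η ∘ₗ D) ∘ₗ X₀.H1.subtype = η ∘ₗ π.rhoR hW ι := by
      rw [LinearMap.comp_assoc, π.incrementChain_comp_subtype (φ := fun y => logOne hW (Φ y)) hφ hℓ]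
      rfl
    have h2 := m.hasAsymptoticVariance hX₀ h1
    rw [hN θ η hη_apply] at h2
    convert h2 using 2 with e
    rw [hξ, ← hη_apply, map_sub]
    rfl
  refine satisfiesLDP_of_gaussian hB hκ hκB (tendsto_speed ha_sqrt)
    (fun N hN => hasGaussianCgf_gridVector p hvar ha_pos ha_sqrt ha_lin (π.vert x) hN)
    (exponentiallySmallOscillation_listPath p hvar hκ hκB ha_pos ha_sqrt ha_lin (π.vert x))
    fun n A => ?_
  rw [← hℙ.measure_projectedEdges π n {l | listPath ξ a n l ∈ A}]
  simp only [scaledPath_eq_listPath π hφ]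
  rfl
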